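/- **Setup.** Let $\Gamma$ be a finite group, $R(\Gamma)$ the space of complex class functions on $\Gamma$, $\Gamma_*$ its set of conjugacy classes, and $\zeta_c$ the order of the centralizer of an element of $c\in\Gamma_*$. Let $\xi\in R(\Gamma)$ be self-dual, i.e. $\xi(x^{-1})=\xi(x)$, and put $\langle f,g\rangle_\xi=|\Gamma|^{-1}\sum_{x\in\Gamma}\xi(x)f(x)g(x^{-1})$ on $R(\Gamma)$ (a symmetric bilinear form). *Spin wreath products.* Let $\tilde S_n$ be the group generated by $z,t_1,\dots,t_{n-1}$ with $z$ central, $z^2=1$, $t_i^2=z$, $(t_it_{i+1})^3=z$, and $t_it_j=zt_jt_i$ for $i>j+1$; it acts on $\Gamma^n$ through $\tilde S_n\to S_n$, $t_i\mapsto(i,i+1)$, $z\mapsto 1$. Put $\tilde\Gamma_n=\Gamma^n\rtimes\tilde S_n$, with the parity given by: $\Gamma^n$ and $z$ even, each $t_i$ odd. Let $R^-(\tilde\Gamma_n)$ be the space of complex class functions $f$ on $\tilde\Gamma_n$ with $f(zx)=-f(x)$ that vanish on all odd elements, and $R^-_\Gamma=\bigoplus_{n\ge 0}R^-(\tilde\Gamma_n)$.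 For $x=(g,t)\in\tilde\Gamma_n$ let $\eta_n(\xi)(x)$ be the product, over the cycles $(i_1\,i_2\cdots i_k)$ (fixed points included) of the permutation underlying $t$, of $\xi(g_{i_k}g_{i_{k-1}}\cdots g_{i_1})$; the element $g_{i_k}\cdots g_{i_1}$, well defined up to conjugacy, is the cycle product. Set $\langle f,g\rangle_\xi=|\tilde\Gamma_n|^{-1}\sum_{x\in\tilde\Gamma_n}\eta_n(\xi)(x)f(x)g(x^{-1})$ on $R^-(\tilde\Gamma_n)$, let distinct summands of $R^-_\Gamma$ be orthogonal, and let $R^0_\Gamma$ be the radical of the resulting form on $R^-_\Gamma$. *Split classes.* Let $\mathcal{OP}_n(\Gamma_*)$ be the set of functions $\rho$ from $\Gamma_*$ to partitions with odd parts, of total size $n$. Let $l(\rho)$ be the total number of parts, $m_k(\rho(c))$ the multiplicity of $k$ in $\rho(c)$, and $Z_\rho=\prod_{c\in\Gamma_*}\zeta_c^{l(\rho(c))}\prod_k k^{m_k(\rho(c))}m_k(\rho(c))!$. Let $D^+_\rho$ be the conjugacy class in $\tilde\Gamma_n$ of $(g,t^\rho)$, where $t^\rho$ is the product of the words $t_at_{a+1}\cdots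 t_{a+k-2}$ over consecutive blocks $\{a,\dots,a+k-1\}$ of $\{1,\dots,n\}$, one block for each part $k$ of each $\rho(c)$, and the cycle product of $g$ on a block belonging to a part of $\rho(c)$ lies in $c$. Let $D^-_\rho=zD^+_\rho$, and $f(\rho)=f(D^+_\rho)$ for $f\in R^-(\tilde\Gamma_n)$. For $n\geq1$ odd and $c\in\Gamma_*$ write $D_n(c)^\pm$ for $D_\rho^\pm$ where $\rho$ has the single part $n$, at $c$. For $\gamma\in R(\Gamma)$ let $\sigma_n(\gamma)\in R^-(\tilde\Gamma_n)$ take the value $\pm\frac{n}{\sqrt2}\gamma(c)$ on $D_n(c)^{\pm}$ for every $c$ and $0$ elsewhere. *Operators.* Let $\tilde\Gamma_n\hat\times\tilde\Gamma_m$ be the subgroup of $\tilde\Gamma_{n+m}$ generated by the images of $\tilde\Gamma_n$ (acting on the first $n$ letters) and of $\tilde\Gamma_m$ (on the last $m$ letters). For $f\in R^-(\tilde\Gamma_n)$, $g\in R^-(\tilde\Gamma_m)$ let $f\hat\otimes g$ be the function on it with $(f\hat\otimes g)(xy)=f(x)g(y)$ for $x\in\tilde\Gamma_n$, $y\in\tilde\Gamma_m$.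 For $n\ge 1$ odd and $\gamma\in R(\Gamma)$ let $\tilde a_{-n}(\gamma)$ be the operator on $R^-_\Gamma$ given on $R^-(\tilde\Gamma_m)$ by $$f\mapsto \mathrm{Ind}_{\tilde\Gamma_n\hat\times\tilde\Gamma_m}^{\tilde\Gamma_{n+m}}\bigl(\sigma_n(\gamma)\hat\otimes f\bigr),$$ and let $\tilde a_n(\gamma)$ be the operator which kills $R^-(\tilde\Gamma_m)$ for $m<n$ and on $R^-(\tilde\Gamma_{n+m})$ is the restriction to $\tilde\Gamma_n\hat\times\tilde\Gamma_m$ followed by the pairing $\langle\sigma_n(\gamma),\cdot\rangle_\xi$ in the first tensor factor, with values in $R^-(\tilde\Gamma_m)$. *Heisenberg algebra and Fock space.* $\hat{\mathfrak h}_{\Gamma,\xi}[-1]$ is the complex Lie algebra spanned by the symbols $a_n(\gamma)$ ($n$ an odd integer, $\gamma\in R(\Gamma)$, linear in $\gamma$, with no other linear relations) and a central element $C$, with $$[a_m(\gamma),a_n(\gamma')]=\tfrac m2\,\delta_{m,-n}\langle\gamma,\gamma'\rangle_\xi\,C .$$ Let $S^-_\Gamma$ be the symmetric algebra on the $a_{-n}(\gamma)$,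 $n\geq 1$ odd. The algebra $\hat{\mathfrak h}_{\Gamma,\xi}[-1]$ acts on it as follows: $C$ acts as the identity, $a_{-n}(\gamma)$ ($n\ge1$) by multiplication, and $a_n(\gamma)$ ($n\ge 1$) as the derivation with $a_{-m}(\gamma')\mapsto\frac n2\delta_{n,m}\langle\gamma,\gamma'\rangle_\xi$. Let $S^0_\Gamma$ be the ideal of $S^-_\Gamma$ generated by all $a_{-n}(\gamma)$ with $n\ge1$ odd and $\gamma$ in the radical of $\langle\ ,\ \rangle_\xi$ on $R(\Gamma)$, and $\overline S_\Gamma=S^-_\Gamma/S^0_\Gamma$. For $c\in\Gamma_*$ put $a_{-n}(c)=\sum_{\gamma}\gamma(c^{-1})a_{-n}(\gamma)$, summed over the irreducible characters of $\Gamma$ (equivalently $a_{-n}(c)=a_{-n}(\zeta_c1_c)$), and for $\rho\in\mathcal{OP}_n(\Gamma_*)$ put $a'_{-\rho}=\prod_{c}\prod_{k\in\rho(c)}a_{-k}(c)$, over the parts $k$ of $\rho(c)$. The characteristic map $\mathrm{ch}:R^-_\Gamma\to S^-_\Gamma$ is the linear map with $$\mathrm{ch}(f)=\sum_{\rho\in\mathcal{OP}_n(\Gamma_*)}2^{l(\rho)/2}Z_\rho^{-1}f(\rho)\,a'_{-\rho}\qquad(f\in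 R^-(\tilde\Gamma_n)).$$ **Theorem.** 1. Letting $a_n(\gamma)$ act as $\tilde a_n(\gamma)$ (for all odd $n\in\mathbb Z$ and all $\gamma\in R(\Gamma)$) and $C$ as the identity defines a representation of $\hat{\mathfrak h}_{\Gamma,\xi}[-1]$ on $R^-_\Gamma$. 2. $R^0_\Gamma$ is a subrepresentation of $R^-_\Gamma$, and the quotient $\overline R_\Gamma=R^-_\Gamma/R^0_\Gamma$ is irreducible. 3. $S^0_\Gamma$ is a subrepresentation of $S^-_\Gamma$; the map $\mathrm{ch}$ is an isomorphism of representations $R^-_\Gamma\to S^-_\Gamma$, restricts to an isomorphism of representations $R^0_\Gamma\to S^0_\Gamma$, and induces an isomorphism of representations $\overline R_\Gamma\to\overline S_\Gamma$. -/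

import Mathlib

/-!
# Spin symmetric groups, spin wreath products and the twisted Heisenberg algebra
-/

attribute [local instance] LieRing.ofAssociativeRing

noncomputable section

namespace SpinWreath

/-! ## The spin symmetric group -/

/-- Generators `z` and `t i` (`i = 0, …, n - 2`) of the double cover of `S_n`;
`t i` lies over the transposition of the (zero-based) letters `i` and `i + 1`. -/
inductive SpinGen (n : ℕ) : Type
  | z : SpinGen n
  | t (i : ℕ) (h : i + 1 < n) : SpinGen n

/-- The defining relators. -/
inductive SpinRel (n : ℕ) : FreeGroup (SpinGen n) → Prop
  | z_sq : SpinRel n (FreeGroup.of SpinGen.z * FreeGroup.of SpinGen.z)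
  | t_sq (i : ℕ) (h : i + 1 < n) :
      SpinRel n (FreeGroup.of (SpinGen.t i h) * FreeGroup.of (SpinGen.t i h) *
        (FreeGroup.of SpinGen.z)⁻¹)
  | braid (i : ℕ) (h : i + 1 < n) (h' : i + 1 + 1 < n) :
      SpinRel n ((FreeGroup.of (SpinGen.t i h) * FreeGroup.of (SpinGen.t (i + 1) h')) ^ 3 *
        (FreeGroup.of SpinGen.z)⁻¹)
  | far (i j : ℕ) (hi : i + 1 < n) (hj : j + 1 < n) (hij : j + 1 < i) :
      SpinRel n (FreeGroup.of (SpinGen.t i hi) * FreeGroup.of (SpinGen.t j hj) *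
        (FreeGroup.of SpinGen.z * FreeGroup.of (SpinGen.t j hj) *
          FreeGroup.of (SpinGen.t i hi))⁻¹)
  | z_comm (i : ℕ) (h : i + 1 < n) :
      SpinRel n (FreeGroup.of SpinGen.z * FreeGroup.of (SpinGen.t i h) *
        (FreeGroup.of (SpinGen.t i h) * FreeGroup.of SpinGen.z)⁻¹)

/-- The spin group `S̃_n`: generators `z`, `t_i`; relations `z² = 1`, `t_i² = (t_i t_{i+1})³ = z`,
`t_i t_j = z t_j t_i` for `i > j + 1`, and `z t_i = t_i z`. -/
abbrev SpinSym (n : ℕ) : Type := PresentedGroup {w | SpinRel n w}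

namespace SpinSym

variable {n : ℕ}

/-- The central element `z`. -/
def z (n : ℕ) : SpinSym n := PresentedGroup.of SpinGen.z

/-- The generator `t i`; out of range the value is `1` by convention. -/
def t (n : ℕ) (i : ℕ) : SpinSym n :=
  if h : i + 1 < n then PresentedGroup.of (SpinGen.t i h) else 1

theorem t_eq {i : ℕ} (h : i + 1 < n) : t n i = PresentedGroup.of (SpinGen.t i h) := dif_pos h

theorem z_mul_z : z n * z n = 1 := by
  have := PresentedGroup.one_of_mem (rels := {w | SpinRel n w}) SpinRel.z_sq
  simpa [z, PresentedGroup.of] using this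

theorem t_mul_t {i : ℕ} (h : i + 1 < n) : t n i * t n i = z n := by
  have := PresentedGroup.one_of_mem (rels := {w | SpinRel n w}) (SpinRel.t_sq i h)
  rw [map_mul, map_inv, mul_inv_eq_one] at this
  simpa [z, t_eq h, PresentedGroup.of] using this

theorem braid {i : ℕ} (h : i + 1 + 1 < n) : (t n i * t n (i + 1)) ^ 3 = z n := by
  have := PresentedGroup.one_of_mem (rels := {w | SpinRel n w})
    (SpinRel.braid i (by omega) h)
  rw [map_mul, map_inv, mul_inv_eq_one] at this
  rw [t_eq h, t_eq (show i + 1 < n by omega)]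
  simpa [z, PresentedGroup.of] using this

theorem far {i j : ℕ} (hi : i + 1 < n) (hij : j + 1 < i) :
    t n i * t n j = z n * t n j * t n i := by
  have := PresentedGroup.one_of_mem (rels := {w | SpinRel n w})
    (SpinRel.far i j hi (by omega) hij)
  rw [map_mul, map_inv, mul_inv_eq_one] at this
  rw [t_eq hi, t_eq (show j + 1 < n by omega)]
  simpa [z, PresentedGroup.of] using this

/-- Homomorphisms out of `S̃_n` from images of the generators. -/
def lift {G : Type*} [Group G] (Z : G) (T : ∀ i, i + 1 < n → G) (h1 : Z * Z = 1)
    (h2 : ∀ i h, T i h * T i h = Z) (h3 : ∀ i h h', (T i h * T (i + 1) h') ^ 3 = Z)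
    (h4 : ∀ i j hi hj, j + 1 < i → T i hi * T j hj = Z * T j hj * T i hi)
    (h5 : ∀ i h, Z * T i h = T i h * Z) : SpinSym n →* G :=
  PresentedGroup.toGroup (rels := {w | SpinRel n w})
    (f := fun g => match g with
      | SpinGen.z => Z
      | SpinGen.t i h => T i h) (by
    rintro r hr
    cases hr with
    | z_sq => simpa using h1
    | t_sq i h => simpa [mul_inv_eq_one] using h2 i h
    | braid i h h' => simpa [mul_inv_eq_one] using h3 i h h'
    | far i j hi hj hij =>
      rw [map_mul, map_inv, mul_inv_eq_one]; simpa using h4 i j hi hj hij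
    | z_comm i h => rw [map_mul, map_inv, mul_inv_eq_one]; simpa using h5 i h)

section lift
variable {G : Type*} [Group G] {Z : G} {T : ∀ i, i + 1 < n → G} {h1 : Z * Z = 1}
    {h2 : ∀ i h, T i h * T i h = Z} {h3 : ∀ i h h', (T i h * T (i + 1) h') ^ 3 = Z}
    {h4 : ∀ i j hi hj, j + 1 < i → T i hi * T j hj = Z * T j hj * T i hi}
    {h5 : ∀ i h, Z * T i h = T i h * Z}

@[simp] theorem lift_z : lift Z T h1 h2 h3 h4 h5 (z n) = Z := by
  simp [lift, z]

theorem lift_t {i : ℕ} (h : i + 1 < n) : lift Z T h1 h2 h3 h4 h5 (t n i) = T i h := by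
  rw [t_eq h]; simp [lift]

end lift

theorem closure_gens : Subgroup.closure (insert (z n) {x | ∃ i, i + 1 < n ∧ x = t n i}) = ⊤ := by
  rw [eq_top_iff, ← PresentedGroup.closure_range_of]
  apply Subgroup.closure_mono
  rintro _ ⟨g, rfl⟩
  cases g with
  | z => exact Or.inl rfl
  | t i h => exact Or.inr ⟨i, h, (t_eq h).symm⟩

theorem inv_z : (z n)⁻¹ = z n := inv_eq_of_mul_eq_one_left z_mul_z

theorem inv_t {i : ℕ} (h : i + 1 < n) : (t n i)⁻¹ = z n * t n i := by
  rw [inv_eq_iff_mul_eq_one]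
  rw [← mul_assoc, ← t_mul_t h]
  have : t n i * (t n i * t n i) * t n i = z n * z n := by rw [← t_mul_t h]; group
  rw [this, z_mul_z]

/-- Induction on words in the generators. -/
theorem induction_gens {p : SpinSym n → Prop} (one : p 1) (hz : ∀ x, p x → p (x * z n))
    (ht : ∀ x i, i + 1 < n → p x → p (x * t n i)) (x : SpinSym n) : p x := by
  have hx : x ∈ Subgroup.closure (insert (z n) {x | ∃ i, i + 1 < n ∧ x = t n i}) := by
    rw [closure_gens]; trivial
  induction hx using Subgroup.closure_induction_right with
  | one => exact one
  | mul_right x _ y hy h =>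
    rcases hy with rfl | ⟨i, hi, rfl⟩
    · exact hz _ h
    · exact ht _ i hi h
  | mul_inv_cancel x _ y hy h =>
    rcases hy with rfl | ⟨i, hi, rfl⟩
    · rw [inv_z]; exact hz _ h
    · rw [inv_t hi, ← mul_assoc]; exact ht _ i hi (hz _ h)

theorem z_comm (x : SpinSym n) : z n * x = x * z n := by
  induction x using induction_gens with
  | one => simp
  | hz x h => rw [← mul_assoc, h]
  | ht x i hi h =>
    have := t_mul_t hi
    have h2 : z n * t n i = t n i * z n := by rw [← this]; group
    rw [← mul_assoc, h, mul_assoc, h2, mul_assoc]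

theorem hom_ext {G : Type*} [Group G] {f g : SpinSym n →* G} (hz : f (z n) = g (z n))
    (ht : ∀ i, i + 1 < n → f (t n i) = g (t n i)) : f = g := by
  ext x
  cases x with
  | z => exact hz
  | t i h => have := ht i h; rwa [t_eq h] at this

/-! ### Finiteness -/

theorem braid' {i : ℕ} (h : i + 1 + 1 < n) :
    t n (i + 1) * t n i * t n (i + 1) = t n i * t n (i + 1) * t n i := by
  have hb := braid h
  have ha := inv_t (n := n) (i := i) (by omega)
  have hb' := inv_t (n := n) (i := i + 1) h
  have e1 : t n i * t n (i + 1) * t n i =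
      (t n i * t n (i + 1)) ^ 3 * ((t n (i + 1))⁻¹ * (t n i)⁻¹ * (t n (i + 1))⁻¹) := by
    simp [pow_succ, mul_assoc]
  rw [e1, hb, ha, hb']
  have : ∀ x : SpinSym n, z n * (x * z n) = x := fun x => by
    rw [← mul_assoc, z_comm, mul_assoc, z_mul_z, mul_one]
  simp only [← mul_assoc, z_comm]
  simp only [mul_assoc, z_mul_z, mul_one]
  rw [this]

/-- The subgroup generated by `z` and the `t i` with `i < k`. -/
def low (n k : ℕ) : Subgroup (SpinSym n) :=
  Subgroup.closure (insert (z n) {x | ∃ i, i < k ∧ i + 1 < n ∧ x = t n i})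

/-- `desc k d = t_k t_{k-1} ⋯ t_{k-d+1}`. -/
def desc (n k : ℕ) : ℕ → SpinSym n
  | 0 => 1
  | d + 1 => desc n k d * t n (k - d)

theorem z_mem_low (k : ℕ) : z n ∈ low n k := Subgroup.subset_closure (Or.inl rfl)

theorem t_mem_low {k i : ℕ} (h : i < k) : t n i ∈ low n k := by
  by_cases hi : i + 1 < n
  · exact Subgroup.subset_closure (Or.inr ⟨i, h, hi, rfl⟩)
  · rw [t, dif_neg hi]; exact one_mem _

theorem desc_comm {k i : ℕ} (hk : k + 1 < n) (d : ℕ) (h : i + d < k) :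
    ∃ c : SpinSym n, c ∈ low n 0 ∧ desc n k d * t n i = c * (t n i * desc n k d) := by
  induction d with
  | zero => exact ⟨1, one_mem _, by simp [desc]⟩
  | succ d ih =>
    obtain ⟨c, hc, e⟩ := ih (by omega)
    refine ⟨z n * c, mul_mem (z_mem_low 0) hc, ?_⟩
    rw [desc, mul_assoc, far (by omega) (by omega), ← mul_assoc, ← mul_assoc, ← z_comm,
      mul_assoc (z n), e]
    simp only [mul_assoc]

theorem desc_shift {k i : ℕ} (hk : k + 1 < n) (hi : i + 1 ≤ k) (d : ℕ) (h : k < i + d)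
    (hd : d ≤ k + 1) :
    ∃ c : SpinSym n, c ∈ low n 0 ∧ desc n k d * t n (i + 1) = c * (t n i * desc n k d) := by
  induction d with
  | zero => omega
  | succ d ih =>
    by_cases hlt : k < i + d
    · obtain ⟨c, hc, e⟩ := ih hlt (by omega)
      refine ⟨z n * c, mul_mem (z_mem_low 0) hc, ?_⟩
      have hf := far (n := n) (i := i + 1) (j := k - d) (by omega) (by omega)
      have hf' : t n (k - d) * t n (i + 1) = z n * t n (i + 1) * t n (k - d) := by
        rw [mul_assoc, hf]
        simp only [← mul_assoc, z_mul_z, one_mul]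
      rw [desc, mul_assoc, hf', ← mul_assoc, ← mul_assoc, ← z_comm, mul_assoc (z n), e]
      simp only [mul_assoc]
    · have hd0 : k = i + d := by omega
      obtain ⟨d, rfl⟩ : ∃ d', d = d' + 1 := ⟨d - 1, by omega⟩
      obtain ⟨c, hc, e⟩ := desc_comm (i := i) hk d (by omega)
      refine ⟨c, hc, ?_⟩
      have e1 : k - d = i + 1 := by omega
      have e2 : k - (d + 1) = i := by omega
      rw [desc, desc, e1, e2]
      calc _ = desc n k d * (t n (i + 1) * t n i * t n (i + 1)) := by simp only [mul_assoc]
        _ = desc n k d * t n i * (t n (i + 1) * t n i) := by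
          rw [braid' (by omega)]; simp only [mul_assoc]
        _ = _ := by rw [e]; simp only [mul_assoc]

theorem low_mono {k l : ℕ} (h : k ≤ l) : low n k ≤ low n l := by
  apply Subgroup.closure_mono
  apply Set.insert_subset_insert
  rintro x ⟨i, hi, hi', rfl⟩
  exact ⟨i, by omega, hi', rfl⟩

theorem low_succ {k : ℕ} (hk : k + 1 < n) (x : SpinSym n) (hx : x ∈ low n (k + 1)) :
    ∃ l ∈ low n k, ∃ d ≤ k + 1, x = l * desc n k d := by
  have key : ∀ i, i < k + 1 → ∀ y : SpinSym n,
      (∃ l ∈ low n k, ∃ d ≤ k + 1, y = l * desc n k d) →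
      ∃ l ∈ low n k, ∃ d ≤ k + 1, y * t n i = l * desc n k d := by
    rintro i hi y ⟨l, hl, d, hd, rfl⟩
    rcases lt_trichotomy (i + d) k with h | h | h
    · obtain ⟨c, hc, e⟩ := desc_comm (i := i) hk d h
      refine ⟨l * c * t n i, mul_mem (mul_mem hl (low_mono (Nat.zero_le _) hc))
        (t_mem_low (by omega)), d, hd, ?_⟩
      rw [mul_assoc, e]; simp only [mul_assoc]
    · refine ⟨l, hl, d + 1, by omega, ?_⟩
      rw [desc, show k - d = i by omega, mul_assoc]
    · by_cases h' : i + d = k + 1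
      · obtain ⟨d, rfl⟩ : ∃ d', d = d' + 1 := ⟨d - 1, by omega⟩
        refine ⟨l * z n, mul_mem hl (z_mem_low k), d, by omega, ?_⟩
        rw [desc, show k - d = i by omega, mul_assoc, mul_assoc, t_mul_t (by omega), ← z_comm,
          mul_assoc]
      · obtain ⟨i, rfl⟩ : ∃ i', i = i' + 1 := ⟨i - 1, by omega⟩
        obtain ⟨c, hc, e⟩ := desc_shift (i := i) hk (by omega) d (by omega) hd
        refine ⟨l * c * t n i, mul_mem (mul_mem hl (low_mono (Nat.zero_le _) hc))
          (t_mem_low (by omega)), d, hd, ?_⟩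
        rw [mul_assoc, e]; simp only [mul_assoc]
  have keyz : ∀ y : SpinSym n, (∃ l ∈ low n k, ∃ d ≤ k + 1, y = l * desc n k d) →
      ∃ l ∈ low n k, ∃ d ≤ k + 1, y * z n = l * desc n k d := by
    rintro y ⟨l, hl, d, hd, rfl⟩
    refine ⟨l * z n, mul_mem hl (z_mem_low k), d, hd, ?_⟩
    rw [mul_assoc, ← z_comm, mul_assoc]
  induction hx using Subgroup.closure_induction_right with
  | one => exact ⟨1, one_mem _, 0, by omega, by simp [desc]⟩
  | mul_right x _ y hy h =>
    rcases hy with rfl | ⟨i, hi, _, rfl⟩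
    · exact keyz _ h
    · exact key _ hi _ h
  | mul_inv_cancel x _ y hy h =>
    rcases hy with rfl | ⟨i, hi, hi', rfl⟩
    · rw [inv_z]; exact keyz _ h
    · rw [inv_t hi', ← mul_assoc]; exact key _ hi _ (keyz _ h)

theorem low_finite (k : ℕ) : (low n k : Set (SpinSym n)).Finite := by
  induction k with
  | zero =>
    refine Set.Finite.subset (Set.toFinite {1, z n}) ?_
    intro x hx
    induction hx using Subgroup.closure_induction_right with
    | one => simp
    | mul_right x _ y hy h =>
      rcases hy with rfl | ⟨i, hi, _, rfl⟩
      · rcases h with rfl | rfl <;> simp [z_mul_z]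
      · omega
    | mul_inv_cancel x _ y hy h =>
      rcases hy with rfl | ⟨i, hi, hi', rfl⟩
      · rcases h with rfl | rfl <;> simp [inv_z, z_mul_z]
      · omega
  | succ k ih =>
    by_cases hk : k + 1 < n
    · refine Set.Finite.subset (Set.Finite.image2 (fun l d => l * desc n k d) ih
        (Set.finite_Iic (k + 1))) ?_
      intro x hx
      obtain ⟨l, hl, d, hd, rfl⟩ := low_succ hk x hx
      exact ⟨l, hl, d, hd, rfl⟩
    · refine ih.subset ?_
      apply Subgroup.closure_mono
      apply Set.insert_subset_insert
      rintro x ⟨i, hi, hi', rfl⟩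
      exact ⟨i, by omega, hi', rfl⟩

instance : Finite (SpinSym n) := by
  have h := low_finite (n := n) n
  have : low n n = ⊤ := by
    rw [eq_top_iff, ← closure_gens]
    apply Subgroup.closure_mono
    apply Set.insert_subset_insert
    rintro x ⟨i, hi, rfl⟩
    exact ⟨i, by omega, hi, rfl⟩
  rw [this] at h
  exact Set.finite_univ_iff.mp h

end SpinSym

namespace SpinSym

/-! ### The projection to the symmetric group, the parity, and the two embeddings -/

theorem swap_braid {α : Type*} [DecidableEq α] {a b c : α} (hab : a ≠ b) (hbc : b ≠ c)
    (hac : a ≠ c) : (Equiv.swap a b * Equiv.swap b c) ^ 3 = 1 := by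
  have e1 : Equiv.swap a b * Equiv.swap b c = Equiv.swap a c * Equiv.swap a b := by
    rw [Equiv.mul_swap_eq_swap_mul, Equiv.swap_apply_right,
      Equiv.swap_apply_of_ne_of_ne hac.symm hbc.symm]
  have e2 : Equiv.swap a c * Equiv.swap b c = Equiv.swap a b * Equiv.swap a c := by
    rw [Equiv.mul_swap_eq_swap_mul, Equiv.swap_apply_right,
      Equiv.swap_apply_of_ne_of_ne hab.symm hbc, Equiv.swap_comm b a]
  have e3 : Equiv.swap a b * Equiv.swap a c = Equiv.swap b c * Equiv.swap a b := by
    rw [Equiv.mul_swap_eq_swap_mul, Equiv.swap_apply_left,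
      Equiv.swap_apply_of_ne_of_ne hac.symm hbc.symm]
  calc (Equiv.swap a b * Equiv.swap b c) ^ 3
      = (Equiv.swap a b * Equiv.swap b c) * (Equiv.swap a b * Equiv.swap b c) *
        (Equiv.swap a b * Equiv.swap b c) := by rw [pow_succ, pow_two]
    _ = Equiv.swap a c * (Equiv.swap a b * Equiv.swap a b) * Equiv.swap b c *
        (Equiv.swap a b * Equiv.swap b c) := by nth_rewrite 1 [e1]; simp only [mul_assoc]
    _ = Equiv.swap b c * Equiv.swap a b * (Equiv.swap a b * Equiv.swap b c) := by
        rw [Equiv.swap_mul_self, mul_one, e2, e3]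
    _ = Equiv.swap b c * (Equiv.swap a b * Equiv.swap a b) * Equiv.swap b c := by
        simp only [mul_assoc]
    _ = 1 := by rw [Equiv.swap_mul_self, mul_one, Equiv.swap_mul_self]

/-- The projection `θ_n : S̃_n → S_n`, `t i ↦ (i, i + 1)`, `z ↦ 1`. -/
def theta (n : ℕ) : SpinSym n →* Equiv.Perm (Fin n) :=
  lift 1 (fun i h => Equiv.swap ⟨i, by omega⟩ ⟨i + 1, h⟩) (by simp)
    (fun i h => Equiv.swap_mul_self _ _)
    (fun i h h' => swap_braid (by simp) (by simp) (by simp [Fin.ext_iff]; omega))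
    (fun i j hi hj hij => by
      rw [one_mul, Equiv.mul_swap_eq_swap_mul, Equiv.swap_apply_of_ne_of_ne,
        Equiv.swap_apply_of_ne_of_ne] <;> simp [Fin.ext_iff] <;> omega)
    (by simp)

/-- The parity, written multiplicatively: `sgn x = (-1)^{d(x)}`, where `d (t i) = 1`, `d z = 0`. -/
def sgn (n : ℕ) : SpinSym n →* ℤˣ :=
  lift 1 (fun _ _ => -1) (by simp) (by simp) (by simp) (by simp) (by simp)

/-- The embedding of `S̃_n` in `S̃_{n+m}` with `t i ↦ t i`. -/
def inLeft (n m : ℕ) : SpinSym n →* SpinSym (n + m) :=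
  lift (z _) (fun i _ => t _ i) z_mul_z (fun i h => t_mul_t (by omega))
    (fun i h h' => braid (by omega)) (fun i j hi hj hij => far (by omega) hij)
    (fun i h => z_comm _)

/-- The embedding of `S̃_m` in `S̃_{n+m}` with `t j ↦ t (n + j)`. -/
def inRight (n m : ℕ) : SpinSym m →* SpinSym (n + m) :=
  lift (z _) (fun i _ => t _ (n + i)) z_mul_z (fun i h => t_mul_t (by omega))
    (fun i h h' => braid (by omega)) (fun i j hi hj hij => far (by omega) (by omega))
    (fun i h => z_comm _)

variable {n m : ℕ}

@[simp] theorem theta_z : theta n (z n) = 1 := lift_z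
theorem theta_t {i : ℕ} (h : i + 1 < n) :
    theta n (t n i) = Equiv.swap ⟨i, by omega⟩ ⟨i + 1, h⟩ := lift_t h
@[simp] theorem sgn_z : sgn n (z n) = 1 := lift_z
theorem sgn_t {i : ℕ} (h : i + 1 < n) : sgn n (t n i) = -1 := lift_t h
@[simp] theorem inLeft_z : inLeft n m (z n) = z _ := lift_z
theorem inLeft_t {i : ℕ} (h : i + 1 < n) : inLeft n m (t n i) = t _ i := lift_t h
@[simp] theorem inRight_z : inRight n m (z m) = z _ := lift_z
theorem inRight_t {i : ℕ} (h : i + 1 < m) : inRight n m (t m i) = t _ (n + i) := lift_t h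

theorem sgn_inLeft (x : SpinSym n) : sgn (n + m) (inLeft n m x) = sgn n x := by
  suffices (sgn (n + m)).comp (inLeft n m) = sgn n from DFunLike.congr_fun this x
  apply hom_ext
  · simp
  · intro i h
    rw [MonoidHom.comp_apply, inLeft_t h, sgn_t h, sgn_t (by omega)]

theorem sgn_inRight (x : SpinSym m) : sgn (n + m) (inRight n m x) = sgn m x := by
  suffices (sgn (n + m)).comp (inRight n m) = sgn m from DFunLike.congr_fun this x
  apply hom_ext
  · simp
  · intro i h
    rw [MonoidHom.comp_apply, inRight_t h, sgn_t h, sgn_t (by omega)]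

theorem theta_inLeft_castAdd (x : SpinSym n) (i : Fin n) :
    theta (n + m) (inLeft n m x) (Fin.castAdd m i) = Fin.castAdd m (theta n x i) := by
  induction x using induction_gens generalizing i with
  | one => simp
  | hz x h => simp [h]
  | ht x k hk h =>
    rw [map_mul, map_mul, map_mul, inLeft_t hk, theta_t hk, theta_t (by omega)]
    simp only [Equiv.Perm.mul_apply]
    rw [← h]
    congr 1
    simp only [Equiv.swap_apply_def, Fin.ext_iff]
    split_ifs <;> simp_all

theorem theta_inLeft_natAdd (x : SpinSym n) (i : Fin m) :
    theta (n + m) (inLeft n m x) (Fin.natAdd n i) = Fin.natAdd n i := by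
  induction x using induction_gens generalizing i with
  | one => simp
  | hz x h => simp [h]
  | ht x k hk h =>
    rw [map_mul, map_mul, inLeft_t hk, theta_t (by omega)]
    simp only [Equiv.Perm.mul_apply]
    rw [Equiv.swap_apply_of_ne_of_ne, h] <;> simp [Fin.ext_iff] <;> omega

theorem theta_inRight_natAdd (x : SpinSym m) (i : Fin m) :
    theta (n + m) (inRight n m x) (Fin.natAdd n i) = Fin.natAdd n (theta m x i) := by
  induction x using induction_gens generalizing i with
  | one => simp
  | hz x h => simp [h]
  | ht x k hk h =>
    rw [map_mul, map_mul, map_mul, inRight_t hk, theta_t hk, theta_t (by omega)]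
    simp only [Equiv.Perm.mul_apply]
    rw [← h]
    congr 1
    simp only [Equiv.swap_apply_def, Fin.ext_iff]
    split_ifs <;> simp_all <;> omega

theorem theta_inRight_castAdd (x : SpinSym m) (i : Fin n) :
    theta (n + m) (inRight n m x) (Fin.castAdd m i) = Fin.castAdd m i := by
  induction x using induction_gens generalizing i with
  | one => simp
  | hz x h => simp [h]
  | ht x k hk h =>
    rw [map_mul, map_mul, inRight_t hk, theta_t (by omega)]
    simp only [Equiv.Perm.mul_apply]
    rw [Equiv.swap_apply_of_ne_of_ne, h] <;> simp [Fin.ext_iff] <;> omega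

/-- Super-commutation of the generators of the second copy with the first copy. -/
theorem t_mul_inLeft {j : ℕ} (hj : j + 1 < m) (x : SpinSym n) :
    t (n + m) (n + j) * inLeft n m x =
      (if sgn n x = 1 then 1 else z _) * (inLeft n m x * t (n + m) (n + j)) := by
  induction x using induction_gens with
  | one => simp
  | hz x h =>
    rw [map_mul, map_mul, sgn_z, mul_one, inLeft_z, ← mul_assoc, h]
    simp only [mul_assoc, z_comm]
  | ht x i hi h =>
    rw [map_mul, map_mul, sgn_t hi, inLeft_t hi, ← mul_assoc, h, mul_assoc, mul_assoc,
      far (by omega) (by omega)]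
    rcases Int.units_eq_one_or (sgn n x) with hs | hs
    · rw [hs]
      simp only [if_true, one_mul, ← mul_assoc, z_comm]
      rw [if_neg (by decide), ← z_comm (inLeft n m x * t (n + m) i)]
      simp only [mul_assoc]
    · rw [hs, if_neg (by decide), if_pos (by decide)]
      rw [one_mul, ← mul_assoc (inLeft n m x), ← mul_assoc (inLeft n m x),
        ← z_comm (inLeft n m x)]
      simp only [← mul_assoc, z_mul_z, one_mul]

theorem inRight_comm_inLeft (x : SpinSym n) (hx : sgn n x = 1) (y : SpinSym m) :
    inRight n m y * inLeft n m x = inLeft n m x * inRight n m y := by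
  induction y using induction_gens with
  | one => simp
  | hz y h => rw [map_mul, inRight_z, mul_assoc, z_comm, ← mul_assoc, h, mul_assoc]
  | ht y j hj h =>
    rw [map_mul, inRight_t hj, mul_assoc, t_mul_inLeft hj, if_pos hx, one_mul, ← mul_assoc, h,
      mul_assoc]

end SpinSym

/-! ## The spin wreath product -/

section Wreath

variable (Γ : Type*) [Group Γ]

/-- `S̃_n` acts on `Γ^n` through `S_n`: `(t · g)_i = g_{θ(t)⁻¹ i}`. -/
def wreathAct (n : ℕ) : SpinSym n →* MulAut (Fin n → Γ) :=
  (mulAutArrow (G := Equiv.Perm (Fin n)) (A := Fin n) (M := Γ)).comp (SpinSym.theta n)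

theorem wreathAct_apply {n : ℕ} (t : SpinSym n) (g : Fin n → Γ) (i : Fin n) :
    wreathAct Γ n t g i = g ((SpinSym.theta n t)⁻¹ i) := rfl

/-- The spin wreath product `Γ̃_n = Γ^n ⋊ S̃_n`. -/
abbrev SpinWr (n : ℕ) : Type _ := (Fin n → Γ) ⋊[wreathAct Γ n] SpinSym n

instance [Finite Γ] (n : ℕ) : Finite (SpinWr Γ n) :=
  Finite.of_equiv _ SemidirectProduct.equivProd.symm

instance [Finite Γ] (n : ℕ) : Fintype (SpinWr Γ n) := Fintype.ofFinite _

/-- The central involution of `Γ̃_n`. -/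
def zW (n : ℕ) : SpinWr Γ n := SemidirectProduct.inr (SpinSym.z n)

variable {Γ}
variable {n m : ℕ}

/-- The parity `(-1)^d` of `Γ̃_n`. -/
def sgnW : SpinWr Γ n →* ℤˣ := (SpinSym.sgn n).comp SemidirectProduct.rightHom

theorem sgnW_apply (x : SpinWr Γ n) : sgnW x = SpinSym.sgn n x.right := rfl

theorem zW_mul_zW : zW Γ n * zW Γ n = 1 := by
  rw [zW, ← map_mul, SpinSym.z_mul_z, map_one]

theorem zW_comm (x : SpinWr Γ n) : zW Γ n * x = x * zW Γ n := by
  refine SemidirectProduct.ext ?_ ?_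
  · ext i; simp [zW, wreathAct_apply]
  · simp [zW, SpinSym.z_comm]

@[simp] theorem sgnW_zW : sgnW (zW Γ n) = 1 := by simp [sgnW_apply, zW]

/-- Extension of a tuple by `1`'s on the right. -/
def extLeft (n m : ℕ) : (Fin n → Γ) →* (Fin (n + m) → Γ) where
  toFun g := Fin.append g 1
  map_one' := by ext i; refine Fin.addCases (fun i => ?_) (fun i => ?_) i <;> simp
  map_mul' g h := by ext i; refine Fin.addCases (fun i => ?_) (fun i => ?_) i <;> simp

/-- Extension of a tuple by `1`'s on the left. -/
def extRight (n m : ℕ) : (Fin m → Γ) →* (Fin (n + m) → Γ) where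
  toFun g := Fin.append 1 g
  map_one' := by ext i; refine Fin.addCases (fun i => ?_) (fun i => ?_) i <;> simp
  map_mul' g h := by ext i; refine Fin.addCases (fun i => ?_) (fun i => ?_) i <;> simp

/-- The embedding of `Γ̃_n` in `Γ̃_{n+m}` using the first `n` letters: `(g, t_i) ↦ (g, t_i)`. -/
def embL (n m : ℕ) : SpinWr Γ n →* SpinWr Γ (n + m) :=
  SemidirectProduct.map (extLeft n m) (SpinSym.inLeft n m) (by
    intro t
    ext g i
    simp only [MonoidHom.comp_apply, MulEquiv.coe_toMonoidHom, wreathAct_apply, ← map_inv]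
    refine Fin.addCases (fun i => ?_) (fun i => ?_) i
    · rw [SpinSym.theta_inLeft_castAdd]; simp [extLeft, wreathAct_apply]
    · rw [SpinSym.theta_inLeft_natAdd]; simp [extLeft])

/-- The embedding of `Γ̃_m` in `Γ̃_{n+m}` using the last `m` letters: `(g, t_j) ↦ (g, t_{n+j})`. -/
def embR (n m : ℕ) : SpinWr Γ m →* SpinWr Γ (n + m) :=
  SemidirectProduct.map (extRight n m) (SpinSym.inRight n m) (by
    intro t
    ext g i
    simp only [MonoidHom.comp_apply, MulEquiv.coe_toMonoidHom, wreathAct_apply, ← map_inv]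
    refine Fin.addCases (fun i => ?_) (fun i => ?_) i
    · rw [SpinSym.theta_inRight_castAdd]; simp [extRight]
    · rw [SpinSym.theta_inRight_natAdd]; simp [extRight, wreathAct_apply])

@[simp] theorem embL_zW : embL n m (zW Γ n) = zW Γ (n + m) := by simp [embL, zW]
@[simp] theorem embR_zW : embR n m (zW Γ m) = zW Γ (n + m) := by simp [embR, zW]

@[simp] theorem sgnW_embL (x : SpinWr Γ n) : sgnW (embL n m x) = sgnW x := by
  simp [sgnW_apply, embL, SpinSym.sgn_inLeft]
@[simp] theorem sgnW_embR (x : SpinWr Γ m) : sgnW (embR n m x) = sgnW x := by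
  simp [sgnW_apply, embR, SpinSym.sgn_inRight]

theorem embR_comm_embL (x : SpinWr Γ n) (hx : sgnW x = 1) (y : SpinWr Γ m) :
    embR n m y * embL n m x = embL n m x * embR n m y := by
  refine SemidirectProduct.ext ?_ ?_
  · ext i
    simp only [embL, embR, SemidirectProduct.mul_left, SemidirectProduct.map_left,
      SemidirectProduct.map_right, Pi.mul_apply, wreathAct_apply, ← map_inv]
    refine Fin.addCases (fun i => ?_) (fun i => ?_) i
    · rw [SpinSym.theta_inRight_castAdd, SpinSym.theta_inLeft_castAdd]; simp [extLeft, extRight]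
    · rw [SpinSym.theta_inRight_natAdd, SpinSym.theta_inLeft_natAdd]; simp [extLeft, extRight]
  · exact SpinSym.inRight_comm_inLeft _ hx _

/-- The spin product `Γ̃_n ×̂ Γ̃_m`, identified with the subgroup of `Γ̃_{n+m}` generated by the
two (super-commuting) copies of `Γ̃_n` and `Γ̃_m`, that is, the set of all products
`embL x * embR y`. -/
def hatProd (Γ : Type*) [Group Γ] (n m : ℕ) : Subgroup (SpinWr Γ (n + m)) :=
  (embL n m).range ⊔ (embR n m).range

theorem embL_mul_embR_mem (x : SpinWr Γ n) (y : SpinWr Γ m) :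
    embL n m x * embR n m y ∈ hatProd Γ n m :=
  mul_mem (Subgroup.mem_sup_left ⟨x, rfl⟩) (Subgroup.mem_sup_right ⟨y, rfl⟩)

theorem zW_mem_hatProd : zW Γ (n + m) ∈ hatProd Γ n m := by
  have := embL_mul_embR_mem (Γ := Γ) (n := n) (m := m) (zW Γ n) 1
  simpa using this

end Wreath

/-! ## Class functions -/

section ClassFunctions

variable (Γ : Type*) [Group Γ]

/-- `R(Γ)`: the space of complex class functions on `Γ`. -/
def ClassFn : Submodule ℂ (Γ → ℂ) where
  carrier := {f | ∀ g x, f (g * x * g⁻¹) = f x}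
  zero_mem' := by intro g x; rfl
  add_mem' := by intro f f' h h' g x; simp [h g x, h' g x]
  smul_mem' := by intro a f h g x; simp [h g x]

/-- The self-dual class functions, `ξ(x⁻¹) = ξ(x)`. -/
structure SelfDual where
  /-- the underlying class function -/
  fn : ClassFn Γ
  /-- self-duality -/
  fn_inv : ∀ x : Γ, fn.1 x⁻¹ = fn.1 x

variable {Γ}

/-- The value of a class function on a conjugacy class. -/
def valAt (f : ClassFn Γ) (c : ConjClasses Γ) : ℂ := f.1 (Quotient.out c)

/-- The order `ζ_c` of the centralizer of an element of the class `c`. -/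
def zeta (c : ConjClasses Γ) : ℕ := Nat.card (Subgroup.centralizer {Quotient.out c})

open Classical in
/-- The class function `ζ_c 1_c`. By the orthogonality of the irreducible characters it equals
`∑ γ, γ(c⁻¹) γ`, the sum being over the irreducible characters `γ` of `Γ`. -/
def classDelta (c : ConjClasses Γ) : ClassFn Γ where
  val x := if ConjClasses.mk x = c then (zeta c : ℂ) else 0
  property := by
    intro g x
    have : ConjClasses.mk (g * x * g⁻¹) = ConjClasses.mk x :=
      ConjClasses.mk_eq_mk_iff_isConj.2 (isConj_iff.2 ⟨g, rfl⟩).symm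
    simp only [this]

variable [Fintype Γ]

open Classical in
/-- `γ = ∑ c, ζ_c⁻¹ γ(c) (ζ_c 1_c)`. -/
theorem sum_valAt_smul_classDelta (γ : ClassFn Γ) :
    ∑ c : ConjClasses Γ, ((zeta c : ℂ)⁻¹ * valAt γ c) • classDelta c = γ := by
  ext x
  have hx : γ.1 (Quotient.out (ConjClasses.mk x)) = γ.1 x := by
    have h : IsConj x (Quotient.out (ConjClasses.mk x)) :=
      ConjClasses.mk_eq_mk_iff_isConj.1 (Quotient.out_eq (ConjClasses.mk x)).symm
    obtain ⟨g, hg⟩ := isConj_iff.1 h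
    rw [← hg, γ.2]
  have hz : (zeta (ConjClasses.mk x) : ℂ) ≠ 0 := by
    rw [zeta]; exact_mod_cast Nat.card_pos.ne'
  rw [Submodule.coe_sum, Finset.sum_apply, Finset.sum_eq_single (ConjClasses.mk x)]
  · simp only [classDelta, valAt, Submodule.coe_smul, Pi.smul_apply, smul_eq_mul, if_true, hx]
    field_simp
  · intro c _ hc
    simp [classDelta, Ne.symm hc]
  · simp

/-- The weighted form `⟨f, g⟩_ξ = |Γ|⁻¹ ∑ x, ξ(x) f(x) g(x⁻¹)` on `R(Γ)`. -/
def wform (ξ : SelfDual Γ) : ClassFn Γ →ₗ[ℂ] ClassFn Γ →ₗ[ℂ] ℂ :=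
  LinearMap.mk₂ ℂ (fun f g => (Fintype.card Γ : ℂ)⁻¹ * ∑ x : Γ, ξ.fn.1 x * f.1 x * g.1 x⁻¹)
    (by intro f f' g; simp [mul_add, add_mul, Finset.sum_add_distrib])
    (by
      intro a f g
      simp only [Submodule.coe_smul, Pi.smul_apply, smul_eq_mul, Finset.mul_sum]
      exact Finset.sum_congr rfl fun x _ => by ring)
    (by intro f g g'; simp [mul_add, Finset.sum_add_distrib])
    (by
      intro a f g
      simp only [Submodule.coe_smul, Pi.smul_apply, smul_eq_mul, Finset.mul_sum]
      exact Finset.sum_congr rfl fun x _ => by ring)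

theorem wform_symm (ξ : SelfDual Γ) (f g : ClassFn Γ) : wform ξ f g = wform ξ g f := by
  simp only [wform, LinearMap.mk₂_apply]
  congr 1
  refine Fintype.sum_equiv (Equiv.inv Γ) _ _ fun x => ?_
  simp only [Equiv.inv_apply, inv_inv, ξ.fn_inv]
  ring

end ClassFunctions

/-! ## Spin super class functions on `Γ̃_n` -/

section SuperFn

/-- `R⁻(Γ̃_n)`: the spin super class functions, that is, the class functions `f` on `Γ̃_n` with
`f(z x) = -f(x)` which vanish on the odd elements. -/
def SuperFn (Γ : Type*) [Group Γ] (n : ℕ) : Submodule ℂ (SpinWr Γ n → ℂ) where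
  carrier := {f | (∀ u x, f (u * x * u⁻¹) = f x) ∧ (∀ x, f (zW Γ n * x) = -f x) ∧
    ∀ x, sgnW x = -1 → f x = 0}
  zero_mem' := ⟨fun _ _ => rfl, fun _ => by simp, fun _ _ => rfl⟩
  add_mem' := by
    rintro f f' ⟨h1, h2, h3⟩ ⟨h1', h2', h3'⟩
    refine ⟨fun u x => by simp [h1 u x, h1' u x], fun x => ?_, fun x hx => ?_⟩
    · simp only [Pi.add_apply, h2, h2']; ring
    · simp [h3 x hx, h3' x hx]
  smul_mem' := by
    rintro a f ⟨h1, h2, h3⟩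
    exact ⟨fun u x => by simp [h1 u x], fun x => by simp [h2], fun x hx => by simp [h3 x hx]⟩

variable {Γ : Type*} [Group Γ] [Fintype Γ] {n m : ℕ}

/-! ### Outer tensor product followed by induction -/

open Classical in
/-- The pairs `(x, y)` with `embL x * embR y = w`. For `w` in the spin product these are
two pairs, `(x, y)` and `(z x, z y)`. -/
def fibre (n m : ℕ) (w : SpinWr Γ (n + m)) : Finset (SpinWr Γ n × SpinWr Γ m) :=
  Finset.univ.filter fun p => embL n m p.1 * embR n m p.2 = w

/-- The super outer tensor product of `f` and `g`: the function
`embL x * embR y ↦ f(x) g(y)` on the spin product (for spin functions `f`, `g` the value is the same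
at both pairs of the fibre; the definition takes the average). -/
def outer (f : SpinWr Γ n → ℂ) (g : SpinWr Γ m → ℂ) (w : hatProd Γ n m) : ℂ :=
  ((fibre n m w.1).card : ℂ)⁻¹ * ∑ p ∈ fibre n m w.1, f p.1 * g p.2

open Classical in
/-- Induction of class functions from a subgroup `H` to a finite group `G`. -/
def induce {G : Type*} [Group G] [Fintype G] (H : Subgroup G) (F : H → ℂ) (w : G) : ℂ :=
  (Nat.card H : ℂ)⁻¹ * ∑ u : G, if h : u * w * u⁻¹ ∈ H then F ⟨u * w * u⁻¹, h⟩ else 0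

theorem induce_conj {G : Type*} [Group G] [Fintype G] (H : Subgroup G) (F : H → ℂ) (v w : G) :
    induce H F (v * w * v⁻¹) = induce H F w := by
  unfold induce
  congr 1
  refine Fintype.sum_equiv (Equiv.mulRight v) _ _ fun u => ?_
  have : u * (v * w * v⁻¹) * u⁻¹ = (u * v) * w * (u * v)⁻¹ := by group
  rw [Equiv.coe_mulRight]
  classical
  have key : ∀ a b : G, a = b →
      (if h : a ∈ H then F ⟨a, h⟩ else 0) = if h : b ∈ H then F ⟨b, h⟩ else 0 := by
    rintro a _ rfl; rfl
  exact key _ _ this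

theorem mem_fibre {w : SpinWr Γ (n + m)} {p : SpinWr Γ n × SpinWr Γ m} :
    p ∈ fibre n m w ↔ embL n m p.1 * embR n m p.2 = w := by simp [fibre]

/-- Translation by `z` as a bijection between fibres. -/
theorem fibre_zW (w : SpinWr Γ (n + m)) :
    fibre n m (zW Γ (n + m) * w) =
      (fibre n m w).map ((Equiv.prodCongr (Equiv.mulLeft (zW Γ n)) (Equiv.refl _)).toEmbedding) := by
  ext p
  rw [Finset.mem_map_equiv]
  rw [mem_fibre, mem_fibre]
  simp [inv_mul_eq_iff_eq_mul, mul_assoc]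

theorem outer_zW (f : SuperFn Γ n) (g : SpinWr Γ m → ℂ) (w w' : hatProd Γ n m)
    (h : w'.1 = zW Γ (n + m) * w.1) : outer f.1 g w' = -outer f.1 g w := by
  unfold outer
  rw [h, fibre_zW, Finset.card_map, Finset.sum_map, ← mul_neg, ← Finset.sum_neg_distrib]
  congr 1
  refine Finset.sum_congr rfl fun p _ => ?_
  simp [f.2.2.1]

theorem outer_odd (f : SuperFn Γ n) (g : SuperFn Γ m) (w : hatProd Γ n m)
    (hw : sgnW w.1 = -1) : outer f.1 g.1 w = 0 := by
  unfold outer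
  rw [Finset.sum_eq_zero, mul_zero]
  intro p hp
  rw [mem_fibre] at hp
  rw [← hp, map_mul, sgnW_embL, sgnW_embR] at hw
  rcases Int.units_eq_one_or (sgnW p.1) with h | h
  · rw [g.2.2.2 p.2 (by simpa [h] using hw), mul_zero]
  · rw [f.2.2.2 p.1 h, zero_mul]

/-- The composition `R⁻(Γ̃_m) → R⁻(Γ̃_n ×̂ Γ̃_m) → R⁻(Γ̃_{n+m})`: outer tensor product with `f`
followed by induction. -/
def raise (f : SuperFn Γ n) (m : ℕ) : SuperFn Γ m →ₗ[ℂ] SuperFn Γ (n + m) where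
  toFun g := ⟨induce (hatProd Γ n m) (outer f.1 g.1), by
    refine ⟨fun u x => induce_conj _ _ u x, fun x => ?_, fun x hx => ?_⟩
    · unfold induce
      rw [← mul_neg, ← Finset.sum_neg_distrib]
      congr 1
      refine Finset.sum_congr rfl fun u _ => ?_
      have e : u * (zW Γ (n + m) * x) * u⁻¹ = zW Γ (n + m) * (u * x * u⁻¹) := by
        rw [← mul_assoc, ← zW_comm]; simp only [mul_assoc]
      by_cases h : u * x * u⁻¹ ∈ hatProd Γ n m
      · have h' : u * (zW Γ (n + m) * x) * u⁻¹ ∈ hatProd Γ n m := by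
          rw [e]; exact mul_mem zW_mem_hatProd h
        rw [dif_pos h, dif_pos h']
        exact outer_zW _ _ _ _ e
      · have h' : u * (zW Γ (n + m) * x) * u⁻¹ ∉ hatProd Γ n m := by
          rw [e]; intro h'
          exact h ((Subgroup.mul_mem_cancel_left _ zW_mem_hatProd).1 h')
        rw [dif_neg h, dif_neg h', neg_zero]
    · unfold induce
      rw [Finset.sum_eq_zero, mul_zero]
      intro u _
      split_ifs with h
      · apply outer_odd
        simp [hx]
      · rfl⟩
  map_add' g g' := by
    ext x
    simp only [induce, outer, Submodule.coe_add, Pi.add_apply, ← mul_add,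
      ← Finset.sum_add_distrib]
    congr 1
    refine Finset.sum_congr rfl fun u _ => ?_
    split_ifs with h
    · rw [← mul_add, ← Finset.sum_add_distrib]
      simp only [mul_add]
    · simp
  map_smul' a g := by
    ext x
    simp only [induce, outer, Submodule.coe_smul, Pi.smul_apply, smul_eq_mul, RingHom.id_apply]
    rw [mul_left_comm a]
    congr 1
    rw [Finset.mul_sum]
    refine Finset.sum_congr rfl fun u _ => ?_
    split_ifs with h
    · rw [mul_left_comm a]
      congr 1
      rw [Finset.mul_sum]
      exact Finset.sum_congr rfl fun p _ => by ring
    · simp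

/-! ### The weighted form -/

/-- The product of `g` along the `σ`-cycle of `i`: `g_{i_k} ⋯ g_{i_2} g_{i_1}` for the
cycle `(i_1 i_2 ⋯ i_k)` with `i_1 = i`. -/
def cycleProd (g : Fin n → Γ) (σ : Equiv.Perm (Fin n)) (i : Fin n) : Γ :=
  (((List.range (Function.minimalPeriod σ i)).map fun j => g ((σ ^ j) i)).reverse).prod

open Classical in
/-- One point (the smallest) from each cycle of `σ`, fixed points included. -/
def cycleReps (σ : Equiv.Perm (Fin n)) : Finset (Fin n) :=
  Finset.univ.filter fun i => ∀ j : ℕ, i ≤ (σ ^ j) i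

/-- `η_n(ξ)`: the product of the values of `ξ` at the cycle products, over all cycles. -/
def eta (ξ : SelfDual Γ) (x : SpinWr Γ n) : ℂ :=
  ∏ i ∈ cycleReps (SpinSym.theta n x.right), ξ.fn.1 (cycleProd x.left (SpinSym.theta n x.right) i)

/-- The weighted form on `R⁻(Γ̃_n)`:
`⟨f, g⟩_ξ = |Γ̃_n|⁻¹ ∑ x, η_n(ξ)(x) f(x) g(x⁻¹)`. -/
def wformN (ξ : SelfDual Γ) (n : ℕ) : SuperFn Γ n →ₗ[ℂ] SuperFn Γ n →ₗ[ℂ] ℂ :=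
  LinearMap.mk₂ ℂ
    (fun f g => (Fintype.card (SpinWr Γ n) : ℂ)⁻¹ * ∑ x, eta ξ x * f.1 x * g.1 x⁻¹)
    (by intro f f' g; simp [mul_add, add_mul, Finset.sum_add_distrib])
    (by
      intro a f g
      simp only [Submodule.coe_smul, Pi.smul_apply, smul_eq_mul, Finset.mul_sum]
      exact Finset.sum_congr rfl fun x _ => by ring)
    (by intro f g g'; simp [mul_add, Finset.sum_add_distrib])
    (by
      intro a f g
      simp only [Submodule.coe_smul, Pi.smul_apply, smul_eq_mul, Finset.mul_sum]
      exact Finset.sum_congr rfl fun x _ => by ring)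

/-! ### Restriction followed by pairing -/

/-- The pairing of `f ∈ R⁻(Γ̃_n)` with the first tensor factor of a function `F` on the spin
product `Γ̃_n ×̂ Γ̃_m`, with respect to the weighted form on `R⁻(Γ̃_n)`. -/
def contract (ξ : SelfDual Γ) (f : SuperFn Γ n) (F : hatProd Γ n m → ℂ) (y : SpinWr Γ m) : ℂ :=
  (Fintype.card (SpinWr Γ n) : ℂ)⁻¹ *
    ∑ x, eta ξ x * f.1 x * F ⟨embL n m x⁻¹ * embR n m y, embL_mul_embR_mem _ _⟩

/-- On a pure tensor `f₁ ⊗ f₂` the pairing is `⟨f, f₁⟩_ξ f₂`. -/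
theorem contract_tensor (ξ : SelfDual Γ) (f f₁ : SuperFn Γ n) (f₂ : SuperFn Γ m)
    (F : hatProd Γ n m → ℂ)
    (hF : ∀ x y, F ⟨embL n m x * embR n m y, embL_mul_embR_mem _ _⟩ = f₁.1 x * f₂.1 y)
    (y : SpinWr Γ m) : contract ξ f F y = wformN ξ n f f₁ * f₂.1 y := by
  simp only [contract, hF, wformN, LinearMap.mk₂_apply, mul_assoc, Finset.sum_mul]

/-- The composition `R⁻(Γ̃_{n+m}) → R⁻(Γ̃_n ×̂ Γ̃_m) = R⁻(Γ̃_n) ⊗ R⁻(Γ̃_m) → R⁻(Γ̃_m)`: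
restriction to the spin product followed by the pairing `⟨f, ·⟩_ξ` in the first factor. -/
def lower (ξ : SelfDual Γ) (f : SuperFn Γ n) (m : ℕ) :
    SuperFn Γ (n + m) →ₗ[ℂ] SuperFn Γ m where
  toFun g := ⟨contract ξ f (fun w : hatProd Γ n m => g.1 w.1), by
    refine ⟨fun v y => ?_, fun y => ?_, fun y hy => ?_⟩
    · unfold contract
      congr 1
      refine Finset.sum_congr rfl fun x _ => ?_
      rcases Int.units_eq_one_or (sgnW x) with h | h
      · have hc := embR_comm_embL (n := n) (m := m) x⁻¹ (by simp [h]) v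
        have e : embL n m x⁻¹ * embR n m (v * y * v⁻¹) =
            embR n m v * (embL n m x⁻¹ * embR n m y) * (embR n m v)⁻¹ := by
          rw [map_mul, map_mul, ← mul_assoc, ← mul_assoc, ← hc, map_inv]
          simp only [mul_assoc, map_inv]
        simp only [e, g.2.1]
      · rw [f.2.2.2 x h]; simp
    · unfold contract
      rw [← mul_neg, ← Finset.sum_neg_distrib]
      congr 1
      refine Finset.sum_congr rfl fun x _ => ?_
      have e : embL n m x⁻¹ * embR n m (zW Γ m * y) =
          zW Γ (n + m) * (embL n m x⁻¹ * embR n m y) := by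
        rw [map_mul, embR_zW, ← mul_assoc, ← zW_comm, mul_assoc]
      simp only [e, g.2.2.1, mul_neg]
    · unfold contract
      rw [Finset.sum_eq_zero, mul_zero]
      intro x _
      rcases Int.units_eq_one_or (sgnW x) with h | h
      · simp only
        rw [g.2.2.2 _ (by simp [h, hy]), mul_zero]
      · rw [f.2.2.2 x h]; simp⟩
  map_add' g g' := by
    ext y
    simp [contract, mul_add, Finset.sum_add_distrib]
  map_smul' a g := by
    ext y
    simp only [contract, Submodule.coe_smul, Pi.smul_apply, smul_eq_mul, RingHom.id_apply]
    rw [mul_left_comm a]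
    congr 1
    rw [Finset.mul_sum]
    exact Finset.sum_congr rfl fun x _ => by ring

end SuperFn

/-! ## Odd partition-valued functions and the special conjugacy classes -/

/-- The positive odd integers. -/
abbrev OddNat : Type := {n : ℕ // Odd n}

section Classes

variable {Γ : Type*} [Group Γ]

/-- The word `t_a t_{a+1} ⋯ t_{a+k-2}` over the cycle `(a, a+1, …, a+k-1)`. -/
def blockWord (N a k : ℕ) : SpinSym N := ((List.range (k - 1)).map fun j => SpinSym.t N (a + j)).prod

/-- The product of the block words of the given lengths on consecutive blocks starting at `a`. -/
def wordFrom (N : ℕ) : ℕ → List (OddNat × ConjClasses Γ) → SpinSym N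
  | _, [] => 1
  | a, kc :: L => blockWord N a kc.1.1 * wordFrom N (a + kc.1.1) L

/-- The labels in `Γ`: a representative of the prescribed class at the first letter of each block,
and `1` elsewhere. -/
def labelFrom : ℕ → List (OddNat × ConjClasses Γ) → ℕ → Γ
  | _, [] => fun _ => 1
  | a, kc :: L => Function.update (labelFrom (a + kc.1.1) L) a (Quotient.out kc.2)

/-- For a list of pairs `(k, c)`, the element of `Γ̃_N` with consecutive cycles of lengths `k` and
cycle products in the classes `c`. -/
def stdElt (N : ℕ) (L : List (OddNat × ConjClasses Γ)) : SpinWr Γ N :=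
  ⟨fun i => labelFrom 0 L i, wordFrom N 0 L⟩

variable (Γ) in
open Classical in
/-- `OP_n(Γ_*)`: functions from the conjugacy classes of `Γ` to the partitions with odd parts (given
as multisets of odd positive integers) of total size `n`. -/
structure OddPF [Fintype Γ] (n : ℕ) where
  /-- the partition attached to a class -/
  parts : ConjClasses Γ → Multiset OddNat
  /-- the total size is `n` -/
  size_eq : ∑ c, ((parts c).map Subtype.val).sum = n

namespace OddPF

variable [Fintype Γ] {n : ℕ}

open Classical in
instance : Finite (OddPF Γ n) := by
  have hle : ∀ (ρ : OddPF Γ n) c, ((ρ.parts c).map Subtype.val).sum < n + 1 := fun ρ c => by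
    have := Finset.single_le_sum (f := fun c => ((ρ.parts c).map Subtype.val).sum)
      (fun _ _ => Nat.zero_le _) (Finset.mem_univ c)
    have h := ρ.size_eq
    replace this : ((ρ.parts c).map Subtype.val).sum ≤ _ := this
    omega
  let F : OddPF Γ n → ConjClasses Γ → Σ j : Fin (n + 1), Nat.Partition j := fun ρ c =>
    ⟨⟨((ρ.parts c).map Subtype.val).sum, hle ρ c⟩,
      ⟨(ρ.parts c).map Subtype.val, fun {i} hi => by
        obtain ⟨k, _, rfl⟩ := Multiset.mem_map.1 hi
        exact k.2.pos, rfl⟩⟩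
  refine Finite.of_injective F fun ρ ρ' h => ?_
  obtain ⟨p, hp⟩ := ρ
  obtain ⟨p', hp'⟩ := ρ'
  rw [OddPF.mk.injEq]
  funext c
  have h1 := congrArg (fun p : Σ j : Fin (n + 1), Nat.Partition j => p.2.parts) (congrFun h c)
  exact Multiset.map_injective Subtype.val_injective h1

instance : Fintype (OddPF Γ n) := Fintype.ofFinite _

open Classical in
/-- The total number of parts `l(ρ)`. -/
def len (ρ : OddPF Γ n) : ℕ := ∑ c, Multiset.card (ρ.parts c)

/-- `z_λ = ∏ i, i ^ m_i m_i!`. -/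
def zPart (s : Multiset OddNat) : ℕ :=
  (s.map Subtype.val).prod * ∏ k ∈ s.toFinset, (s.count k).factorial

open Classical in
/-- `Z_ρ = ∏ c, z_{ρ(c)} ζ_c ^ l(ρ(c))`. -/
def Z (ρ : OddPF Γ n) : ℕ := ∏ c, zPart (ρ.parts c) * zeta c ^ Multiset.card (ρ.parts c)

open Classical in
/-- The list of all pairs `(k, c)` with `k` a part of `ρ(c)`: the classes `c` in a fixed order, and
the parts of each `ρ(c)` in decreasing order. -/
def toList (ρ : OddPF Γ n) : List (OddNat × ConjClasses Γ) :=
  (Finset.univ : Finset (ConjClasses Γ)).toList.flatMap fun c =>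
    ((ρ.parts c).sort (· ≥ ·)).map fun k => (k, c)

/-- The representative `(g, t^ρ)` of the conjugacy class `D_ρ⁺` of `Γ̃_n`. -/
def rep (ρ : OddPF Γ n) : SpinWr Γ n := stdElt n ρ.toList

end OddPF

/-! ### The functions `σ_n(γ)` -/

/-- The representative of the class `D_n(c)⁺`: an `n`-cycle with cycle product in `c`. -/
def cycleElt (n : OddNat) (c : ConjClasses Γ) : SpinWr Γ n.1 := stdElt n.1 [(n, c)]

theorem sgn_blockWord (n : ℕ) (k : ℕ) (hk : k ≤ n) :
    SpinSym.sgn n (blockWord n 0 k) = (-1) ^ (k - 1) := by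
  unfold blockWord
  have : ∀ j, j ≤ k - 1 →
      SpinSym.sgn n ((List.range j).map fun j => SpinSym.t n (0 + j)).prod = (-1) ^ j := by
    intro j hj
    induction j with
    | zero => simp
    | succ j ih =>
      rw [List.range_succ, List.map_append, List.prod_append, map_mul, ih (by omega)]
      simp only [List.map_cons, List.map_nil, List.prod_cons, List.prod_nil, mul_one]
      rw [SpinSym.sgn_t (by omega), pow_succ]
  exact this _ le_rfl

theorem sgnW_cycleElt (n : OddNat) (c : ConjClasses Γ) : sgnW (cycleElt n c) = 1 := by
  rw [sgnW_apply]
  simp only [cycleElt, stdElt, wordFrom, mul_one]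
  rw [sgn_blockWord _ _ le_rfl]
  obtain ⟨k, hk⟩ := n.2
  rw [hk, Nat.add_sub_cancel, pow_mul]
  simp

variable [Fintype Γ]

open Classical in
/-- `σ_n(γ)`: the value is `± (n / √2) γ(c)` on the classes `D_n(c)^±`, and `0` elsewhere. Here
`D_n(c)⁺` is the class of `cycleElt n c`, and `D_n(c)⁻ = z D_n(c)⁺`. -/
def sigma (n : OddNat) (γ : ClassFn Γ) : SuperFn Γ n.1 where
  val x := ∑ c : ConjClasses Γ, ((n.1 : ℂ) / (Real.sqrt 2 : ℂ)) * valAt γ c *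
    ((if IsConj x (cycleElt n c) then 1 else 0) -
      (if IsConj (zW Γ n.1 * x) (cycleElt n c) then 1 else 0))
  property := by
    refine ⟨fun u x => ?_, fun x => ?_, fun x hx => ?_⟩
    · have hc : ∀ y : SpinWr Γ n.1, IsConj (u * y * u⁻¹) y := fun y =>
        (isConj_iff.2 ⟨u, rfl⟩).symm
      have e : zW Γ n.1 * (u * x * u⁻¹) = u * (zW Γ n.1 * x) * u⁻¹ := by
        rw [← mul_assoc, ← mul_assoc, zW_comm u]; simp only [mul_assoc]
      refine Finset.sum_congr rfl fun c _ => ?_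
      have h1 : IsConj (u * x * u⁻¹) (cycleElt n c) ↔ IsConj x (cycleElt n c) :=
        ⟨fun h => (hc x).symm.trans h, fun h => (hc x).trans h⟩
      have h2 : IsConj (zW Γ n.1 * (u * x * u⁻¹)) (cycleElt n c) ↔
          IsConj (zW Γ n.1 * x) (cycleElt n c) := by
        rw [e]; exact ⟨fun h => (hc _).symm.trans h, fun h => (hc _).trans h⟩
      simp only [h1, h2]
    · rw [← Finset.sum_neg_distrib]
      refine Finset.sum_congr rfl fun c _ => ?_
      rw [← mul_assoc (zW Γ n.1) (zW Γ n.1) x, zW_mul_zW, one_mul]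
      ring
    · refine Finset.sum_eq_zero fun c _ => ?_
      have key : ∀ y : SpinWr Γ n.1, sgnW y = -1 → ¬ IsConj y (cycleElt n c) := by
        intro y hy h
        obtain ⟨u, hu⟩ := isConj_iff.1 h
        have := congrArg sgnW hu
        rw [sgnW_cycleElt] at this
        simp [hy] at this
      rw [if_neg (key x hx), if_neg (key _ (by simp [hx]))]
      simp

end Classes

/-! ## The spaces `R⁻_Γ` and `S⁻_Γ`, and the characteristic map -/

section Spaces

open DirectSum

variable (Γ : Type*) [Group Γ]

/-- `R⁻_Γ = ⨁ n, R⁻(Γ̃_n)`. -/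
def RMinus : Type _ := ⨁ n, SuperFn Γ n

instance : AddCommGroup (RMinus Γ) := inferInstanceAs (AddCommGroup (⨁ n, SuperFn Γ n))
instance : Module ℂ (RMinus Γ) := inferInstanceAs (Module ℂ (⨁ n, SuperFn Γ n))

/-- `RMinus Γ` is by definition the direct sum. -/
def RMinus.equiv : RMinus Γ ≃ₗ[ℂ] ⨁ n, SuperFn Γ n where
  toFun v := v
  invFun v := v
  left_inv _ := rfl
  right_inv _ := rfl
  map_add' _ _ := rfl
  map_smul' _ _ := rfl

/-- `S⁻_Γ`: the symmetric algebra on the vector space spanned by the symbols `a_{-n}(γ)`, `n`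
positive and odd, linear in `γ ∈ R(Γ)`. -/
abbrev SMinus : Type _ := SymmetricAlgebra ℂ (OddNat →₀ ClassFn Γ)

variable {Γ}

/-- The generator `a_{-n}(γ)` of `S⁻_Γ`. -/
def gen (n : OddNat) : ClassFn Γ →ₗ[ℂ] SMinus Γ :=
  SymmetricAlgebra.ι ℂ (OddNat →₀ ClassFn Γ) ∘ₗ Finsupp.lsingle n

/-- The inclusion of the summand `R⁻(Γ̃_n)`. -/
def RMinus.of (n : ℕ) : SuperFn Γ n →ₗ[ℂ] RMinus Γ :=
  (RMinus.equiv Γ).symm.toLinearMap ∘ₗ DirectSum.lof ℂ ℕ (fun k => SuperFn Γ k) n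

/-- The component in `R⁻(Γ̃_n)`. -/
def RMinus.component (n : ℕ) : RMinus Γ →ₗ[ℂ] SuperFn Γ n :=
  DirectSum.component ℂ ℕ (fun k => SuperFn Γ k) n ∘ₗ (RMinus.equiv Γ).toLinearMap

/-- The linear map on `R⁻_Γ` with prescribed restrictions to the summands. -/
def RMinus.sumMap {W : Type*} [AddCommMonoid W] [Module ℂ W] (F : ∀ n, SuperFn Γ n →ₗ[ℂ] W) :
    RMinus Γ →ₗ[ℂ] W :=
  DirectSum.toModule ℂ ℕ W F ∘ₗ (RMinus.equiv Γ).toLinearMap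

variable [Fintype Γ]

/-- The operator "outer tensor product with `f`, then induction" on `R⁻_Γ`. -/
def raiseOp {n : ℕ} (f : SuperFn Γ n) : Module.End ℂ (RMinus Γ) :=
  RMinus.sumMap fun m => RMinus.of (n + m) ∘ₗ raise f m

/-- The operator "restriction, then pairing with `f`" on `R⁻_Γ`: its component in `R⁻(Γ̃_m)`
comes from `R⁻(Γ̃_{n+m})`; it is `0` on `R⁻(Γ̃_k)` for `k < n`. -/
def lowerOp (ξ : SelfDual Γ) {n : ℕ} (f : SuperFn Γ n) : Module.End ℂ (RMinus Γ) :=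
  (RMinus.equiv Γ).symm.toLinearMap ∘ₗ
    (DFinsupp.mapRange.linearMap (fun m => lower ξ f m) ∘ₗ
      { toFun := fun v : Π₀ k, SuperFn Γ k =>
          DFinsupp.comapDomain (fun m => n + m) (add_right_injective n) v
        map_add' := fun v w => DFinsupp.comapDomain_add _ _ v w
        map_smul' := fun a v => DFinsupp.comapDomain_smul _ _ a v }) ∘ₗ
    (RMinus.equiv Γ).toLinearMap

/-- The form `⟨u, v⟩_ξ = ∑ n, ⟨u_n, v_n⟩_ξ` on `R⁻_Γ`. -/
def formR (ξ : SelfDual Γ) : RMinus Γ →ₗ[ℂ] RMinus Γ →ₗ[ℂ] ℂ :=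
  RMinus.sumMap fun n => (wformN ξ n).compl₂ (RMinus.component n)

/-- `R⁰_Γ`: the radical of `⟨ , ⟩_ξ`. -/
def RZero (ξ : SelfDual Γ) : Submodule ℂ (RMinus Γ) := LinearMap.ker (formR ξ)

/-- `S⁰_Γ`: the ideal of `S⁻_Γ` generated by the `a_{-n}(γ)`, `γ` in the radical of `⟨ , ⟩_ξ`
on `R(Γ)`. -/
def SZero (ξ : SelfDual Γ) : Submodule ℂ (SMinus Γ) :=
  (Ideal.span {s | ∃ (n : OddNat) (γ : ClassFn Γ), wform ξ γ = 0 ∧ s = gen n γ}).restrictScalars ℂ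

open Classical in
/-- The monomial `a'_{-ρ} = ∏ c, ∏ k, a_{-k}(c)`, the second product over the parts `k` of `ρ(c)`. -/
def classMonomial {n : ℕ} (ρ : OddPF Γ n) : SMinus Γ :=
  ∏ c, ((ρ.parts c).map fun k => gen k (classDelta c)).prod

/-- The characteristic map on `R⁻(Γ̃_n)`:
`ch f = ∑ ρ, 2^{l(ρ)/2} Z_ρ⁻¹ f(ρ) a'_{-ρ}` over `ρ ∈ OP_n(Γ_*)`, where `f(ρ) = f(D_ρ⁺)`. -/
def chN (n : ℕ) : SuperFn Γ n →ₗ[ℂ] SMinus Γ :=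
  ∑ ρ : OddPF Γ n, (((Real.sqrt 2 : ℂ) ^ ρ.len / (ρ.Z : ℂ)) •
    (LinearMap.proj ρ.rep ∘ₗ (SuperFn Γ n).subtype)).smulRight (classMonomial ρ)

theorem chN_apply (n : ℕ) (f : SuperFn Γ n) :
    chN n f = ∑ ρ : OddPF Γ n,
      ((Real.sqrt 2 : ℂ) ^ ρ.len / (ρ.Z : ℂ) * f.1 ρ.rep) • classMonomial ρ := by
  simp [chN, LinearMap.sum_apply]

variable (Γ) in
/-- The characteristic map `ch : R⁻_Γ → S⁻_Γ`. -/
def ch : RMinus Γ →ₗ[ℂ] SMinus Γ := RMinus.sumMap fun n => chN n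

end Spaces

/-! ## The twisted Heisenberg algebra -/

section Heisenberg

/-- The odd integers. -/
abbrev OddInt : Type := {n : ℤ // Odd n}

instance : Neg OddInt := ⟨fun m => ⟨-m.1, m.2.neg⟩⟩

/-- The absolute value of an odd integer. -/
def OddInt.abs (m : OddInt) : OddNat := ⟨m.1.natAbs, Int.natAbs_odd.2 m.2⟩

variable {Γ : Type*} [Group Γ] [Fintype Γ]

/-- The twisted Heisenberg algebra `ĥ_{Γ,ξ}[-1]`: the vector space spanned by the symbols
`a_m(γ)`, `m` odd, linear in `γ ∈ R(Γ)`, and a central element `C`. -/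
def Heis (_ξ : SelfDual Γ) : Type _ := (OddInt →₀ ClassFn Γ) × ℂ

namespace Heis

variable {ξ : SelfDual Γ}

instance : AddCommGroup (Heis ξ) := inferInstanceAs (AddCommGroup ((OddInt →₀ ClassFn Γ) × ℂ))
instance : Module ℂ (Heis ξ) := inferInstanceAs (Module ℂ ((OddInt →₀ ClassFn Γ) × ℂ))

/-- The element `a_m(γ)`. -/
def a (m : OddInt) (γ : ClassFn Γ) : Heis ξ := ((Finsupp.single m γ, 0) : (OddInt →₀ ClassFn Γ) × ℂ)

/-- The central element `C`. -/
def C : Heis ξ := ((0, 1) : (OddInt →₀ ClassFn Γ) × ℂ)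

/-- The projection to the span of the `a_m(γ)`. -/
def fstₗ : Heis ξ →ₗ[ℂ] (OddInt →₀ ClassFn Γ) := LinearMap.fst ℂ _ _

/-- The coefficient of `C`. -/
def sndₗ : Heis ξ →ₗ[ℂ] ℂ := LinearMap.snd ℂ (OddInt →₀ ClassFn Γ) ℂ

variable (ξ) in
/-- The alternating form with `(a_m(γ), a_n(γ')) ↦ (m/2) δ_{m,-n} ⟨γ, γ'⟩_ξ`. -/
def omega : (OddInt →₀ ClassFn Γ) →ₗ[ℂ] (OddInt →₀ ClassFn Γ) →ₗ[ℂ] ℂ :=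
  Finsupp.lsum ℂ fun m : OddInt => ((m.1 : ℂ) / 2) • (wform ξ).compl₂ (Finsupp.lapply (-m))

theorem omega_single (m n : OddInt) (γ γ' : ClassFn Γ) :
    omega ξ (Finsupp.single m γ) (Finsupp.single n γ') =
      if m.1 = -n.1 then (m.1 : ℂ) / 2 * wform ξ γ γ' else 0 := by
  have h : (n = -m) ↔ m.1 = -n.1 := by
    rw [Subtype.ext_iff]; change n.1 = -m.1 ↔ _; omega
  simp only [omega, Finsupp.lsum_single, LinearMap.smul_apply, LinearMap.compl₂_apply,
    Finsupp.lapply_apply, Finsupp.single_apply, smul_eq_mul, h]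
  split_ifs <;> simp

theorem omega_skew (u v : OddInt →₀ ClassFn Γ) : omega ξ u v = -omega ξ v u := by
  suffices omega ξ = -(omega ξ).flip by
    have h := DFunLike.congr_fun (DFunLike.congr_fun this u) v
    simpa using h
  ext m γ n γ'
  simp only [LinearMap.comp_apply, Finsupp.lsingle_apply, LinearMap.neg_apply,
    LinearMap.flip_apply, omega_single]
  by_cases h : m.1 = -n.1
  · rw [if_pos h, if_pos (by omega), wform_symm, h]
    push_cast
    ring
  · rw [if_neg h, if_neg (by omega), neg_zero]

theorem omega_self (u : OddInt →₀ ClassFn Γ) : omega ξ u u = 0 := by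
  have := omega_skew (ξ := ξ) u u
  linear_combination this / 2

instance : Bracket (Heis ξ) (Heis ξ) :=
  ⟨fun x y => ((0, omega ξ (fstₗ x) (fstₗ y)) : (OddInt →₀ ClassFn Γ) × ℂ)⟩

theorem bracket_eq (x y : Heis ξ) : ⁅x, y⁆ = (omega ξ (fstₗ x) (fstₗ y)) • (C : Heis ξ) := by
  change ((0, omega ξ (fstₗ x) (fstₗ y)) : (OddInt →₀ ClassFn Γ) × ℂ) =
    (omega ξ (fstₗ x) (fstₗ y)) • ((0, 1) : (OddInt →₀ ClassFn Γ) × ℂ)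
  simp

theorem fst_bracket (x y : Heis ξ) : fstₗ ⁅x, y⁆ = 0 := rfl

instance : LieRing (Heis ξ) where
  add_lie x y w := by simp only [bracket_eq, map_add, LinearMap.add_apply, add_smul]
  lie_add x y w := by simp only [bracket_eq, map_add, add_smul]
  lie_self x := by rw [bracket_eq, omega_self, zero_smul]
  leibniz_lie x y w := by
    rw [bracket_eq x ⁅y, w⁆, bracket_eq ⁅x, y⁆ w, bracket_eq y ⁅x, w⁆]
    simp only [fst_bracket, map_zero, LinearMap.zero_apply, zero_smul, add_zero]

instance : LieAlgebra ℂ (Heis ξ) where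
  lie_smul t x y := by simp only [bracket_eq, map_smul, smul_eq_mul, mul_smul]

/-- The defining commutation relation `[a_m(γ), a_n(γ')] = (m/2) δ_{m,-n} ⟨γ, γ'⟩_ξ C`. -/
theorem a_lie_a (m n : OddInt) (γ γ' : ClassFn Γ) :
    ⁅(a m γ : Heis ξ), (a n γ' : Heis ξ)⁆ =
      (if m.1 = -n.1 then (m.1 : ℂ) / 2 * wform ξ γ γ' else 0) • (C : Heis ξ) := by
  rw [bracket_eq, ← omega_single]; rfl

theorem C_lie (x : Heis ξ) : ⁅(C : Heis ξ), x⁆ = 0 := by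
  rw [bracket_eq]
  have : fstₗ (C : Heis ξ) = 0 := rfl
  simp [this]

end Heis

/-! ### The Fock space action -/

section Derivation

variable {V : Type*} [AddCommMonoid V] [Module ℂ V]

/-- The derivation of the symmetric algebra extending a linear functional `φ` on the generators. -/
def symDer (φ : V →ₗ[ℂ] ℂ) : Derivation ℂ (SymmetricAlgebra ℂ V) (SymmetricAlgebra ℂ V) :=
  let F : SymmetricAlgebra ℂ V →ₐ[ℂ] TrivSqZeroExt (SymmetricAlgebra ℂ V) (SymmetricAlgebra ℂ V) :=
    SymmetricAlgebra.lift
      ((TrivSqZeroExt.inlAlgHom ℂ (SymmetricAlgebra ℂ V) (SymmetricAlgebra ℂ V)).toLinearMap ∘ₗ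
          SymmetricAlgebra.ι ℂ V +
        (TrivSqZeroExt.inrHom (SymmetricAlgebra ℂ V) (SymmetricAlgebra ℂ V)).restrictScalars ℂ ∘ₗ
          Algebra.linearMap ℂ (SymmetricAlgebra ℂ V) ∘ₗ φ)
  have hF : ∀ x, (F x).fst = x := fun x => by
    have : (TrivSqZeroExt.fstHom ℂ (SymmetricAlgebra ℂ V) (SymmetricAlgebra ℂ V)).comp F =
        AlgHom.id ℂ _ := by
      ext v
      simp [F]
    exact DFunLike.congr_fun this x
  Derivation.mk' ((TrivSqZeroExt.sndHom (SymmetricAlgebra ℂ V)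
      (SymmetricAlgebra ℂ V)).restrictScalars ℂ ∘ₗ F.toLinearMap) fun x y => by
    simp [hF, mul_comm]

@[simp] theorem symDer_ι (φ : V →ₗ[ℂ] ℂ) (v : V) :
    symDer φ (SymmetricAlgebra.ι ℂ V v) = algebraMap ℂ _ (φ v) := by
  simp [symDer, Algebra.algebraMap_eq_smul_one]

theorem der_ext {D D' : Derivation ℂ (SymmetricAlgebra ℂ V) (SymmetricAlgebra ℂ V)}
    (h : ∀ v, D (SymmetricAlgebra.ι ℂ V v) = D' (SymmetricAlgebra.ι ℂ V v)) : D = D' := by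
  ext x
  induction x using SymmetricAlgebra.induction with
  | algebraMap r => simp
  | ι v => exact h v
  | mul x y hx hy => simp [hx, hy]
  | add x y hx hy => simp [hx, hy]

/-- `symDer` is linear in the functional. -/
def symDerₗ : (V →ₗ[ℂ] ℂ) →ₗ[ℂ] Module.End ℂ (SymmetricAlgebra ℂ V) where
  toFun φ := (symDer φ).toLinearMap
  map_add' φ ψ := by
    have : symDer (φ + ψ) = symDer φ + symDer ψ := der_ext fun v => by simp
    rw [this]; rfl
  map_smul' r φ := by
    have : symDer (r • φ) = r • symDer φ := der_ext fun v => by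
      simp [Algebra.smul_def]
    rw [this]; rfl

end Derivation

section Fock

/-- For `n` positive and odd, the functional `a_{-m}(γ') ↦ (n/2) δ_{n,m} ⟨γ, γ'⟩_ξ` on the
generators of `S⁻_Γ`, as a linear function of `γ`. -/
def annFunctional (ξ : SelfDual Γ) (n : OddNat) :
    ClassFn Γ →ₗ[ℂ] (OddNat →₀ ClassFn Γ) →ₗ[ℂ] ℂ :=
  ((n.1 : ℂ) / 2) • (wform ξ).compl₂ (Finsupp.lapply n)

/-- The action of the `a_m(γ)` on `S⁻_Γ`: for `m = -n < 0` multiplication by `a_{-n}(γ)`, for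
`m = n > 0` the derivation with `a_{-k}(γ') ↦ (n/2) δ_{n,k} ⟨γ, γ'⟩_ξ`. -/
def fockA (ξ : SelfDual Γ) : (OddInt →₀ ClassFn Γ) →ₗ[ℂ] Module.End ℂ (SMinus Γ) :=
  Finsupp.lsum ℂ fun m : OddInt =>
    if 0 < m.1 then symDerₗ ∘ₗ annFunctional ξ m.abs
    else LinearMap.mul ℂ (SMinus Γ) ∘ₗ gen m.abs

theorem fockA_neg (ξ : SelfDual Γ) (m : OddInt) (hm : m.1 < 0) (γ : ClassFn Γ) (s : SMinus Γ) :
    fockA ξ (Finsupp.single m γ) s = gen m.abs γ * s := by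
  simp [fockA, not_lt.2 hm.le]

theorem fockA_pos (ξ : SelfDual Γ) (m : OddInt) (hm : 0 < m.1) (γ : ClassFn Γ) (s : SMinus Γ) :
    fockA ξ (Finsupp.single m γ) s = symDer (annFunctional ξ m.abs γ) s := by
  rw [fockA, Finsupp.lsum_single, if_pos hm]
  rfl

theorem symDer_ann_gen (ξ : SelfDual Γ) (n k : OddNat) (γ γ' : ClassFn Γ) :
    symDer (annFunctional ξ n γ) (gen k γ') =
      algebraMap ℂ (SMinus Γ) (if n = k then (n.1 : ℂ) / 2 * wform ξ γ γ' else 0) := by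
  rw [gen, LinearMap.comp_apply, symDer_ι]
  congr 1
  simp only [annFunctional, LinearMap.smul_apply, LinearMap.compl₂_apply, Finsupp.lsingle_apply,
    Finsupp.lapply_apply, Finsupp.single_apply, smul_eq_mul, eq_comm (a := k)]
  split_ifs <;> simp

theorem symDer_comm {V : Type*} [AddCommMonoid V] [Module ℂ V] (φ ψ : V →ₗ[ℂ] ℂ)
    (s : SymmetricAlgebra ℂ V) : symDer φ (symDer ψ s) = symDer ψ (symDer φ s) := by
  have h : ⁅symDer φ, symDer ψ⁆ = 0 := der_ext fun v => by simp [Derivation.commutator_apply]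
  have := DFunLike.congr_fun h s
  rw [Derivation.commutator_apply] at this
  exact sub_eq_zero.1 this

theorem fockA_comm_pos_neg (ξ : SelfDual Γ) (m n : OddInt) (hm : 0 < m.1) (hn : n.1 < 0)
    (γ γ' : ClassFn Γ) (s : SMinus Γ) :
    fockA ξ (Finsupp.single m γ) (fockA ξ (Finsupp.single n γ') s) -
      fockA ξ (Finsupp.single n γ') (fockA ξ (Finsupp.single m γ) s) =
    Heis.omega ξ (Finsupp.single m γ) (Finsupp.single n γ') • s := by
  simp only [fockA_neg ξ n hn, fockA_pos ξ m hm, Derivation.leibniz, symDer_ann_gen, smul_eq_mul,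
    Heis.omega_single, Algebra.smul_def, add_sub_cancel_left]
  rw [mul_comm]
  congr 2
  have h1 : m.abs = n.abs ↔ m.1 = -n.1 := by
    rw [Subtype.ext_iff]; change m.1.natAbs = n.1.natAbs ↔ _; omega
  have h2 : (m.abs.1 : ℂ) = (m.1 : ℂ) := by
    have : ((m.abs.1 : ℤ)) = m.1 := by change ((m.1.natAbs : ℕ) : ℤ) = m.1; omega
    exact_mod_cast congrArg (Int.cast : ℤ → ℂ) this
  simp only [h1, h2]

theorem fockA_comm (ξ : SelfDual Γ) (u v : OddInt →₀ ClassFn Γ) (s : SMinus Γ) :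
    fockA ξ u (fockA ξ v s) - fockA ξ v (fockA ξ u s) = Heis.omega ξ u v • s := by
  induction u using Finsupp.induction_linear with
  | zero => simp
  | add u u' h h' =>
    simp only [map_add, LinearMap.add_apply, add_smul, ← h, ← h']; abel
  | single m γ =>
    induction v using Finsupp.induction_linear with
    | zero => simp
    | add v v' h h' =>
      simp only [map_add, LinearMap.add_apply, add_smul, ← h, ← h']; abel
    | single n γ' =>
      have hm0 : m.1 ≠ 0 := by rintro h; have := m.2; simp [h] at this
      have hn0 : n.1 ≠ 0 := by rintro h; have := n.2; simp [h] at this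
      rcases lt_or_gt_of_ne hm0 with hm | hm <;> rcases lt_or_gt_of_ne hn0 with hn | hn
      · rw [Heis.omega_single, if_neg (by omega), zero_smul]
        simp only [fockA_neg ξ m hm, fockA_neg ξ n hn]
        ring
      · rw [Heis.omega_skew, neg_smul, ← fockA_comm_pos_neg ξ n m hn hm, neg_sub]
      · exact fockA_comm_pos_neg ξ m n hm hn γ γ' s
      · rw [Heis.omega_single, if_neg (by omega), zero_smul]
        simp only [fockA_pos ξ m hm, fockA_pos ξ n hn]
        rw [symDer_comm, sub_self]

/-- The representation of `ĥ_{Γ,ξ}[-1]` on `S⁻_Γ`; `C` acts as the identity. -/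
def fock (ξ : SelfDual Γ) : Heis ξ →ₗ⁅ℂ⁆ Module.End ℂ (SMinus Γ) :=
  { fockA ξ ∘ₗ Heis.fstₗ + (Heis.sndₗ (ξ := ξ)).smulRight (1 : Module.End ℂ (SMinus Γ)) with
    map_lie' := fun {x y} => by
      ext s
      have h := fockA_comm ξ (Heis.fstₗ x) (Heis.fstₗ y) s
      have h1 : Heis.fstₗ ⁅x, y⁆ = 0 := rfl
      have h2 : Heis.sndₗ ⁅x, y⁆ = Heis.omega ξ (Heis.fstₗ x) (Heis.fstₗ y) := rfl
      simp only [AddHom.toFun_eq_coe, LinearMap.coe_toAddHom, LinearMap.add_apply,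
        LinearMap.comp_apply, LinearMap.smulRight_apply, h1, h2, map_zero, zero_add,
        LinearMap.smul_apply, Module.End.one_apply, Ring.lie_def, LinearMap.sub_apply,
        Module.End.mul_apply, map_add, map_smul, ← h]
      module }

end Fock

/-! ## Representations given by operators -/

section Rep

variable {L : Type*} [LieRing L] [LieAlgebra ℂ L]
variable {V : Type*} [AddCommGroup V] [Module ℂ V] {W : Type*} [AddCommGroup W] [Module ℂ W]

/-- A subspace is a subrepresentation if it is stable under all operators. -/
def IsSubrep (ρ : L →ₗ⁅ℂ⁆ Module.End ℂ V) (N : Submodule ℂ V) : Prop :=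
  ∀ x, ∀ v ∈ N, ρ x v ∈ N

/-- The restriction of a representation to a subrepresentation. -/
def subRep (ρ : L →ₗ⁅ℂ⁆ Module.End ℂ V) (N : Submodule ℂ V) (hN : IsSubrep ρ N) :
    L →ₗ⁅ℂ⁆ Module.End ℂ N where
  toFun x := (ρ x).restrict (hN x)
  map_add' x y := by ext v; simp
  map_smul' r x := by ext v; simp
  map_lie' {x y} := by ext v; simp [Ring.lie_def]

/-- The quotient of a representation by a subrepresentation. -/
def quotRep (ρ : L →ₗ⁅ℂ⁆ Module.End ℂ V) (N : Submodule ℂ V) (hN : IsSubrep ρ N) :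
    L →ₗ⁅ℂ⁆ Module.End ℂ (V ⧸ N) where
  toFun x := N.mapQ N (ρ x) (hN x)
  map_add' x y := by ext v; simp
  map_smul' r x := by ext v; simp
  map_lie' {x y} := by ext v; simp [Ring.lie_def]

/-- Irreducibility: the space is nonzero and has no subrepresentations but `0` and itself. -/
def IsIrreducibleRep (ρ : L →ₗ⁅ℂ⁆ Module.End ℂ V) : Prop :=
  Nontrivial V ∧ ∀ N : Submodule ℂ V, IsSubrep ρ N → N = ⊥ ∨ N = ⊤

/-- A linear map is an isomorphism of representations if it is bijective and equivariant. -/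
def IsRepIso (ρ : L →ₗ⁅ℂ⁆ Module.End ℂ V) (τ : L →ₗ⁅ℂ⁆ Module.End ℂ W) (f : V →ₗ[ℂ] W) : Prop :=
  Function.Bijective f ∧ ∀ x v, f (ρ x v) = τ x (f v)

end Rep

/-- The operators `ã_n(γ)` on `R⁻_Γ`: for `n < 0`, outer tensor product with `σ_{|n|}(γ)` followed by
induction; for `n > 0`, restriction followed by the pairing `⟨σ_n(γ), ·⟩_ξ`. -/
def aTilde (ξ : SelfDual Γ) (n : OddInt) (γ : ClassFn Γ) : Module.End ℂ (RMinus Γ) :=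
  if 0 < n.1 then lowerOp ξ (sigma n.abs γ) else raiseOp (sigma n.abs γ)

end Heisenberg

end SpinWreath

end

/-! Everything is transported from the Fock space. For a multiset M of pairs (k, c), with k odd and
c a class, of total size n, let b_M be the function `basisFn n M`, equal to 1 on D_M^+, to -1 on
D_M^- and to 0 elsewhere, and let `mon M` be the product of the a_{-k}(c). Both families are bases,
and `ch` sends b_M to 2^{l(M)/2} Z_M⁻¹ `mon M`. Being diagonal with nonzero entries, `ch` is
bijective.

That the b_M form a basis rests on the conjugacy classes. The kernel of S̃_n → S_n is exactly {1,
z}: a coset count bounds it by two elements, and a representation in a Clifford algebra shows z ≠ 1.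
Hence elements with the same cycle types (length, class of the cycle product) are conjugate up to z
(`simZ_of_cycleTypes_eq`). If there is an even cycle, an even element is conjugate to z times
itself, so spin functions vanish there (`superFn_apply_eq_zero_of_even`). If all cycles are odd,
exactly one of t and zt has odd order; this gives a conjugation-invariant sign, multiplicative on
spin products, which separates D_M^+ from D_M^- and, normalized on the standard representatives, is
`normSign`.

On the basis the operators are elementary. Raising by b_p with p = (k, c) adds p to M with the
factor m + 1, where m is the multiplicity of p in M: induction counts the cycles of type p
(`raise_basisFn`). Lowering by b_p removes (k, c⁻¹) with the factor ξ(c)/(k ζ_c): the pairing counts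
the elements that are a single cycle of type p (`lower_basisFn`). Adding p multiplies Z_M by k ζ_c
(m + 1), so with the powers of √2 these become multiplication by a_{-k}(γ) and the Fock derivation
(`ch_raiseOp_sigma`, `ch_lowerOp_sigma`). The commutation relations on R⁻_Γ are then inherited from
the Fock space.

Both R⁰_Γ and S⁰_Γ are spanned by the basis elements whose M contains a class with ξ(c) = 0
(`mem_RZero_iff`, `mem_SZero_iff`), so `ch` matches them. For irreducibility, a subrepresentation
strictly above S⁰_Γ has an element with a nonzero coefficient at some M free of such classes; for M
with the most parts, the annihilation operators attached to M turn that element into a nonzero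
constant modulo S⁰_Γ, and the creation operators generate everything from 1. -/

noncomputable section

namespace SpinWreath

open Classical

namespace SpinSym

/-! ### Non-triviality of the central element -/

section Clifford

variable {n : ℕ}

/-- The quadratic form `-(1/2) ∑ v_i²`. -/
def cliffordForm (n : ℕ) : QuadraticForm ℝ (Fin n → ℝ) :=
  QuadraticMap.weightedSumSquares ℝ fun _ => (-(1 / 2) : ℝ)

theorem cliffordForm_apply (v : Fin n → ℝ) : cliffordForm n v = -(1 / 2) * (v ⬝ᵥ v) := by
  simp [cliffordForm, QuadraticMap.weightedSumSquares_apply, dotProduct, Finset.mul_sum]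

theorem cliffordForm_polar (u v : Fin n → ℝ) :
    QuadraticMap.polar (cliffordForm n) u v = -(u ⬝ᵥ v) := by
  simp only [QuadraticMap.polar, cliffordForm_apply, add_dotProduct, dotProduct_add,
    dotProduct_comm v u]
  ring

/-- The root `e_i - e_{i+1}`. -/
def root (i : ℕ) (h : i + 1 < n) : Fin n → ℝ :=
  Pi.single ⟨i, by omega⟩ 1 - Pi.single ⟨i + 1, h⟩ 1

/-- This is the Cartan matrix of type A. With the form `cliffordForm` the roots then square to -1,
adjacent ones satisfy ab + ba = 1 and distant ones anticommute: these are the relations of S̃_n with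
z acting as -1. -/
theorem root_dotProduct (i j : ℕ) (hi : i + 1 < n) (hj : j + 1 < n) :
    root i hi ⬝ᵥ root j hj =
      (if i = j then 2 else if i = j + 1 ∨ j = i + 1 then -1 else 0 : ℝ) := by
  simp only [root, sub_dotProduct, dotProduct_sub, single_dotProduct, one_mul, Pi.single_apply,
    Fin.mk.injEq]
  split_ifs <;> first | omega | norm_num

/-- The image of `t i` in the Clifford algebra. -/
def cliffordT (i : ℕ) (h : i + 1 < n) : CliffordAlgebra (cliffordForm n) :=
  CliffordAlgebra.ι _ (root i h)

theorem cliffordT_sq (i : ℕ) (h : i + 1 < n) : cliffordT i h * cliffordT i h = -1 := by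
  rw [cliffordT, CliffordAlgebra.ι_sq_scalar, cliffordForm_apply, root_dotProduct]
  simp

theorem cliffordT_swap (i j : ℕ) (hi : i + 1 < n) (hj : j + 1 < n) :
    cliffordT i hi * cliffordT j hj + cliffordT j hj * cliffordT i hi =
      algebraMap ℝ _ (-(root i hi ⬝ᵥ root j hj)) := by
  rw [cliffordT, cliffordT, CliffordAlgebra.ι_mul_ι_add_swap, cliffordForm_polar]

/-- The unit given by `t i`. -/
def cliffordUnit (i : ℕ) (h : i + 1 < n) : (CliffordAlgebra (cliffordForm n))ˣ where
  val := cliffordT i h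
  inv := -cliffordT i h
  val_inv := by rw [mul_neg, cliffordT_sq, neg_neg]
  inv_val := by rw [neg_mul, cliffordT_sq, neg_neg]

/-- Substituting ba = 1 - ab shows that X = ab satisfies X² = X - 1, hence X³ = -1. This is the
braid relation with z read as -1. -/
theorem cube_eq_neg_one {R : Type*} [Ring R] {a b : R} (ha : a * a = -1) (hb : b * b = -1)
    (hab : a * b + b * a = 1) : (a * b) ^ 3 = -1 := by
  have h1 : b * a = 1 - a * b := by rw [← hab]; abel
  have h2 : (a * b) ^ 2 = a * b - 1 := by
    calc (a * b) ^ 2 = a * (b * a) * b := by rw [pow_two]; simp only [mul_assoc]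
      _ = a * b - (a * a) * (b * b) := by rw [h1]; simp only [mul_sub, sub_mul, mul_one, mul_assoc]
      _ = _ := by rw [ha, hb]; simp
  rw [pow_succ, h2, sub_mul, ← pow_two, h2, one_mul]
  abel

/-- The representation of `S̃_n` by units of the Clifford algebra. -/
def toClifford (n : ℕ) : SpinSym n →* (CliffordAlgebra (cliffordForm n))ˣ :=
  lift (-1) cliffordUnit (by simp)
    (fun i h => Units.ext (cliffordT_sq i h))
    (fun i h h' => Units.ext <| by
      refine cube_eq_neg_one (cliffordT_sq i h) (cliffordT_sq _ h') ?_
      change cliffordT _ _ * cliffordT _ _ + cliffordT _ _ * cliffordT _ _ = 1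
      rw [cliffordT_swap, root_dotProduct]
      simp)
    (fun i j hi hj hij => Units.ext <| by
      have h := cliffordT_swap i j hi hj
      rw [root_dotProduct, if_neg (by omega), if_neg (by omega), neg_zero, map_zero] at h
      change cliffordT _ _ * cliffordT _ _ = -1 * cliffordT _ _ * cliffordT _ _
      rw [eq_neg_of_add_eq_zero_left h]
      simp)
    (by simp)

/-- In the Clifford algebra z acts as -1, which differs from 1 because the real scalars embed.
Without this, f(zx) = -f(x) would force every spin function to vanish. -/
theorem z_ne_one (n : ℕ) : z n ≠ 1 := by
  intro h
  have h1 := congrArg (fun x => ((toClifford n x : _ˣ) : CliffordAlgebra (cliffordForm n))) h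
  have h2 : toClifford n (z n) = -1 := lift_z
  simp only [h2, map_one, Units.val_neg, Units.val_one] at h1
  have : Nontrivial (CliffordAlgebra (cliffordForm n)) :=
    have : Invertible (2 : ℝ) := invertibleOfNonzero two_ne_zero
    inferInstance
  have h3 : algebraMap ℝ (CliffordAlgebra (cliffordForm n)) (-1) =
      algebraMap ℝ (CliffordAlgebra (cliffordForm n)) 1 := by simpa using h1
  have h4 := (algebraMap ℝ (CliffordAlgebra (cliffordForm n))).injective h3
  norm_num at h4

end Clifford

/-! ### The kernel and the image of the projection to the symmetric group -/

variable {n m : ℕ}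

theorem theta_surjective (n : ℕ) : Function.Surjective (theta n) := by
  rcases n with _ | n
  · intro σ
    exact ⟨1, Subsingleton.elim _ _⟩
  · intro σ
    have hσ : σ ∈ Submonoid.closure
        (Set.range fun i : Fin n ↦ Equiv.swap i.castSucc i.succ) := by
      rw [Equiv.Perm.mclosure_swap_castSucc_succ]; trivial
    have : Submonoid.closure (Set.range fun i : Fin n ↦ Equiv.swap i.castSucc i.succ) ≤
        MonoidHom.mrange (theta (n + 1)) := by
      rw [Submonoid.closure_le]
      rintro _ ⟨i, rfl⟩
      exact ⟨t (n + 1) i, theta_t (by omega)⟩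
    exact this hσ

theorem card_low_zero_le (n : ℕ) : Nat.card (low n 0) ≤ 2 := by
  have h : (low n 0 : Set (SpinSym n)) ⊆ {1, z n} := by
    intro x hx
    induction hx using Subgroup.closure_induction_right with
    | one => simp
    | mul_right x _ y hy h =>
      rcases hy with rfl | ⟨i, hi, _, rfl⟩
      · rcases h with rfl | rfl <;> simp [z_mul_z]
      · omega
    | mul_inv_cancel x _ y hy h =>
      rcases hy with rfl | ⟨i, hi, hi', rfl⟩
      · rcases h with rfl | rfl <;> simp [inv_z, z_mul_z]
      · omega
  calc Nat.card (low n 0) = (low n 0 : Set (SpinSym n)).ncard := rfl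
    _ ≤ ({1, z n} : Set (SpinSym n)).ncard := Set.ncard_le_ncard h
    _ ≤ 2 := (Set.ncard_insert_le _ _).trans (by rw [Set.ncard_singleton])

/-- By `low_succ`, each stage is covered by the cosets of the k + 2 elements `desc n k d` with d ≤ k
+ 1, so the order grows by a factor of at most k + 2. -/
theorem card_low_le (k : ℕ) (hk : k < n) : Nat.card (low n k) ≤ 2 * (k + 1).factorial := by
  induction k with
  | zero => simpa using card_low_zero_le n
  | succ k ih =>
    let F : low n k × Fin (k + 2) → SpinSym n := fun p => p.1.1 * desc n k p.2
    have hF : ∀ x : low n (k + 1), ∃ p, F p = x.1 := fun x => by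
      obtain ⟨l, hl, d, hd, e⟩ := low_succ hk x.1 x.2
      exact ⟨(⟨l, hl⟩, ⟨d, by omega⟩), e.symm⟩
    choose G hG using hF
    have hGi : Function.Injective G := fun x y h => Subtype.ext (by rw [← hG, ← hG, h])
    calc Nat.card (low n (k + 1)) ≤ Nat.card (low n k × Fin (k + 2)) :=
          Nat.card_le_card_of_injective G hGi
      _ = Nat.card (low n k) * (k + 2) := by rw [Nat.card_prod, Nat.card_fin]
      _ ≤ 2 * (k + 1).factorial * (k + 2) := Nat.mul_le_mul_right _ (ih (by omega))
      _ = 2 * (k + 1 + 1).factorial := by rw [Nat.factorial_succ (k + 1)]; ring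

theorem card_le (n : ℕ) : Nat.card (SpinSym n) ≤ 2 * n.factorial := by
  have top : ∀ k, n ≤ k + 1 → low n k = ⊤ := fun k hk => by
    rw [eq_top_iff, ← closure_gens]
    apply Subgroup.closure_mono
    apply Set.insert_subset_insert
    rintro x ⟨i, hi, rfl⟩
    exact ⟨i, by omega, hi, rfl⟩
  rcases n with _ | n
  · have := card_low_zero_le 0
    rw [top 0 (by omega), Subgroup.card_top] at this
    simpa using this
  · have := card_low_le (n := n + 1) n (by omega)
    rwa [top n (by omega), Subgroup.card_top] at this

/-- The order of the kernel times n! is the order of S̃_n, which is at most 2 n!. So the kernel has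
at most two elements, and 1 and z are already two. -/
theorem eq_one_or_eq_z_of_theta_eq_one {x : SpinSym n} (hx : theta n x = 1) :
    x = 1 ∨ x = z n := by
  have h1 : Nat.card (theta n).ker * Nat.card (theta n).range = Nat.card (SpinSym n) := by
    rw [← Subgroup.index_ker, Subgroup.card_mul_index]
  rw [MonoidHom.range_eq_top.2 (theta_surjective n), Subgroup.card_top, Nat.card_perm,
    Nat.card_fin] at h1
  have h2 : Nat.card (theta n).ker ≤ 2 := by
    have := card_le n
    rw [← h1] at this
    exact Nat.le_of_mul_le_mul_right this (Nat.factorial_pos n)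
  by_contra hne
  push Not at hne
  have h3 : ({1, z n, x} : Finset (SpinSym n)).card = 3 := by
    rw [Finset.card_eq_three]
    exact ⟨1, z n, x, (z_ne_one n).symm, hne.1.symm, hne.2.symm, rfl⟩
  have h4 : ((({1, z n, x} : Finset (SpinSym n)) : Set (SpinSym n))).ncard ≤
      ((theta n).ker : Set (SpinSym n)).ncard := by
    refine Set.ncard_le_ncard ?_ (Set.toFinite _)
    intro y hy
    simp only [Finset.coe_insert, Finset.coe_singleton, Set.mem_insert_iff,
      Set.mem_singleton_iff] at hy
    rcases hy with rfl | rfl | rfl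
    · exact one_mem _
    · exact theta_z
    · exact hx
  rw [Set.ncard_coe_finset, h3] at h4
  have h5 : ((theta n).ker : Set (SpinSym n)).ncard = Nat.card (theta n).ker := rfl
  omega

theorem eq_or_eq_z_mul_of_theta_eq {x y : SpinSym n} (h : theta n x = theta n y) :
    x = y ∨ x = z n * y := by
  rcases eq_one_or_eq_z_of_theta_eq_one (x := x * y⁻¹) (by simp [h]) with h | h
  · exact Or.inl (mul_inv_eq_one.1 h)
  · exact Or.inr (mul_inv_eq_iff_eq_mul.1 h)

theorem sgn_eq_sign_theta (x : SpinSym n) : sgn n x = Equiv.Perm.sign (theta n x) := by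
  suffices sgn n = Equiv.Perm.sign.comp (theta n) from DFunLike.congr_fun this x
  apply hom_ext
  · simp
  · intro i h
    rw [MonoidHom.comp_apply, sgn_t h, theta_t h, Equiv.Perm.sign_swap (by simp)]

/-- An element of `S̃_{n+m}` preserving the first `n` letters is a product of elements of
the two embedded subgroups. -/
theorem exists_inLeft_mul_inRight (x : SpinSym (n + m))
    (hx : ∀ i : Fin n, ∃ j : Fin n, theta (n + m) x (Fin.castAdd m i) = Fin.castAdd m j) :
    ∃ a b, x = inLeft n m a * inRight n m b := by
  let e : Fin n ⊕ Fin m ≃ Fin (n + m) := finSumFinEquiv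
  have hmem : e.symm.permCongr (theta (n + m) x) ∈
      (Equiv.Perm.sumCongrHom (Fin n) (Fin m)).range := by
    apply Equiv.Perm.mem_sumCongrHom_range_of_perm_mapsTo_inl
    rintro _ ⟨i, rfl⟩
    obtain ⟨j, hj⟩ := hx i
    refine ⟨j, ?_⟩
    rw [Equiv.permCongr_apply, Equiv.symm_symm]
    change _ = e.symm (theta (n + m) x (finSumFinEquiv (Sum.inl i)))
    rw [finSumFinEquiv_apply_left, hj, eq_comm, Equiv.symm_apply_eq]
    rfl
  obtain ⟨⟨σ, τ⟩, h⟩ := hmem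
  obtain ⟨a, rfl⟩ := theta_surjective n σ
  obtain ⟨b, rfl⟩ := theta_surjective m τ
  have key : theta (n + m) x = theta (n + m) (inLeft n m a * inRight n m b) := by
    ext1 i
    have h' : ∀ s, theta (n + m) x (e s) =
        e (Equiv.Perm.sumCongrHom (Fin n) (Fin m) (theta n a, theta m b) s) := fun s => by
      rw [h, Equiv.permCongr_apply]; simp
    rw [map_mul, Equiv.Perm.mul_apply]
    refine Fin.addCases (fun i => ?_) (fun i => ?_) i
    · rw [theta_inRight_castAdd, theta_inLeft_castAdd]
      simpa [e] using h' (Sum.inl i)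
    · rw [theta_inRight_natAdd, theta_inLeft_natAdd]
      simpa [e] using h' (Sum.inr i)
  rcases eq_or_eq_z_mul_of_theta_eq key with h | h
  · exact ⟨a, b, h⟩
  -- The two sides agree in the symmetric group only; a possible factor z is absorbed in the left
  -- component.
  · exact ⟨z n * a, b, by rw [h, map_mul, inLeft_z, mul_assoc]⟩

end SpinSym

/-! ## Cycle types in spin wreath products -/

section CycleTypes

variable {Γ : Type*} [Group Γ] {n m k : ℕ}

/-- The projection `Γ̃_n → S_n`. -/
def permW : SpinWr Γ n →* Equiv.Perm (Fin n) := (SpinSym.theta n).comp SemidirectProduct.rightHom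

theorem permW_apply (x : SpinWr Γ n) : permW x = SpinSym.theta n x.right := rfl

@[simp] theorem permW_zW : permW (zW Γ n) = 1 := by simp [permW_apply, zW]

theorem permW_surjective : Function.Surjective (permW (Γ := Γ) (n := n)) := fun σ => by
  obtain ⟨t, rfl⟩ := SpinSym.theta_surjective n σ
  exact ⟨SemidirectProduct.inr t, rfl⟩

theorem mul_left_apply (x y : SpinWr Γ n) (i : Fin n) :
    (x * y).left i = x.left i * y.left ((permW x)⁻¹ i) := rfl

/-- The cocycle rule, evaluated at the image of a point so that no inverse appears. Iterated, it
shows that the entries of the powers of x are products of labels along a cycle. -/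
theorem mul_left_perm (x y : SpinWr Γ n) (i : Fin n) :
    (x * y).left (permW x i) = x.left (permW x i) * y.left i := by
  rw [mul_left_apply, ← Equiv.Perm.mul_apply, inv_mul_cancel, Equiv.Perm.one_apply]

/-- The kernel of `theta` is {1, z}, so labels and permutation determine an element up to z.
Conjugacy can therefore be studied in the ordinary wreath product, with z tracked separately. -/
theorem eq_or_eq_zW_mul {x y : SpinWr Γ n} (hl : x.left = y.left) (hp : permW x = permW y) :
    x = y ∨ x = zW Γ n * y := by
  rcases SpinSym.eq_or_eq_z_mul_of_theta_eq (x := x.right) (y := y.right) hp with h | h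
  · exact Or.inl (SemidirectProduct.ext hl h)
  · refine Or.inr (SemidirectProduct.ext ?_ ?_)
    · ext i; simp [zW, wreathAct_apply, hl]
    · simp [zW, h]

theorem zW_mul_ne (x : SpinWr Γ n) : zW Γ n * x ≠ x := by
  intro h
  have h1 : zW Γ n = 1 := by simpa using h
  exact SpinSym.z_ne_one n (congrArg (fun x : SpinWr Γ n => x.right) h1)

@[simp] theorem zW_mul_left (x : SpinWr Γ n) : (zW Γ n * x).left = x.left := by
  ext i; simp [zW, wreathAct_apply]

theorem embL_left_castAdd (x : SpinWr Γ n) (i : Fin n) :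
    (embL n m x).left (Fin.castAdd m i) = x.left i := by simp [embL, extLeft]
theorem embL_left_natAdd (x : SpinWr Γ n) (i : Fin m) :
    (embL n m x).left (Fin.natAdd n i) = 1 := by simp [embL, extLeft]
theorem embR_left_castAdd (x : SpinWr Γ m) (i : Fin n) :
    (embR n m x).left (Fin.castAdd m i) = 1 := by simp [embR, extRight]
theorem embR_left_natAdd (x : SpinWr Γ m) (i : Fin m) :
    (embR n m x).left (Fin.natAdd n i) = x.left i := by simp [embR, extRight]
theorem permW_embL_castAdd (x : SpinWr Γ n) (i : Fin n) :
    permW (embL n m x) (Fin.castAdd m i) = Fin.castAdd m (permW x i) :=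
  SpinSym.theta_inLeft_castAdd _ _
theorem permW_embL_natAdd (x : SpinWr Γ n) (i : Fin m) :
    permW (embL n m x) (Fin.natAdd n i) = Fin.natAdd n i :=
  SpinSym.theta_inLeft_natAdd _ _
theorem permW_embR_castAdd (x : SpinWr Γ m) (i : Fin n) :
    permW (embR n m x) (Fin.castAdd m i) = Fin.castAdd m i :=
  SpinSym.theta_inRight_castAdd _ _
theorem permW_embR_natAdd (x : SpinWr Γ m) (i : Fin m) :
    permW (embR n m x) (Fin.natAdd n i) = Fin.natAdd n (permW x i) :=
  SpinSym.theta_inRight_natAdd _ _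

/-! ### Restriction to a set of letters, and the type of a cycle -/

/-- The restriction of `w` along the embedding `f` of index sets is `x`. -/
def RestrictsTo (w : SpinWr Γ m) (x : SpinWr Γ n) (f : Fin n → Fin m) : Prop :=
  ∀ i, w.left (f i) = x.left i ∧ permW w (f i) = f (permW x i)

theorem RestrictsTo.one (f : Fin n → Fin m) : RestrictsTo (1 : SpinWr Γ m) 1 f :=
  fun i => by simp

theorem RestrictsTo.inv_apply {w : SpinWr Γ m} {x : SpinWr Γ n} {f : Fin n → Fin m}
    (h : RestrictsTo w x f) (i : Fin n) : (permW w)⁻¹ (f i) = f ((permW x)⁻¹ i) := by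
  rw [Equiv.Perm.inv_eq_iff_eq, (h _).2, ← Equiv.Perm.mul_apply, mul_inv_cancel,
    Equiv.Perm.one_apply]

theorem RestrictsTo.mul {w w' : SpinWr Γ m} {x x' : SpinWr Γ n} {f : Fin n → Fin m}
    (h : RestrictsTo w x f) (h' : RestrictsTo w' x' f) : RestrictsTo (w * w') (x * x') f :=
  fun i => ⟨by rw [mul_left_apply, mul_left_apply, (h i).1, h.inv_apply, (h' _).1],
    by rw [map_mul, map_mul, Equiv.Perm.mul_apply, Equiv.Perm.mul_apply, (h' _).2, (h _).2]⟩

theorem RestrictsTo.pow {w : SpinWr Γ m} {x : SpinWr Γ n} {f : Fin n → Fin m}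
    (h : RestrictsTo w x f) (r : ℕ) : RestrictsTo (w ^ r) (x ^ r) f := by
  induction r with
  | zero => simpa using RestrictsTo.one f
  | succ r ih => rw [pow_succ, pow_succ]; exact ih.mul h

theorem restrictsTo_castAdd (x : SpinWr Γ n) (y : SpinWr Γ m) :
    RestrictsTo (embL n m x * embR n m y) x (Fin.castAdd m) := by
  have h1 : RestrictsTo (embL n m x) x (Fin.castAdd m) :=
    fun i => ⟨embL_left_castAdd _ _, permW_embL_castAdd _ _⟩
  have h2 : RestrictsTo (embR n m y) 1 (Fin.castAdd m) :=
    fun i => ⟨embR_left_castAdd _ _, permW_embR_castAdd _ _⟩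
  simpa using h1.mul h2

theorem restrictsTo_natAdd (x : SpinWr Γ n) (y : SpinWr Γ m) :
    RestrictsTo (embL n m x * embR n m y) y (Fin.natAdd n) := by
  have h1 : RestrictsTo (embL n m x) 1 (Fin.natAdd n) :=
    fun i => ⟨embL_left_natAdd _ _, permW_embL_natAdd _ _⟩
  have h2 : RestrictsTo (embR n m y) y (Fin.natAdd n) :=
    fun i => ⟨embR_left_natAdd _ _, permW_embR_natAdd _ _⟩
  simpa using h1.mul h2

theorem restrictsTo_zW (x : SpinWr Γ n) : RestrictsTo (zW Γ n * x) x id :=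
  fun i => ⟨congrFun (zW_mul_left x) i, by simp⟩

/-- The length of the cycle of `i`. -/
def cycleLen (x : SpinWr Γ n) (i : Fin n) : ℕ := Function.minimalPeriod (permW x) i

/-- The length of the cycle of `i`, and the conjugacy class of its cycle product. -/
def ptype (x : SpinWr Γ n) (i : Fin n) : ℕ × ConjClasses Γ :=
  (cycleLen x i, ConjClasses.mk ((x ^ cycleLen x i).left i))

theorem isPeriodicPt_iff (x : SpinWr Γ n) (i : Fin n) (r : ℕ) :
    Function.IsPeriodicPt (permW x) r i ↔ permW (x ^ r) i = i := by
  rw [Function.IsPeriodicPt, Function.IsFixedPt, ← Equiv.Perm.coe_pow, map_pow]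

theorem cycleLen_pos (x : SpinWr Γ n) (i : Fin n) : 0 < cycleLen x i := by
  apply Function.minimalPeriod_pos_of_mem_periodicPts
  refine ⟨orderOf (permW x), orderOf_pos _, ?_⟩
  rw [isPeriodicPt_iff, map_pow, pow_orderOf_eq_one]
  rfl

theorem permW_pow_cycleLen (x : SpinWr Γ n) (i : Fin n) : permW (x ^ cycleLen x i) i = i :=
  (isPeriodicPt_iff _ _ _).1 (Function.isPeriodicPt_minimalPeriod _ _)

/-- The type is defined through powers of x, not through a list of labels. To compare two types it
is enough to compare powers, and restriction, conjugation and inversion all commute with powers. -/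
theorem ptype_eq_of {x : SpinWr Γ n} {y : SpinWr Γ m} {i : Fin n} {j : Fin m}
    (h : ∀ r, permW (x ^ r) i = i ↔ permW (y ^ r) j = j)
    (h' : ∀ r, permW (x ^ r) i = i → ConjClasses.mk ((x ^ r).left i) =
      ConjClasses.mk ((y ^ r).left j)) : ptype x i = ptype y j := by
  have e : cycleLen x i = cycleLen y j :=
    Function.minimalPeriod_eq_minimalPeriod_iff.2 fun r => by
      rw [isPeriodicPt_iff, isPeriodicPt_iff, h]
  rw [ptype, ptype, h' _ (permW_pow_cycleLen x i), e]

theorem RestrictsTo.ptype_eq {w : SpinWr Γ m} {x : SpinWr Γ n} {f : Fin n → Fin m}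
    (h : RestrictsTo w x f) (hf : Function.Injective f) (i : Fin n) :
    ptype w (f i) = ptype x i :=
  ptype_eq_of (fun r => by rw [(h.pow r i).2, hf.eq_iff]) fun r _ => by rw [(h.pow r i).1]

theorem ptype_castAdd (x : SpinWr Γ n) (y : SpinWr Γ m) (i : Fin n) :
    ptype (embL n m x * embR n m y) (Fin.castAdd m i) = ptype x i :=
  (restrictsTo_castAdd x y).ptype_eq (Fin.castAdd_injective n m) i

theorem ptype_natAdd (x : SpinWr Γ n) (y : SpinWr Γ m) (i : Fin m) :
    ptype (embL n m x * embR n m y) (Fin.natAdd n i) = ptype y i :=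
  (restrictsTo_natAdd x y).ptype_eq (Fin.natAdd_injective m n) i

theorem ptype_zW_mul (x : SpinWr Γ n) (i : Fin n) : ptype (zW Γ n * x) i = ptype x i :=
  (restrictsTo_zW x).ptype_eq Function.injective_id i

/-- When v fixes i, the labels of u at the two ends of the conjugation are the same one. This is why
a cycle product is defined up to conjugacy only, and why its class is an invariant. -/
theorem conj_left_perm (u v : SpinWr Γ n) (i : Fin n) (h : permW v i = i) :
    (u * v * u⁻¹).left (permW u i) =
      u.left (permW u i) * v.left i * (u.left (permW u i))⁻¹ := by
  have h1 := mul_left_apply (u * v * u⁻¹) u (permW u i)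
  rw [inv_mul_cancel_right, mul_left_perm] at h1
  have h2 : (permW (u * v * u⁻¹))⁻¹ (permW u i) = permW u i := by
    rw [Equiv.Perm.inv_eq_iff_eq]; simp [h]
  rw [h2] at h1
  rw [h1, mul_inv_cancel_right]

theorem ptype_conj (u x : SpinWr Γ n) (i : Fin n) :
    ptype (u * x * u⁻¹) (permW u i) = ptype x i := by
  refine (ptype_eq_of (fun r => ?_) fun r hr => ?_).symm
  · rw [conj_pow]; simp
  · rw [conj_pow, conj_left_perm _ _ _ hr, ConjClasses.mk_eq_mk_iff_isConj, isConj_iff]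
    exact ⟨_, rfl⟩

theorem ptype_perm (x : SpinWr Γ n) (i : Fin n) : ptype x (permW x i) = ptype x i := by
  simpa using ptype_conj x x i

theorem ptype_perm_pow (x : SpinWr Γ n) (j : ℕ) (i : Fin n) :
    ptype x ((permW x ^ j) i) = ptype x i := by
  induction j with
  | zero => simp
  | succ j ih => rw [pow_succ', Equiv.Perm.mul_apply, ptype_perm, ih]

/-- The class of inverses. -/
def invClass (c : ConjClasses Γ) : ConjClasses Γ :=
  Quotient.map' (fun g => g⁻¹) (fun a b h => by
    obtain ⟨u, rfl⟩ := isConj_iff.1 h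
    exact isConj_iff.2 ⟨u, by group⟩) c

@[simp] theorem invClass_mk (g : Γ) : invClass (ConjClasses.mk g) = ConjClasses.mk g⁻¹ := rfl

@[simp] theorem invClass_invClass (c : ConjClasses Γ) : invClass (invClass c) = c := by
  induction c using Quotient.inductionOn' with
  | h g => exact congrArg ConjClasses.mk (inv_inv g)

theorem inv_left_apply (v : SpinWr Γ n) (i : Fin n) (h : permW v i = i) :
    v⁻¹.left i = (v.left i)⁻¹ := by
  have := mul_left_perm v v⁻¹ i
  rw [h, mul_inv_cancel] at this
  exact eq_inv_of_mul_eq_one_right (by simpa using this.symm)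

theorem ptype_inv (x : SpinWr Γ n) (i : Fin n) :
    ptype x⁻¹ i = ((ptype x i).1, invClass (ptype x i).2) := by
  have e : cycleLen x⁻¹ i = cycleLen x i :=
    Function.minimalPeriod_eq_minimalPeriod_iff.2 fun r => by
      rw [isPeriodicPt_iff, isPeriodicPt_iff, inv_pow, map_inv, Equiv.Perm.inv_eq_iff_eq, eq_comm]
  rw [ptype, ptype, e, inv_pow, inv_left_apply _ _ (permW_pow_cycleLen x i), invClass_mk]

/-! ### The multiset of cycle types -/

theorem mem_cycleReps {σ : Equiv.Perm (Fin n)} {i : Fin n} :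
    i ∈ cycleReps σ ↔ ∀ j : ℕ, i ≤ (σ ^ j) i := by simp [cycleReps]

theorem pow_apply_back (σ : Equiv.Perm (Fin n)) (i : Fin n) (j : ℕ) :
    ∃ l : ℕ, (σ ^ l) ((σ ^ j) i) = i := by
  -- A nonnegative exponent representing the inverse of σ^j.
  refine ⟨j * (orderOf σ - 1), ?_⟩
  have h := orderOf_pos σ
  rw [← Equiv.Perm.mul_apply, ← pow_add,
    show j * (orderOf σ - 1) + j = orderOf σ * j by
      rw [← Nat.mul_succ, Nat.succ_eq_add_one, Nat.sub_add_cancel h, mul_comm],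
    pow_mul, pow_orderOf_eq_one, one_pow, Equiv.Perm.one_apply]

theorem exists_cycleRep (σ : Equiv.Perm (Fin n)) (i : Fin n) :
    ∃ r ∈ cycleReps σ, ∃ j : ℕ, (σ ^ j) r = i := by
  let j := Function.argmin (fun j : ℕ => (σ ^ j) i)
  refine ⟨(σ ^ j) i, mem_cycleReps.2 fun l => ?_, pow_apply_back σ i j⟩
  rw [← Equiv.Perm.mul_apply, ← pow_add]
  exact Function.argmin_le (fun j : ℕ => (σ ^ j) i) (l + j)

/-- Each of two representatives on one cycle is reached from the other by a power of σ, so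
minimality gives both inequalities. -/
theorem cycleReps_unique {σ : Equiv.Perm (Fin n)} {r r' : Fin n} (hr : r ∈ cycleReps σ)
    (hr' : r' ∈ cycleReps σ) {j j' : ℕ} (h : (σ ^ j) r = (σ ^ j') r') : r = r' := by
  apply le_antisymm
  · obtain ⟨l, hl⟩ := pow_apply_back σ r' j'
    rw [← h, ← Equiv.Perm.mul_apply, ← pow_add] at hl
    exact hl ▸ mem_cycleReps.1 hr _
  · obtain ⟨l, hl⟩ := pow_apply_back σ r j
    rw [h, ← Equiv.Perm.mul_apply, ← pow_add] at hl
    exact hl ▸ mem_cycleReps.1 hr' _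

theorem pow_apply_inj (x : SpinWr Γ n) (i : Fin n) {a b : ℕ} (ha : a < cycleLen x i)
    (hb : b < cycleLen x i) (h : (permW x ^ a) i = (permW x ^ b) i) : a = b := by
  rw [Equiv.Perm.coe_pow, Equiv.Perm.coe_pow] at h
  exact Function.iterate_injOn_Iio_minimalPeriod ha hb h

theorem pow_mod_cycleLen (x : SpinWr Γ n) (i : Fin n) (a : ℕ) :
    (permW x ^ (a % cycleLen x i)) i = (permW x ^ a) i := by
  rw [Equiv.Perm.coe_pow, Equiv.Perm.coe_pow]
  exact Function.iterate_mod_minimalPeriod_eq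

/-- The multiset of the cycle types. -/
def cycleTypes (x : SpinWr Γ n) : Multiset (ℕ × ConjClasses Γ) :=
  (cycleReps (permW x)).val.map (ptype x)

theorem count_cycleTypes [DecidableEq (ℕ × ConjClasses Γ)] (x : SpinWr Γ n) (p : ℕ × ConjClasses Γ) :
    (cycleTypes x).count p = ((cycleReps (permW x)).filter fun i => ptype x i = p).card := by
  rw [cycleTypes, Multiset.count_map, Finset.card_def, Finset.filter_val]
  simp only [eq_comm]

/-- A cycle of type p has p.1 points, all of type p, and each point is uniquely a representative
moved by an exponent below p.1. -/
theorem mul_count_cycleTypes (x : SpinWr Γ n) (p : ℕ × ConjClasses Γ) :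
    p.1 * (cycleTypes x).count p = (Finset.univ.filter fun i => ptype x i = p).card := by
  rw [count_cycleTypes, mul_comm, ← Finset.card_range p.1, ← Finset.card_product]
  refine Finset.card_bij (fun q _ => (permW x ^ q.2) q.1) ?_ ?_ ?_
  · rintro ⟨r, j⟩ h
    simp only [Finset.mem_product, Finset.mem_filter] at h
    simp [ptype_perm_pow, h.1.2]
  · rintro ⟨r, j⟩ h ⟨r', j'⟩ h' e
    simp only [Finset.mem_product, Finset.mem_filter, Finset.mem_range] at h h' e
    obtain rfl := cycleReps_unique h.1.1 h'.1.1 e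
    have hl : cycleLen x r = p.1 := by rw [← h.1.2]; rfl
    rw [pow_apply_inj x r (hl ▸ h.2) (hl ▸ h'.2) e]
  · intro i hi
    simp only [Finset.mem_filter, Finset.mem_univ, true_and] at hi
    obtain ⟨r, hr, j, rfl⟩ := exists_cycleRep (permW x) i
    rw [ptype_perm_pow] at hi
    have hl : cycleLen x r = p.1 := by rw [← hi]; rfl
    refine ⟨(r, j % cycleLen x r), ?_, pow_mod_cycleLen _ _ _⟩
    simp only [Finset.mem_product, Finset.mem_filter, Finset.mem_range]
    exact ⟨⟨hr, hi⟩, hl ▸ Nat.mod_lt _ (cycleLen_pos _ _)⟩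

theorem mem_cycleTypes {x : SpinWr Γ n} {p : ℕ × ConjClasses Γ} :
    p ∈ cycleTypes x ↔ ∃ i, ptype x i = p := by
  constructor
  · intro h
    obtain ⟨i, _, hi⟩ := Multiset.mem_map.1 h
    exact ⟨i, hi⟩
  · rintro ⟨i, rfl⟩
    obtain ⟨r, hr, j, rfl⟩ := exists_cycleRep (permW x) i
    exact Multiset.mem_map.2 ⟨r, hr, (ptype_perm_pow _ _ _).symm⟩

/-- Points are counted in place of cycles. Points are easy to follow under conjugation, inversion
and juxtaposition, whereas minimal representatives of cycles are not preserved by conjugation. -/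
theorem cycleTypes_ext {x : SpinWr Γ n} {M : Multiset (ℕ × ConjClasses Γ)}
    (hM : ∀ p ∈ M, 0 < p.1)
    (h : ∀ p, 0 < p.1 → (Finset.univ.filter fun i => ptype x i = p).card = p.1 * M.count p) :
    cycleTypes x = M := by
  ext p
  by_cases hp : 0 < p.1
  · have := h p hp
    rw [← mul_count_cycleTypes] at this
    exact Nat.eq_of_mul_eq_mul_left hp this
  · rw [Multiset.count_eq_zero_of_notMem fun h => hp (hM p h), Multiset.count_eq_zero_of_notMem]
    intro h
    obtain ⟨i, rfl⟩ := mem_cycleTypes.1 h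
    exact hp (cycleLen_pos x i)

theorem pos_of_mem_cycleTypes {x : SpinWr Γ n} {p : ℕ × ConjClasses Γ} (h : p ∈ cycleTypes x) :
    0 < p.1 := by
  obtain ⟨i, rfl⟩ := mem_cycleTypes.1 h
  exact cycleLen_pos x i

theorem cycleTypes_conj (u x : SpinWr Γ n) : cycleTypes (u * x * u⁻¹) = cycleTypes x := by
  refine cycleTypes_ext (fun p => pos_of_mem_cycleTypes) fun p _ => ?_
  rw [mul_count_cycleTypes]
  refine (Finset.card_bij (fun i _ => permW u i) ?_ ?_ ?_).symm
  · intro i hi; simpa [ptype_conj] using hi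
  · intro i _ j _ h; exact (permW u).injective h
  · intro i hi
    refine ⟨(permW u)⁻¹ i, ?_, by simp⟩
    obtain ⟨j, rfl⟩ := (permW u).surjective i
    simpa [ptype_conj] using hi

theorem cycleTypes_eq_of_isConj {x y : SpinWr Γ n} (h : IsConj x y) :
    cycleTypes x = cycleTypes y := by
  obtain ⟨u, rfl⟩ := isConj_iff.1 h
  exact (cycleTypes_conj u x).symm

@[simp] theorem cycleTypes_zW_mul (x : SpinWr Γ n) : cycleTypes (zW Γ n * x) = cycleTypes x := by
  refine cycleTypes_ext (fun p => pos_of_mem_cycleTypes) fun p _ => ?_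
  simp only [mul_count_cycleTypes, ptype_zW_mul]

theorem cycleTypes_embL_mul_embR (x : SpinWr Γ n) (y : SpinWr Γ m) :
    cycleTypes (embL n m x * embR n m y) = cycleTypes x + cycleTypes y := by
  refine cycleTypes_ext (fun p hp => ?_) fun p _ => ?_
  · rcases Multiset.mem_add.1 hp with h | h <;> exact pos_of_mem_cycleTypes h
  · rw [Multiset.count_add, mul_add, mul_count_cycleTypes, mul_count_cycleTypes]
    simp only [Finset.card_filter, Fin.sum_univ_add, ptype_castAdd, ptype_natAdd]

theorem cycleTypes_inv (x : SpinWr Γ n) :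
    cycleTypes x⁻¹ = (cycleTypes x).map fun p => (p.1, invClass p.2) := by
  have hinv : ∀ p q : ℕ × ConjClasses Γ, (p.1, invClass p.2) = q ↔ p = (q.1, invClass q.2) := by
    rintro ⟨a, b⟩ ⟨c, d⟩
    simp only [Prod.mk.injEq]
    constructor <;> rintro ⟨rfl, rfl⟩ <;> simp
  refine cycleTypes_ext (fun p hp => ?_) fun p _ => ?_
  · obtain ⟨q, hq, rfl⟩ := Multiset.mem_map.1 hp
    exact pos_of_mem_cycleTypes (p := q) hq
  · have h1 : p = (fun q : ℕ × ConjClasses Γ => (q.1, invClass q.2)) (p.1, invClass p.2) := by simp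
    have h2 : Function.Injective fun q : ℕ × ConjClasses Γ => (q.1, invClass q.2) := fun q q' h => by
      simpa using (hinv q _).1 h
    conv_rhs => rw [h1, Multiset.count_map_eq_count' _ _ h2]
    have := mul_count_cycleTypes x (p.1, invClass p.2)
    simp only [ptype_inv, hinv]
    exact this.symm

theorem sum_cycleTypes (x : SpinWr Γ n) : ((cycleTypes x).map Prod.fst).sum = n := by
  have h1 : ((cycleTypes x).map Prod.fst).sum =
      ∑ p ∈ (cycleTypes x).toFinset, (cycleTypes x).count p * p.1 := by
    rw [Finset.sum_multiset_map_count]; rfl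
  rw [h1]
  calc _ = ∑ p ∈ (cycleTypes x).toFinset, (Finset.univ.filter fun i => ptype x i = p).card :=
        Finset.sum_congr rfl fun p _ => by rw [mul_comm, mul_count_cycleTypes]
    _ = (Finset.univ : Finset (Fin n)).card :=
        (Finset.card_eq_sum_card_fiberwise fun i _ => by
          rw [Finset.mem_coe, Multiset.mem_toFinset]
          exact mem_cycleTypes.2 ⟨i, rfl⟩).symm
    _ = n := by simp

/-- All points have the same type exactly when there is one cycle. -/
theorem cycleTypes_eq_singleton {x : SpinWr Γ k} {p : ℕ × ConjClasses Γ} (hk : p.1 = k)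
    (hk0 : 0 < k) (h : ∀ i, ptype x i = p) : cycleTypes x = {p} := by
  refine cycleTypes_ext (fun q hq => ?_) fun q _ => ?_
  · rw [Multiset.mem_singleton.1 hq, hk]; exact hk0
  · simp only [h, Multiset.count_singleton]
    by_cases hq : q = p
    · subst hq; simp [hk]
    · rw [if_neg hq, Finset.filter_false_of_mem fun i _ => Ne.symm hq]; simp

theorem ptype_eq_of_cycleTypes_eq_singleton {x : SpinWr Γ k} {p : ℕ × ConjClasses Γ}
    (h : cycleTypes x = {p}) (i : Fin k) : ptype x i = p :=
  Multiset.mem_singleton.1 (h ▸ mem_cycleTypes.2 ⟨i, rfl⟩)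

end CycleTypes

/-! ### Conjugacy in spin wreath products -/

/-- Only two odd elements fail to commute. For x odd, each generator t_j in a word for y contributes
one factor z when it passes x, and the number of these factors modulo 2 is the parity of y. -/
theorem SpinSym.inRight_mul_inLeft {n m : ℕ} (x : SpinSym n) (y : SpinSym m) :
    SpinSym.inRight n m y * SpinSym.inLeft n m x =
      (if SpinSym.sgn n x = 1 ∨ SpinSym.sgn m y = 1 then 1 else SpinSym.z _) *
        (SpinSym.inLeft n m x * SpinSym.inRight n m y) := by
  by_cases hx : SpinSym.sgn n x = 1
  · rw [if_pos (Or.inl hx), one_mul, SpinSym.inRight_comm_inLeft x hx]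
  have hx' : SpinSym.sgn n x = -1 := (Int.units_eq_one_or _).resolve_left hx
  induction y using SpinSym.induction_gens with
  | one => simp
  | hz y h =>
    rw [map_mul, map_mul, SpinSym.sgn_z, mul_one, SpinSym.inRight_z, mul_assoc, SpinSym.z_comm,
      ← mul_assoc, h]
    simp only [mul_assoc]
  | ht y j hj h =>
    rw [map_mul, map_mul, SpinSym.sgn_t hj, SpinSym.inRight_t hj, mul_assoc,
      SpinSym.t_mul_inLeft hj, if_neg hx, ← mul_assoc, ← SpinSym.z_comm, mul_assoc,
      ← mul_assoc (SpinSym.inRight n m y), h]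
    rcases Int.units_eq_one_or (SpinSym.sgn m y) with hs | hs
    · simp [hs, hx', mul_assoc]
    · simp only [hs, hx', mul_assoc]
      rw [if_neg (by decide), if_pos (by decide), ← mul_assoc, SpinSym.z_mul_z]

section Conjugacy

variable {Γ : Type*} [Group Γ] {n m k : ℕ}

theorem embR_mul_embL_left (x : SpinWr Γ n) (y : SpinWr Γ m) :
    (embR n m y * embL n m x).left = (embL n m x * embR n m y).left := by
  ext i
  simp only [embL, embR, SemidirectProduct.mul_left, SemidirectProduct.map_left,
    SemidirectProduct.map_right, Pi.mul_apply, wreathAct_apply, ← map_inv]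
  refine Fin.addCases (fun i => ?_) (fun i => ?_) i
  · rw [SpinSym.theta_inRight_castAdd, SpinSym.theta_inLeft_castAdd]; simp [extLeft, extRight]
  · rw [SpinSym.theta_inRight_natAdd, SpinSym.theta_inLeft_natAdd]; simp [extLeft, extRight]

theorem embR_mul_embL (x : SpinWr Γ n) (y : SpinWr Γ m) :
    embR n m y * embL n m x =
      (if sgnW x = 1 ∨ sgnW y = 1 then 1 else zW Γ _) * (embL n m x * embR n m y) := by
  have h := SpinSym.inRight_mul_inLeft x.right y.right
  rw [← sgnW_apply, ← sgnW_apply] at h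
  refine SemidirectProduct.ext ?_ ?_
  · rw [embR_mul_embL_left]
    split_ifs
    · rw [one_mul]
    · rw [zW_mul_left]
  · refine Eq.trans h ?_
    split_ifs
    · rw [one_mul, one_mul]; rfl
    · rfl

theorem exists_embL_mul_embR (w : SpinWr Γ (n + m))
    (h : ∀ i : Fin n, (permW w (Fin.castAdd m i)).1 < n) :
    ∃ a y, w = embL n m a * embR n m y := by
  obtain ⟨a, b, e⟩ := SpinSym.exists_inLeft_mul_inRight w.right fun i => ⟨⟨_, h i⟩, rfl⟩
  refine ⟨⟨fun i => w.left (Fin.castAdd m i), a⟩, ⟨fun i => w.left (Fin.natAdd n i), b⟩,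
    SemidirectProduct.ext ?_ e⟩
  ext i
  refine Fin.addCases (fun i => ?_) (fun i => ?_) i
  · rw [(restrictsTo_castAdd _ _ i).1]
  · rw [(restrictsTo_natAdd _ _ i).1]

/-- The spin product is the full preimage of S_n × S_m, so membership depends only on the
permutation. -/
theorem mem_hatProd_iff (w : SpinWr Γ (n + m)) :
    w ∈ hatProd Γ n m ↔ ∀ i : Fin n, (permW w (Fin.castAdd m i)).1 < n := by
  constructor
  -- The stabilizer of the first block, stated as an equivalence so that closure under inverses is
  -- immediate.
  · let K : Subgroup (SpinWr Γ (n + m)) :=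
      { carrier := {w | ∀ i, (permW w i).1 < n ↔ i.1 < n}
        one_mem' := fun i => by simp
        mul_mem' := fun {a b} ha hb i => by
          rw [map_mul, Equiv.Perm.mul_apply, ha, hb]
        inv_mem' := fun {a} ha i => by
          rw [← ha, map_inv, ← Equiv.Perm.mul_apply, mul_inv_cancel, Equiv.Perm.one_apply] }
    have hK : hatProd Γ n m ≤ K := by
      refine sup_le ?_ ?_
      · rintro _ ⟨x, rfl⟩ i
        refine Fin.addCases (fun i => ?_) (fun i => ?_) i
        · rw [permW_embL_castAdd]; simp
        · rw [permW_embL_natAdd]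
      · rintro _ ⟨x, rfl⟩ i
        refine Fin.addCases (fun i => ?_) (fun i => ?_) i
        · rw [permW_embR_castAdd]
        · rw [permW_embR_natAdd]; simp
    exact fun h i => (hK h _).2 (by simp)
  · intro h
    obtain ⟨a, y, rfl⟩ := exists_embL_mul_embR w h
    exact embL_mul_embR_mem a y

/-- The embedding `j ↦ σ^j i` for the cycle of `i`. -/
def cycleEmb (x : SpinWr Γ n) (i : Fin n) (h : cycleLen x i = k) : Fin k ↪ Fin n where
  toFun j := (permW x ^ j.1) i
  inj' a b hab := Fin.ext (pow_apply_inj x i (h ▸ a.2) (h ▸ b.2) hab)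

/-- The symmetric group acts transitively on injective k-tuples, and every permutation lifts to
Γ̃_n. -/
theorem exists_perm_extending (f g : Fin k ↪ Fin n) :
    ∃ u : SpinWr Γ n, ∀ j, permW u (f j) = g j := by
  have := Equiv.Perm.isMultiplyPretransitive (Fin n) k
  obtain ⟨σ, h⟩ := MulAction.exists_smul_eq (Equiv.Perm (Fin n)) f g
  obtain ⟨u, rfl⟩ := permW_surjective (Γ := Γ) σ
  exact ⟨u, fun j => DFunLike.congr_fun h j⟩

/-- If `u` moves the cycle of `i` to the first `k` letters, these are the images of the points
of the cycle. -/
theorem exists_pow_apply_eq_castAdd {x : SpinWr Γ (k + m)} {i : Fin (k + m)}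
    (hk : cycleLen x i = k) {u : SpinWr Γ (k + m)}
    (hu : ∀ j : ℕ, (permW u ((permW x ^ j) i)).1 < k) (l : Fin k) :
    ∃ j : ℕ, permW u ((permW x ^ j) i) = Fin.castAdd m l := by
  let F : Fin k → Fin k := fun j => ⟨permW u (cycleEmb x i hk j), hu _⟩
  have hF : Function.Injective F := fun a b h =>
    (cycleEmb x i hk).injective ((permW u).injective (Fin.ext (Fin.mk.inj_iff.1 h)))
  obtain ⟨j, hj⟩ := (Finite.injective_iff_surjective.1 hF) l
  exact ⟨j.1, Fin.ext (congrArg (fun l : Fin k => l.1) hj)⟩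

/-- Under u the points of the cycle fill exactly the first k letters. The conjugate therefore
preserves that block, and its first factor is a single cycle that inherits the type. -/
theorem conj_eq_embL_mul_embR {x : SpinWr Γ (k + m)} {i : Fin (k + m)}
    (hk : cycleLen x i = k) {u : SpinWr Γ (k + m)}
    (hu : ∀ j : ℕ, (permW u ((permW x ^ j) i)).1 < k) :
    ∃ a y, u * x * u⁻¹ = embL k m a * embR k m y ∧ cycleTypes a = {ptype x i} := by
  obtain ⟨a, y, e⟩ := exists_embL_mul_embR (u * x * u⁻¹) fun l => by
    obtain ⟨j, hj⟩ := exists_pow_apply_eq_castAdd hk hu l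
    rw [← hj, map_mul, map_inv, Equiv.Perm.mul_apply, Equiv.Perm.inv_eq_iff_eq.2 rfl, map_mul,
      Equiv.Perm.mul_apply, ← Equiv.Perm.mul_apply (permW x), ← pow_succ']
    exact hu _
  refine ⟨a, y, e, cycleTypes_eq_singleton hk (hk ▸ cycleLen_pos x i) fun l => ?_⟩
  obtain ⟨j, hj⟩ := exists_pow_apply_eq_castAdd hk hu l
  rw [← ptype_castAdd a y, ← e, ← hj, ptype_conj, ptype_perm_pow]

theorem exists_moving_cycle {x : SpinWr Γ (k + m)} {i : Fin (k + m)} (hk : cycleLen x i = k) :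
    ∃ u : SpinWr Γ (k + m), ∀ j : ℕ, (permW u ((permW x ^ j) i)).1 < k := by
  obtain ⟨u, hu⟩ := exists_perm_extending (Γ := Γ) (cycleEmb x i hk) (Fin.castAddEmb m)
  refine ⟨u, fun j => ?_⟩
  have h0 : 0 < k := hk ▸ cycleLen_pos x i
  rw [← pow_mod_cycleLen x i j, hk]
  have := hu ⟨j % k, Nat.mod_lt _ h0⟩
  rw [show (permW x ^ (j % k)) i = cycleEmb x i hk ⟨j % k, Nat.mod_lt _ h0⟩ from rfl, this]
  exact Nat.mod_lt _ h0

/-- Every element is conjugate to one in which a given cycle occupies the first letters. -/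
theorem exists_conj_eq_embL_mul_embR (x : SpinWr Γ (k + m)) (i : Fin (k + m))
    (hk : cycleLen x i = k) :
    ∃ u a y, u * x * u⁻¹ = embL k m a * embR k m y ∧ cycleTypes a = {ptype x i} := by
  obtain ⟨u, hu⟩ := exists_moving_cycle hk
  exact ⟨u, conj_eq_embL_mul_embR hk hu⟩

/-- Conjugacy up to the central element. -/
def SimZ (x y : SpinWr Γ n) : Prop :=
  ∃ u, (u * x * u⁻¹).left = y.left ∧ permW (u * x * u⁻¹) = permW y

theorem SimZ.isConj {x y : SpinWr Γ n} (h : SimZ x y) : IsConj x y ∨ IsConj x (zW Γ n * y) := by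
  obtain ⟨u, h1, h2⟩ := h
  rcases eq_or_eq_zW_mul h1 h2 with h | h
  · exact Or.inl (isConj_iff.2 ⟨u, h⟩)
  · exact Or.inr (isConj_iff.2 ⟨u, h⟩)

theorem simZ_iff {x y : SpinWr Γ n} : SimZ x y ↔ IsConj x y ∨ IsConj x (zW Γ n * y) := by
  refine ⟨SimZ.isConj, ?_⟩
  rintro (h | h)
  · obtain ⟨u, h⟩ := isConj_iff.1 h
    exact ⟨u, by rw [h], by rw [h]⟩
  · obtain ⟨u, h⟩ := isConj_iff.1 h
    exact ⟨u, by rw [h, zW_mul_left], by rw [h]; simp⟩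

theorem zW_conj (u x : SpinWr Γ n) : u * (zW Γ n * x) * u⁻¹ = zW Γ n * (u * x * u⁻¹) := by
  rw [← mul_assoc, ← zW_comm]; simp only [mul_assoc]

theorem isConj_zW_mul {x y : SpinWr Γ n} (h : IsConj x y) :
    IsConj (zW Γ n * x) (zW Γ n * y) := by
  obtain ⟨u, rfl⟩ := isConj_iff.1 h
  exact isConj_iff.2 ⟨u, zW_conj u x⟩

theorem zW_mul_zW_mul (x : SpinWr Γ n) : zW Γ n * (zW Γ n * x) = x := by
  rw [← mul_assoc, zW_mul_zW, one_mul]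

theorem SimZ.symm {x y : SpinWr Γ n} (h : SimZ x y) : SimZ y x := by
  rw [simZ_iff] at h ⊢
  rcases h with h | h
  · exact Or.inl h.symm
  · exact Or.inr (by simpa [zW_mul_zW_mul] using isConj_zW_mul h.symm)

theorem SimZ.trans {x y w : SpinWr Γ n} (h : SimZ x y) (h' : SimZ y w) : SimZ x w := by
  rw [simZ_iff] at h h' ⊢
  rcases h with h | h <;> rcases h' with h' | h'
  · exact Or.inl (h.trans h')
  · exact Or.inr (h.trans h')
  · exact Or.inr (h.trans (isConj_zW_mul h'))
  · exact Or.inl (by simpa [zW_mul_zW_mul] using h.trans (isConj_zW_mul h'))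

theorem simZ_of_conj_eq {x y : SpinWr Γ n} {u : SpinWr Γ n} (h : u * x * u⁻¹ = y) : SimZ x y :=
  simZ_iff.2 (Or.inl (isConj_iff.2 ⟨u, h⟩))

/-- Conjugation inside one factor passes the other factor at the cost of at most one z, which `SimZ`
absorbs. The two factors are replaced one after the other. -/
theorem SimZ.embL_mul_embR {a b : SpinWr Γ n} {x y : SpinWr Γ m} (h : SimZ a b) (h' : SimZ x y) :
    SimZ (embL n m a * embR n m x) (embL n m b * embR n m y) := by
  have hL : SimZ (embL n m a * embR n m x) (embL n m b * embR n m x) := by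
    obtain ⟨u, hu⟩ := h
    have e : embL n m u * (embL n m a * embR n m x) * (embL n m u)⁻¹ =
        embL n m (u * a * u⁻¹) * embR n m x ∨
      embL n m u * (embL n m a * embR n m x) * (embL n m u)⁻¹ =
        zW Γ _ * (embL n m (u * a * u⁻¹) * embR n m x) := by
      have := embR_mul_embL u⁻¹ x
      rw [← map_inv, mul_assoc, mul_assoc, this]
      split_ifs
      · left; simp only [map_mul, map_inv, one_mul, mul_assoc]
      · right
        rw [← mul_assoc (embL n m a), ← zW_comm, mul_assoc (zW Γ _), ← mul_assoc, ← zW_comm]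
        simp only [map_mul, map_inv, mul_assoc]
    have e2 : embL n m (u * a * u⁻¹) * embR n m x = embL n m b * embR n m x ∨
        embL n m (u * a * u⁻¹) * embR n m x = zW Γ _ * (embL n m b * embR n m x) := by
      rcases eq_or_eq_zW_mul hu.1 hu.2 with h | h
      · left; rw [h]
      · right; rw [h, map_mul, embL_zW, mul_assoc]
    refine SimZ.trans (y := embL n m (u * a * u⁻¹) * embR n m x) ?_ ?_
    · rcases e with e | e
      · exact simZ_of_conj_eq e
      · exact simZ_iff.2 (Or.inr (isConj_iff.2 ⟨_, e⟩))
    · rcases e2 with e | e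
      · exact simZ_of_conj_eq (u := 1) (by simpa using e)
      · exact simZ_iff.2 (Or.inr (isConj_iff.2 ⟨1, by simpa using e⟩))
  refine hL.trans ?_
  obtain ⟨u, hu⟩ := h'
  have e : embR n m u * (embL n m b * embR n m x) * (embR n m u)⁻¹ =
        embL n m b * embR n m (u * x * u⁻¹) ∨
      embR n m u * (embL n m b * embR n m x) * (embR n m u)⁻¹ =
        zW Γ _ * (embL n m b * embR n m (u * x * u⁻¹)) := by
    have := embR_mul_embL b u
    rw [← mul_assoc, this]
    split_ifs
    · left; simp only [map_mul, map_inv, one_mul, mul_assoc]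
    · right; simp only [map_mul, map_inv, mul_assoc]
  have e2 : embL n m b * embR n m (u * x * u⁻¹) = embL n m b * embR n m y ∨
      embL n m b * embR n m (u * x * u⁻¹) = zW Γ _ * (embL n m b * embR n m y) := by
    rcases eq_or_eq_zW_mul hu.1 hu.2 with h | h
    · left; rw [h]
    · right; rw [h, map_mul, embR_zW, ← mul_assoc, ← zW_comm, mul_assoc]
  refine SimZ.trans (y := embL n m b * embR n m (u * x * u⁻¹)) ?_ ?_
  · rcases e with e | e
    · exact simZ_of_conj_eq e
    · exact simZ_iff.2 (Or.inr (isConj_iff.2 ⟨_, e⟩))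
  · rcases e2 with e | e
    · exact simZ_of_conj_eq (u := 1) (by simpa using e)
    · exact simZ_iff.2 (Or.inr (isConj_iff.2 ⟨1, by simpa using e⟩))

theorem fst_eq_of_cycleTypes_eq_singleton {x : SpinWr Γ k} {p : ℕ × ConjClasses Γ}
    (h : cycleTypes x = {p}) : p.1 = k := by
  have := sum_cycleTypes x
  rwa [h, Multiset.map_singleton, Multiset.sum_singleton] at this

theorem cycleLen_eq_of_cycleTypes_eq_singleton {x : SpinWr Γ k} {p : ℕ × ConjClasses Γ}
    (h : cycleTypes x = {p}) (i : Fin k) : cycleLen x i = k := by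
  have := congrArg Prod.fst (ptype_eq_of_cycleTypes_eq_singleton h i)
  rwa [fst_eq_of_cycleTypes_eq_singleton h] at this

theorem exists_pow_apply_eq {x : SpinWr Γ k} {p : ℕ × ConjClasses Γ}
    (h : cycleTypes x = {p}) (i j : Fin k) : ∃ l < k, (permW x ^ l) i = j := by
  obtain ⟨l, hl⟩ := (Finite.injective_iff_surjective.1
    (cycleEmb x i (cycleLen_eq_of_cycleTypes_eq_singleton h i)).injective) j
  exact ⟨l.1, l.2, hl⟩

/-- Two elements with the same underlying long cycle and conjugate cycle products are conjugate
up to the central element. -/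
theorem simZ_of_perm_eq {a b : SpinWr Γ k} {p : ℕ × ConjClasses Γ} (ha : cycleTypes a = {p})
    (hb : cycleTypes b = {p}) (hab : permW a = permW b) : SimZ a b := by
  have hp := fst_eq_of_cycleTypes_eq_singleton ha
  have h0 : 0 < k := hp ▸ pos_of_mem_cycleTypes (x := a) (by rw [ha]; simp)
  let i0 : Fin k := ⟨0, h0⟩
  have hcl : ConjClasses.mk ((a ^ k).left i0) = ConjClasses.mk ((b ^ k).left i0) := by
    have h1 := ptype_eq_of_cycleTypes_eq_singleton ha i0
    have h2 := ptype_eq_of_cycleTypes_eq_singleton hb i0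
    have := congrArg Prod.snd (h1.trans h2.symm)
    simpa only [ptype, cycleLen_eq_of_cycleTypes_eq_singleton ha,
      cycleLen_eq_of_cycleTypes_eq_singleton hb] using this
  obtain ⟨H, hH⟩ := isConj_iff.1 (ConjClasses.mk_eq_mk_iff_isConj.1 hcl)
  set σ := permW b with hσ
  have hper : ∀ i, (σ ^ k) i = i := fun i => by
    have := permW_pow_cycleLen b i
    rwa [cycleLen_eq_of_cycleTypes_eq_singleton hb, map_pow] at this
  -- F l is the label, at the point σ^l i0, of the conjugator sought. The equation v a = b v
  -- determines these labels from F 0 = H by the recursion `hF`.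
  let F : ℕ → Γ := fun l => (b ^ l).left ((σ ^ l) i0) * H * ((a ^ l).left ((σ ^ l) i0))⁻¹
  have hF : ∀ l, F (l + 1) * a.left ((σ ^ (l + 1)) i0) = b.left ((σ ^ (l + 1)) i0) * F l := by
    intro l
    have e1 : (b ^ (l + 1)).left ((σ ^ (l + 1)) i0) =
        b.left ((σ ^ (l + 1)) i0) * (b ^ l).left ((σ ^ l) i0) := by
      rw [pow_succ' b, pow_succ' σ, Equiv.Perm.mul_apply, hσ, mul_left_perm]
    have e2 : (a ^ (l + 1)).left ((σ ^ (l + 1)) i0) =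
        a.left ((σ ^ (l + 1)) i0) * (a ^ l).left ((σ ^ l) i0) := by
      rw [pow_succ' a, pow_succ' σ, Equiv.Perm.mul_apply, ← hab, mul_left_perm]
    simp only [F, e1, e2, mul_inv_rev, mul_assoc, inv_mul_cancel, mul_one]
  -- The labels close up around the cycle precisely because H conjugates the cycle product of a at
  -- i0 into that of b.
  have hF0 : F k = F 0 := by
    simp only [F, hper]
    simp [← hH]
  choose l hl hl' using fun j => exists_pow_apply_eq hb i0 j
  let v : SpinWr Γ k := ⟨fun i => F (l i), 1⟩
  have hv : permW v = 1 := by rw [permW_apply]; exact map_one _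
  have hFl : ∀ r, r ≤ k → F (l ((σ ^ r) i0)) = F r := by
    intro r hr
    rcases hr.lt_or_eq with hr | rfl
    · have := pow_apply_inj b i0 (a := l ((σ ^ r) i0)) (b := r)
        (by rw [cycleLen_eq_of_cycleTypes_eq_singleton hb]; exact hl _)
        (by rw [cycleLen_eq_of_cycleTypes_eq_singleton hb]; exact hr) (hl' _)
      rw [this]
    · have := pow_apply_inj b i0 (a := l ((σ ^ r) i0)) (b := 0)
        (by rw [cycleLen_eq_of_cycleTypes_eq_singleton hb]; exact hl _)
        (by rw [cycleLen_eq_of_cycleTypes_eq_singleton hb]; exact h0)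
        (by rw [hl', hper, pow_zero, Equiv.Perm.one_apply])
      rw [this, hF0]
  have key : (v * a).left = (b * v).left := by
    ext i
    obtain ⟨r, hr, rfl⟩ : ∃ r < k, (σ ^ (r + 1)) i0 = i := by
      obtain ⟨r, hr, e⟩ := exists_pow_apply_eq hb i0 ((permW b)⁻¹ i)
      refine ⟨r, hr, ?_⟩
      rw [pow_succ', Equiv.Perm.mul_apply, hσ, e, ← Equiv.Perm.mul_apply, mul_inv_cancel,
        Equiv.Perm.one_apply]
    rw [mul_left_apply, hv, inv_one, Equiv.Perm.one_apply, pow_succ', Equiv.Perm.mul_apply,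
      hσ, mul_left_perm, ← hσ]
    change F (l (σ ((σ ^ r) i0))) * _ = _ * F (l ((σ ^ r) i0))
    rw [← Equiv.Perm.mul_apply, ← pow_succ', hFl _ hr, hFl _ hr.le, hF]
  refine ⟨v, ?_, by rw [map_mul, map_mul, map_inv, hv, hab]; simp [hσ]⟩
  ext i
  have h1 := mul_left_apply (v * a * v⁻¹) v i
  rw [inv_mul_cancel_right, key, mul_left_apply] at h1
  have h2 : permW (v * a * v⁻¹) = permW b := by
    rw [map_mul, map_mul, map_inv, hv, hab]; simp [hσ]
  rw [h2] at h1
  exact (mul_right_cancel h1).symm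

/-- A permutation matching the point reached after j steps from i0 under a with the one reached
under b conjugates the one long cycle into the other. This leaves the case of equal permutations. -/
theorem simZ_of_cycleTypes_eq_singleton {a b : SpinWr Γ k} {p : ℕ × ConjClasses Γ}
    (ha : cycleTypes a = {p}) (hb : cycleTypes b = {p}) : SimZ a b := by
  have hp := fst_eq_of_cycleTypes_eq_singleton ha
  have h0 : 0 < k := hp ▸ pos_of_mem_cycleTypes (x := a) (by rw [ha]; simp)
  let i0 : Fin k := ⟨0, h0⟩
  have hla := cycleLen_eq_of_cycleTypes_eq_singleton ha i0
  have hlb := cycleLen_eq_of_cycleTypes_eq_singleton hb i0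
  obtain ⟨u, hu⟩ := exists_perm_extending (Γ := Γ) (cycleEmb a i0 hla) (cycleEmb b i0 hlb)
  have hu' : ∀ j : ℕ, permW u ((permW a ^ j) i0) = (permW b ^ j) i0 := fun j => by
    have := hu ⟨j % k, Nat.mod_lt _ h0⟩
    change permW u ((permW a ^ (j % k)) i0) = (permW b ^ (j % k)) i0 at this
    have h1 := pow_mod_cycleLen a i0 j
    have h2 := pow_mod_cycleLen b i0 j
    rw [hla] at h1
    rw [hlb] at h2
    rwa [h1, h2] at this
  refine SimZ.trans (simZ_of_conj_eq (u := u) rfl)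
    (simZ_of_perm_eq (p := p) (by rw [cycleTypes_conj, ha]) hb ?_)
  ext1 i
  obtain ⟨j, _, rfl⟩ := exists_pow_apply_eq hb i0 i
  rw [← hu', map_mul, map_mul, map_inv, Equiv.Perm.mul_apply, Equiv.Perm.mul_apply,
    Equiv.Perm.inv_eq_iff_eq.2 rfl, ← Equiv.Perm.mul_apply (permW a), ← pow_succ', hu', hu',
    ← Equiv.Perm.mul_apply, ← pow_succ']

/-- By induction on n. A cycle of x and a cycle of y of the same type are moved to the first
letters; these are compared by the case of one cycle, and the remaining factors have equal cycle
types by cancellation. -/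
theorem simZ_of_cycleTypes_eq {x y : SpinWr Γ n} (h : cycleTypes x = cycleTypes y) :
    SimZ x y := by
  induction n using Nat.strong_induction_on with
  | _ n ih =>
  rcases Nat.eq_zero_or_pos n with rfl | hn
  · exact ⟨1, funext fun i => i.elim0, Subsingleton.elim _ _⟩
  let i : Fin n := ⟨0, hn⟩
  have hp : ptype x i ∈ cycleTypes y := h ▸ mem_cycleTypes.2 ⟨i, rfl⟩
  obtain ⟨j, hj⟩ := mem_cycleTypes.1 hp
  have hle : cycleLen x i ≤ n := by
    simpa using Fintype.card_le_of_embedding (cycleEmb x i rfl)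
  obtain ⟨m, hm⟩ := Nat.exists_eq_add_of_le hle
  have hpos := cycleLen_pos x i
  generalize hk : cycleLen x i = k at hm hpos
  clear_value i
  subst hm
  obtain ⟨u, a, x', hx, ha⟩ := exists_conj_eq_embL_mul_embR x i hk
  obtain ⟨v, b, y', hy, hb⟩ := exists_conj_eq_embL_mul_embR y j
    ((congrArg Prod.fst hj).trans hk)
  have hx'y' : cycleTypes x' = cycleTypes y' := by
    have h1 := cycleTypes_conj u x
    have h2 := cycleTypes_conj v y
    rw [hx, cycleTypes_embL_mul_embR, ha] at h1
    rw [hy, cycleTypes_embL_mul_embR, hb, hj] at h2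
    exact add_left_cancel (h1.trans (h.trans h2.symm))
  exact (simZ_of_conj_eq hx).trans (((simZ_of_cycleTypes_eq_singleton ha (hb.trans
    (by rw [hj]))).embL_mul_embR (ih m (by omega) hx'y')).trans (simZ_of_conj_eq hy).symm)

/-! ### Non-split classes -/

/-- The permutation is a cycle through all k letters with k even, hence odd, and the parity of Γ̃_k
is the sign of the permutation. -/
theorem sgnW_of_even_cycle {a : SpinWr Γ k} {p : ℕ × ConjClasses Γ} (ha : cycleTypes a = {p})
    (hk : Even k) : sgnW a = -1 := by
  have hp := fst_eq_of_cycleTypes_eq_singleton ha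
  have h0 : 0 < k := hp ▸ pos_of_mem_cycleTypes (x := a) (by rw [ha]; simp)
  have h2 : k ≠ 1 := by rintro rfl; simp at hk
  have hmov : ∀ i, permW a i ≠ i := fun i h => by
    have := cycleLen_eq_of_cycleTypes_eq_singleton ha i
    rw [cycleLen, Function.minimalPeriod_eq_one_iff_isFixedPt.2 h] at this
    omega
  have hc : (permW a).IsCycle := ⟨⟨0, h0⟩, hmov _, fun j _ => by
    obtain ⟨l, _, e⟩ := exists_pow_apply_eq ha ⟨0, h0⟩ j
    exact ⟨l, by simpa using e⟩⟩
  have hs : (permW a).support = Finset.univ := by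
    ext i; simp [hmov]
  rw [sgnW_apply, SpinSym.sgn_eq_sign_theta, ← permW_apply, hc.sign, hs, Finset.card_univ,
    Fintype.card_fin, hk.neg_one_pow]

/-- A spin super class function vanishes on elements with an even cycle. -/
theorem superFn_apply_eq_zero_of_even (f : SuperFn Γ n) (x : SpinWr Γ n)
    {p : ℕ × ConjClasses Γ} (hp : p ∈ cycleTypes x) (he : Even p.1) : f.1 x = 0 := by
  rcases Int.units_eq_one_or (sgnW x) with hx | hx
  swap
  · exact f.2.2.2 x hx
  obtain ⟨i, rfl⟩ := mem_cycleTypes.1 hp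
  have hle : cycleLen x i ≤ n := by
    simpa using Fintype.card_le_of_embedding (cycleEmb x i rfl)
  obtain ⟨m, hm⟩ := Nat.exists_eq_add_of_le hle
  have he' : Even (cycleLen x i) := he
  generalize hk : cycleLen x i = k at hm he'
  subst hm
  obtain ⟨u, a, y, e, ha⟩ := exists_conj_eq_embL_mul_embR x i hk
  have hsa := sgnW_of_even_cycle ha he'
  have hsy : sgnW y = -1 := by
    have := congrArg sgnW e
    rw [map_mul, map_mul, map_inv, hx, mul_one, mul_inv_cancel, map_mul, sgnW_embL, sgnW_embR,
      hsa] at this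
    rcases Int.units_eq_one_or (sgnW y) with h | h
    · rw [h] at this; exact absurd this (by decide)
    · exact h
  have h1 : f.1 (embL k m a * embR k m y) = f.1 x := by rw [← e, f.2.1]
  -- The even cycle a is an odd element and x is even, so y is odd as well. The two factors
  -- anticommute, and conjugation by a multiplies the element by z, so f is equal to its own
  -- negative there.
  have h2 : embL k m a * (embL k m a * embR k m y) * (embL k m a)⁻¹ =
      zW Γ _ * (embL k m a * embR k m y) := by
    have h3 := embR_mul_embL a y
    rw [if_neg (by rw [hsa, hsy]; decide)] at h3
    have h4 : embL k m a * embR k m y = zW Γ _ * (embR k m y * embL k m a) := by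
      rw [h3, zW_mul_zW_mul]
    calc _ = embL k m a * (zW Γ _ * (embR k m y * embL k m a)) * (embL k m a)⁻¹ := by rw [← h4]
      _ = _ := by
        rw [zW_conj]; simp only [mul_assoc, mul_inv_cancel, mul_one]
  have h5 := f.2.1 (embL k m a) (embL k m a * embR k m y)
  rw [h2, f.2.2.1, h1] at h5
  linear_combination -h5 / 2

end Conjugacy

/-! ### The sign of elements with odd cycles -/

namespace SpinSym

variable {n m : ℕ}

/-- The sign `1` on elements of odd order, `-1` on their products with `z`, and `0` elsewhere. -/
def spinSign (t : SpinSym n) : ℂ :=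
  if Odd (orderOf t) then 1 else if Odd (orderOf (z n * t)) then -1 else 0

theorem z_pow_of_odd {E : ℕ} (hE : Odd E) : z n ^ E = z n := by
  obtain ⟨r, rfl⟩ := hE
  rw [pow_succ, pow_mul, pow_two, z_mul_z, one_pow, one_mul]

theorem z_mul_z_mul (t : SpinSym n) : z n * (z n * t) = t := by
  rw [← mul_assoc, z_mul_z, one_mul]

/-- If both orders were odd, so would be their product E, and then t^E = 1 while (zt)^E = z^E t^E =
z. -/
theorem not_odd_order_z_mul {t : SpinSym n} (h : Odd (orderOf t)) :
    ¬ Odd (orderOf (z n * t)) := by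
  intro h'
  have hE : Odd (orderOf t * orderOf (z n * t)) := h.mul h'
  have h1 : t ^ (orderOf t * orderOf (z n * t)) = 1 := by rw [pow_mul, pow_orderOf_eq_one, one_pow]
  have h2 : (z n * t) ^ (orderOf t * orderOf (z n * t)) = 1 := by
    rw [mul_comm (orderOf t), pow_mul, pow_orderOf_eq_one, one_pow]
  have hc : Commute (z n) t := z_comm t
  rw [hc.mul_pow, h1, mul_one, z_pow_of_odd hE] at h2
  exact z_ne_one n h2

theorem spinSign_of_odd {t : SpinSym n} (h : Odd (orderOf t)) : spinSign t = 1 := if_pos h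

theorem spinSign_z_mul (t : SpinSym n) : spinSign (z n * t) = -spinSign t := by
  by_cases h1 : Odd (orderOf t)
  · rw [spinSign, if_neg (not_odd_order_z_mul h1), z_mul_z_mul, if_pos h1, spinSign_of_odd h1]
  · by_cases h2 : Odd (orderOf (z n * t))
    · rw [spinSign_of_odd h2, spinSign, if_neg h1, if_pos h2, neg_neg]
    · simp [spinSign, h1, h2, z_mul_z_mul]

theorem orderOf_conj (u t : SpinSym n) : orderOf (u * t * u⁻¹) = orderOf t := by
  rw [← MulAut.conj_apply, MulEquiv.orderOf_eq]

theorem spinSign_conj (u t : SpinSym n) : spinSign (u * t * u⁻¹) = spinSign t := by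
  have e : z n * (u * t * u⁻¹) = u * (z n * t) * u⁻¹ := by
    rw [← mul_assoc, ← mul_assoc, z_comm u]; simp only [mul_assoc]
  rw [spinSign, spinSign, e, orderOf_conj, orderOf_conj]

theorem spinSign_inv (t : SpinSym n) : spinSign t⁻¹ = spinSign t := by
  have e : z n * t⁻¹ = (z n * t)⁻¹ := by rw [mul_inv_rev, inv_z, z_comm]
  rw [spinSign, spinSign, e, orderOf_inv, orderOf_inv]

/-- `t` or `z t` has odd order. -/
def IsOddType (t : SpinSym n) : Prop := Odd (orderOf t) ∨ Odd (orderOf (z n * t))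

theorem IsOddType.sgn_eq {t : SpinSym n} (h : IsOddType t) : sgn n t = 1 := by
  have key : ∀ s : SpinSym n, Odd (orderOf s) → sgn n s = 1 := by
    intro s hs
    rcases Int.units_eq_one_or (sgn n s) with h | h
    · exact h
    · have := congrArg (sgn n) (pow_orderOf_eq_one s)
      rw [map_pow, h, hs.neg_one_pow, map_one] at this
      exact absurd this (by decide)
  rcases h with h | h
  · exact key t h
  · simpa using key _ h

theorem IsOddType.spinSign_sq {t : SpinSym n} (h : IsOddType t) :
    spinSign t * spinSign t = 1 := by
  rcases h with h | h
  · rw [spinSign_of_odd h, mul_one]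
  · have := spinSign_of_odd h
    rw [spinSign_z_mul] at this
    linear_combination (spinSign t - 1) * -this

/-- Elements of odd order are even, so the two factors commute and the order of their product
divides a product of odd numbers. The other cases reduce to this one on multiplying factors by z. -/
theorem spinSign_inLeft_mul_inRight {a : SpinSym n} {b : SpinSym m} (ha : IsOddType a)
    (hb : IsOddType b) :
    spinSign (inLeft n m a * inRight n m b) = spinSign a * spinSign b := by
  have key : ∀ (a : SpinSym n) (b : SpinSym m), Odd (orderOf a) → Odd (orderOf b) →
      spinSign (inLeft n m a * inRight n m b) = spinSign a * spinSign b := by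
    intro a b ha hb
    rw [spinSign_of_odd ha, spinSign_of_odd hb, mul_one]
    apply spinSign_of_odd
    have hc : Commute (inLeft n m a) (inRight n m b) :=
      (inRight_comm_inLeft a (IsOddType.sgn_eq (Or.inl ha)) b).symm
    refine Odd.of_dvd_nat (ha.mul hb) (hc.orderOf_mul_dvd_mul_orderOf.trans
      (mul_dvd_mul (orderOf_map_dvd _ _) (orderOf_map_dvd _ _)))
  rcases ha with ha | ha <;> rcases hb with hb | hb
  · exact key a b ha hb
  · have := key _ _ ha hb
    rw [map_mul, inRight_z, ← mul_assoc, ← z_comm, mul_assoc, spinSign_z_mul,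
      spinSign_z_mul] at this
    linear_combination -this
  · have := key _ _ ha hb
    rw [map_mul, inLeft_z, mul_assoc, spinSign_z_mul, spinSign_z_mul] at this
    linear_combination -this
  · have := key _ _ ha hb
    rw [map_mul, map_mul, inRight_z, inLeft_z, mul_assoc, ← mul_assoc (inLeft n m a), ← z_comm,
      mul_assoc, z_mul_z_mul, spinSign_z_mul, spinSign_z_mul] at this
    linear_combination this

end SpinSym

section Sign

variable {Γ : Type*} [Group Γ] {n m k : ℕ}

/-- Let t be the component of x in S̃_n and E the product of the cycle lengths of all points, an odd
number. Then t^E lies over the identity, so it is 1 or z, and in the second case (zt)^E = 1. -/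
theorem isOddType_of_cycleTypes {x : SpinWr Γ n} (h : ∀ p ∈ cycleTypes x, Odd p.1) :
    SpinSym.IsOddType x.right := by
  let E := ∏ i, cycleLen x i
  have hE : Odd E := by
    refine Finset.prod_induction _ Odd (fun a b ha hb => ha.mul hb) odd_one fun i _ => ?_
    exact h _ (mem_cycleTypes.2 ⟨i, rfl⟩)
  have h1 : permW x ^ E = 1 := by
    ext1 i
    obtain ⟨r, hr⟩ : cycleLen x i ∣ E := Finset.dvd_prod_of_mem _ (Finset.mem_univ i)
    have : Function.IsPeriodicPt (permW x) E i := by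
      rw [hr]; exact (Function.isPeriodicPt_minimalPeriod _ _).mul_const r
    rw [isPeriodicPt_iff, map_pow] at this
    exact this
  rw [permW_apply, ← map_pow] at h1
  rcases SpinSym.eq_one_or_eq_z_of_theta_eq_one h1 with h2 | h2
  · exact Or.inl (hE.of_dvd_nat (orderOf_dvd_of_pow_eq_one h2))
  · refine Or.inr (hE.of_dvd_nat (orderOf_dvd_of_pow_eq_one ?_))
    have hc : Commute (SpinSym.z n) x.right := SpinSym.z_comm _
    rw [hc.mul_pow, h2, SpinSym.z_pow_of_odd hE, SpinSym.z_mul_z]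

/-- The sign of the standard lift of a `k`-cycle. -/
def cycleSign (k : ℕ) : ℂ := SpinSym.spinSign (blockWord k 0 k)

/-- The sign of an element with odd cycles, normalized to be `1` on the standard representatives. -/
def normSign (x : SpinWr Γ n) : ℂ :=
  SpinSym.spinSign x.right * ((cycleTypes x).map fun p => cycleSign p.1).prod

theorem normSign_conj (u x : SpinWr Γ n) : normSign (u * x * u⁻¹) = normSign x := by
  rw [normSign, cycleTypes_conj, normSign]
  congr 1
  exact SpinSym.spinSign_conj u.right x.right

theorem normSign_zW_mul (x : SpinWr Γ n) : normSign (zW Γ n * x) = -normSign x := by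
  rw [normSign, cycleTypes_zW_mul, normSign, ← neg_mul]
  congr 1
  exact SpinSym.spinSign_z_mul x.right

theorem normSign_inv (x : SpinWr Γ n) : normSign x⁻¹ = normSign x := by
  rw [normSign, cycleTypes_inv, normSign, Multiset.map_map]
  congr 1
  exact SpinSym.spinSign_inv x.right

theorem normSign_embL_mul_embR {x : SpinWr Γ n} {y : SpinWr Γ m}
    (hx : ∀ p ∈ cycleTypes x, Odd p.1) (hy : ∀ p ∈ cycleTypes y, Odd p.1) :
    normSign (embL n m x * embR n m y) = normSign x * normSign y := by
  have h : SpinSym.spinSign (embL n m x * embR n m y).right =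
      SpinSym.spinSign x.right * SpinSym.spinSign y.right :=
    SpinSym.spinSign_inLeft_mul_inRight (isOddType_of_cycleTypes hx) (isOddType_of_cycleTypes hy)
  rw [normSign, h, cycleTypes_embL_mul_embR, Multiset.map_add, Multiset.prod_add, normSign,
    normSign]
  ring

theorem sgnW_of_odd {x : SpinWr Γ n} (hx : ∀ p ∈ cycleTypes x, Odd p.1) : sgnW x = 1 :=
  (isOddType_of_cycleTypes hx).sgn_eq

/-! ### Standard representatives -/

/-- The word t_0 ⋯ t_{l-1} lies over the cycle (0 1 ⋯ l). The last factor acts first, so in the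
induction the new transposition is applied before the shorter word. -/
theorem theta_block (N l : ℕ) (hl : l + 1 ≤ N) (i : Fin N) :
    (SpinSym.theta N (((List.range l).map fun j => SpinSym.t N (0 + j)).prod) i).1 =
      if i.1 < l then i.1 + 1 else if i.1 = l then 0 else i.1 := by
  induction l generalizing i with
  | zero => simp
  | succ l ih =>
    rw [List.range_succ, List.map_append, List.prod_append, map_mul, Equiv.Perm.mul_apply,
      ih (by omega), List.map_singleton, List.prod_singleton, SpinSym.theta_t (by omega),
      Equiv.swap_apply_def]
    simp only [Fin.ext_iff]
    by_cases h1 : i.1 = 0 + l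
    · rw [if_pos h1]
      dsimp only
      split_ifs <;> omega
    · rw [if_neg h1]
      by_cases h2 : i.1 = 0 + l + 1
      · rw [if_pos h2]
        dsimp only
        split_ifs <;> omega
      · rw [if_neg h2]
        split_ifs <;> omega

theorem permW_cycleElt (k : OddNat) (c : ConjClasses Γ) (i : Fin k.1) :
    (permW (cycleElt k c) i).1 = if i.1 + 1 < k.1 then i.1 + 1 else 0 := by
  have h0 := k.2.pos
  have := theta_block k.1 (k.1 - 1) (by omega) i
  rw [permW_apply, cycleElt, stdElt]
  simp only [wordFrom, mul_one, blockWord]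
  rw [this]
  split_ifs <;> omega

theorem permW_pow_cycleElt (k : OddNat) (c : ConjClasses Γ) (j : ℕ) (hj : j < k.1) :
    (permW (cycleElt k c) ^ j) ⟨0, k.2.pos⟩ = ⟨j, hj⟩ := by
  induction j with
  | zero => simp
  | succ j ih =>
    rw [pow_succ', Equiv.Perm.mul_apply, ih (by omega)]
    ext
    rw [permW_cycleElt, if_pos hj]

theorem cycleElt_left (k : OddNat) (c : ConjClasses Γ) (i : Fin k.1) :
    (cycleElt k c).left i = if i.1 = 0 then Quotient.out c else 1 := by
  simp only [cycleElt, stdElt, labelFrom, Function.update_apply]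

theorem cycleElt_pow_left (k : OddNat) (c : ConjClasses Γ) (j : ℕ) (hj : j < k.1) :
    (cycleElt k c ^ j).left ⟨j, hj⟩ = 1 := by
  induction j with
  | zero => simp
  | succ j ih =>
    have h := mul_left_perm (cycleElt k c) (cycleElt k c ^ j) ⟨j, by omega⟩
    rw [ih (by omega), show permW (cycleElt k c) ⟨j, by omega⟩ = ⟨j + 1, hj⟩ from
      Fin.ext (by rw [permW_cycleElt, if_pos hj]), cycleElt_left, if_neg (by simp), mul_one] at h
    rw [pow_succ', h]

/-- The permutation is i ↦ i + 1 modulo k, and the only label that need not be 1 is at letter 0,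
where it is picked up when the cycle returns. -/
theorem cycleTypes_cycleElt (k : OddNat) (c : ConjClasses Γ) :
    cycleTypes (cycleElt k c) = {(k.1, c)} := by
  have h0 := k.2.pos
  set x := cycleElt k c with hx
  have hlast : permW x ⟨k.1 - 1, by omega⟩ = ⟨0, h0⟩ :=
    Fin.ext (by rw [permW_cycleElt, if_neg (by simp; omega)])
  have hper : permW (x ^ k.1) ⟨0, h0⟩ = ⟨0, h0⟩ := by
    have : x ^ k.1 = x * x ^ (k.1 - 1) := by rw [← pow_succ', Nat.sub_add_cancel h0]
    rw [this, map_mul, map_pow, Equiv.Perm.mul_apply, permW_pow_cycleElt k c _ (by omega), hlast]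
  have hlen : cycleLen x ⟨0, h0⟩ = k.1 := by
    apply le_antisymm
    · exact Function.IsPeriodicPt.minimalPeriod_le h0 ((isPeriodicPt_iff _ _ _).2 hper)
    · by_contra hlt
      push Not at hlt
      have h1 := permW_pow_cycleLen x ⟨0, h0⟩
      rw [map_pow, permW_pow_cycleElt k c _ hlt] at h1
      have h2 := cycleLen_pos x ⟨0, h0⟩
      have h3 : cycleLen x ⟨0, h0⟩ = 0 := congrArg Fin.val h1
      omega
  have hprod : (x ^ k.1).left ⟨0, h0⟩ = Quotient.out c := by
    have h := mul_left_perm x (x ^ (k.1 - 1)) ⟨k.1 - 1, by omega⟩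
    rw [cycleElt_pow_left, hlast, ← pow_succ', show k.1 - 1 + 1 = k.1 by omega, cycleElt_left,
      if_pos rfl, mul_one] at h
    exact h
  refine cycleTypes_eq_singleton rfl h0 fun i => ?_
  have h1 : i = (permW x ^ i.1) ⟨0, h0⟩ := (permW_pow_cycleElt k c i.1 i.2).symm
  rw [h1, ptype_perm_pow, ptype, hlen, hprod]
  exact Prod.ext rfl (Quotient.out_eq c)

/-- The sign lives in S̃_k alone, so the labels may be taken in the trivial group. -/
theorem cycleSign_sq (k : OddNat) : cycleSign k.1 * cycleSign k.1 = 1 := by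
  have h : SpinSym.IsOddType (cycleElt k (1 : ConjClasses Unit)).right :=
    isOddType_of_cycleTypes fun p hp => by
      rw [cycleTypes_cycleElt, Multiset.mem_singleton] at hp
      rw [hp]; exact k.2
  have := h.spinSign_sq
  simpa only [cycleElt, stdElt, wordFrom, mul_one, cycleSign] using this

/-- The factor `cycleSign` cancels the sign of the standard lift, which need not be 1: for k = 3 the
relation (t_0 t_1)³ = z makes it -1. -/
theorem normSign_cycleElt (k : OddNat) (c : ConjClasses Γ) : normSign (cycleElt k c) = 1 := by
  rw [normSign, cycleTypes_cycleElt, Multiset.map_singleton, Multiset.prod_singleton,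
    ← cycleSign_sq k]
  simp only [cycleElt, stdElt, wordFrom, mul_one, cycleSign]

theorem prod_cycleSign_sq {M : Multiset (ℕ × ConjClasses Γ)} (h : ∀ p ∈ M, Odd p.1) :
    (M.map fun p => cycleSign p.1).prod * (M.map fun p => cycleSign p.1).prod = 1 := by
  rw [← Multiset.prod_map_mul]
  refine Multiset.prod_eq_one fun a ha => ?_
  obtain ⟨p, hp, rfl⟩ := Multiset.mem_map.1 ha
  exact cycleSign_sq ⟨p.1, h p hp⟩

theorem normSign_sq {x : SpinWr Γ n} (hx : ∀ p ∈ cycleTypes x, Odd p.1) :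
    normSign x * normSign x = 1 := by
  have h1 := (isOddType_of_cycleTypes hx).spinSign_sq
  have h2 := prod_cycleSign_sq hx
  rw [normSign]
  linear_combination (((cycleTypes x).map fun p => cycleSign p.1).prod *
    ((cycleTypes x).map fun p => cycleSign p.1).prod) * h1 + h2

theorem labelFrom_of_lt (L : List (OddNat × ConjClasses Γ)) (a j : ℕ) (h : j < a) :
    labelFrom a L j = 1 := by
  induction L generalizing a with
  | nil => rfl
  | cons p L ih => rw [labelFrom, Function.update_of_ne h.ne, ih _ (by omega)]

theorem labelFrom_add (L : List (OddNat × ConjClasses Γ)) (k a j : ℕ) :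
    labelFrom (k + a) L (k + j) = labelFrom a L j := by
  induction L generalizing a with
  | nil => rfl
  | cons p L ih =>
    rw [labelFrom, labelFrom, Function.update_apply, Function.update_apply, add_assoc, ih]
    simp

theorem t_add_eq_inRight (k N j : ℕ) :
    SpinSym.t (k + N) (k + j) = SpinSym.inRight k N (SpinSym.t N j) := by
  by_cases h : j + 1 < N
  · rw [SpinSym.inRight_t h]
  · rw [SpinSym.t, dif_neg (by omega), SpinSym.t, dif_neg h, map_one]

theorem blockWord_add (k N a l : ℕ) :
    blockWord (k + N) (k + a) l = SpinSym.inRight k N (blockWord N a l) := by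
  simp only [blockWord, map_list_prod, List.map_map]
  congr 1
  refine List.map_congr_left fun j _ => ?_
  rw [Function.comp_apply, ← t_add_eq_inRight, add_assoc]

theorem wordFrom_add (L : List (OddNat × ConjClasses Γ)) (k N a : ℕ) :
    wordFrom (k + N) (k + a) L = SpinSym.inRight k N (wordFrom N a L) := by
  induction L generalizing a with
  | nil => simp [wordFrom]
  | cons p L ih => rw [wordFrom, wordFrom, map_mul, blockWord_add, add_assoc, ih]

theorem blockWord_inLeft (k N : ℕ) :
    blockWord (k + N) 0 k = SpinSym.inLeft k N (blockWord k 0 k) := by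
  simp only [blockWord, map_list_prod, List.map_map]
  congr 1
  refine List.map_congr_left fun j hj => ?_
  rw [List.mem_range] at hj
  rw [Function.comp_apply, SpinSym.inLeft_t (by omega)]

/-- Words and labels of the later blocks are the same construction shifted by the first part. The
standard representatives are thus iterated spin products of single cycles, and their invariants
follow by induction on the list. -/
theorem stdElt_cons (p : OddNat × ConjClasses Γ) (N : ℕ) (L : List (OddNat × ConjClasses Γ)) :
    stdElt (p.1.1 + N) (p :: L) =
      embL p.1.1 N (cycleElt p.1 p.2) * embR p.1.1 N (stdElt N L) := by
  have h0 := p.1.2.pos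
  refine SemidirectProduct.ext ?_ ?_
  · ext i
    refine Fin.addCases (fun i => ?_) (fun i => ?_) i
    · rw [(restrictsTo_castAdd _ _ i).1, cycleElt_left]
      simp only [stdElt, labelFrom, Function.update_apply, Fin.val_castAdd]
      split_ifs
      · rfl
      · exact labelFrom_of_lt _ _ _ (by omega)
    · rw [(restrictsTo_natAdd _ _ i).1]
      simp only [stdElt, labelFrom, Function.update_apply, Fin.val_natAdd]
      rw [if_neg (by omega), zero_add, ← labelFrom_add L p.1.1 0, add_zero]
  · change wordFrom _ _ _ = SpinSym.inLeft _ _ (wordFrom _ _ _) * SpinSym.inRight _ _ (wordFrom _ _ _)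
    rw [wordFrom, wordFrom, wordFrom, mul_one, blockWord_inLeft, zero_add, ← wordFrom_add, add_zero]

/-- A multiset of pairs (odd part, class) as a multiset of cycle types. -/
def toTypes (M : Multiset (OddNat × ConjClasses Γ)) : Multiset (ℕ × ConjClasses Γ) :=
  M.map fun p => (p.1.1, p.2)

theorem toTypes_injective : Function.Injective (toTypes (Γ := Γ)) :=
  Multiset.map_injective fun p q h => by
    simp only [Prod.mk.injEq] at h
    exact Prod.ext (Subtype.ext h.1) h.2

theorem odd_of_mem_toTypes {M : Multiset (OddNat × ConjClasses Γ)} {p : ℕ × ConjClasses Γ}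
    (h : p ∈ toTypes M) : Odd p.1 := by
  obtain ⟨q, _, rfl⟩ := Multiset.mem_map.1 h
  exact q.1.2

theorem odd_of_cycleTypes_eq {x : SpinWr Γ n} {M : Multiset (OddNat × ConjClasses Γ)}
    (h : cycleTypes x = toTypes M) : ∀ p ∈ cycleTypes x, Odd p.1 := fun _ hp =>
  odd_of_mem_toTypes (h ▸ hp)

theorem exists_toTypes_eq {M : Multiset (ℕ × ConjClasses Γ)} (h : ∀ p ∈ M, Odd p.1) :
    ∃ M', M = toTypes M' := by
  induction M using Multiset.induction_on with
  | empty => exact ⟨0, rfl⟩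
  | cons p M ih =>
    obtain ⟨M', rfl⟩ := ih fun q hq => h q (Multiset.mem_cons_of_mem hq)
    exact ⟨(⟨p.1, h p (Multiset.mem_cons_self _ _)⟩, p.2) ::ₘ M', by simp [toTypes]⟩

/-- The total size. -/
def weight (M : Multiset (OddNat × ConjClasses Γ)) : ℕ := (M.map fun p => p.1.1).sum

@[simp] theorem weight_cons (p : OddNat × ConjClasses Γ) (M : Multiset (OddNat × ConjClasses Γ)) :
    weight (p ::ₘ M) = p.1.1 + weight M := by simp [weight]

theorem weight_eq_of_cycleTypes {x : SpinWr Γ n} {M : Multiset (OddNat × ConjClasses Γ)}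
    (h : cycleTypes x = toTypes M) : weight M = n := by
  rw [← sum_cycleTypes x, h, toTypes, Multiset.map_map]
  rfl

/-- Cycle types add and `normSign` multiplies over the blocks; a multiplicative sign which is 1 on
each block is 1 on the whole. -/
theorem stdElt_spec (L : List (OddNat × ConjClasses Γ)) (N : ℕ)
    (h : weight (L : Multiset (OddNat × ConjClasses Γ)) = N) :
    cycleTypes (stdElt N L) = toTypes (L : Multiset (OddNat × ConjClasses Γ)) ∧
      normSign (stdElt N L) = 1 := by
  induction L generalizing N with
  | nil =>
    obtain rfl : 0 = N := h
    have h1 : cycleTypes (stdElt 0 ([] : List (OddNat × ConjClasses Γ))) = 0 :=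
      Multiset.eq_zero_of_forall_notMem fun p hp => by
        obtain ⟨i, _⟩ := mem_cycleTypes.1 hp
        exact i.elim0
    refine ⟨h1, ?_⟩
    rw [normSign, h1, Multiset.map_zero, Multiset.prod_zero, mul_one]
    exact SpinSym.spinSign_of_odd (by simp [stdElt, wordFrom])
  | cons p L ih =>
    rw [← Multiset.cons_coe, weight_cons] at h
    subst h
    obtain ⟨h1, h2⟩ := ih _ rfl
    constructor
    · rw [stdElt_cons, cycleTypes_embL_mul_embR, h1, cycleTypes_cycleElt, ← Multiset.cons_coe,
        toTypes, toTypes, Multiset.map_cons, Multiset.singleton_add]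
    · rw [stdElt_cons, normSign_embL_mul_embR, h2, normSign_cycleElt, mul_one]
      · rw [cycleTypes_cycleElt]
        intro q hq
        rw [Multiset.mem_singleton.1 hq]
        exact p.1.2
      · exact odd_of_cycleTypes_eq h1

/-! ### The basis functions -/

/-- The spin super class function which is `±1` on the classes `D_M^±`, and `0` elsewhere. -/
def basisFn (n : ℕ) (M : Multiset (OddNat × ConjClasses Γ)) : SuperFn Γ n where
  val x := if cycleTypes x = toTypes M then normSign x else 0
  property := by
    refine ⟨fun u x => ?_, fun x => ?_, fun x hx => if_neg fun h => ?_⟩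
    · simp only [cycleTypes_conj, normSign_conj]
    · simp only [cycleTypes_zW_mul, normSign_zW_mul]
      split_ifs <;> simp
    · rw [sgnW_of_odd (odd_of_cycleTypes_eq h)] at hx
      exact absurd hx (by decide)

theorem basisFn_apply (M : Multiset (OddNat × ConjClasses Γ)) (x : SpinWr Γ n) :
    (basisFn n M).1 x = if cycleTypes x = toTypes M then normSign x else 0 := rfl

/-- Elements with equal types are conjugate up to z, and f and `normSign` change sign together under
z. So f is proportional to `normSign` on the elements with given odd cycle types. -/
theorem superFn_apply_mul_normSign (f : SuperFn Γ n) {x y : SpinWr Γ n}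
    (h : cycleTypes x = cycleTypes y) : f.1 x * normSign y = f.1 y * normSign x := by
  rcases (simZ_of_cycleTypes_eq h).isConj with h | h
  · obtain ⟨u, rfl⟩ := isConj_iff.1 h
    rw [f.2.1, normSign_conj]
  · obtain ⟨u, hu⟩ := isConj_iff.1 h
    have h1 : f.1 x = -f.1 y := by rw [← f.2.1 u, hu, f.2.2.1]
    have h2 : normSign x = -normSign y := by rw [← normSign_conj u, hu, normSign_zW_mul]
    rw [h1, h2]; ring

theorem superFn_eq_zero_of_not_odd (f : SuperFn Γ n) (x : SpinWr Γ n)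
    (h : ¬ ∃ M, cycleTypes x = toTypes M) : f.1 x = 0 := by
  by_contra hf
  refine h (exists_toTypes_eq fun p hp => ?_)
  by_contra hodd
  exact hf (superFn_apply_eq_zero_of_even f x hp (Nat.not_odd_iff_even.1 hodd))

variable [Fintype Γ]

/-- On elements of type (k, c) the sign `normSign` is 1 on D_k(c)^+ and -1 on D_k(c)^-. In
particular these classes are distinct, and the two indicators in `sigma` never overlap. -/
theorem sigma_eq (k : OddNat) (γ : ClassFn Γ) :
    sigma k γ = ∑ c : ConjClasses Γ,
      ((k.1 : ℂ) / (Real.sqrt 2 : ℂ) * valAt γ c) • basisFn k.1 {(k, c)} := by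
  ext x
  rw [Submodule.coe_sum, Finset.sum_apply]
  change ∑ c : ConjClasses Γ, _ = _
  refine Finset.sum_congr rfl fun c _ => ?_
  rw [Submodule.coe_smul, Pi.smul_apply, smul_eq_mul, basisFn_apply]
  congr 1
  have hT : toTypes ({(k, c)} : Multiset (OddNat × ConjClasses Γ)) = cycleTypes (cycleElt k c) := by
    rw [cycleTypes_cycleElt, toTypes, Multiset.map_singleton]
  have hsig : ∀ y : SpinWr Γ k.1, IsConj y (cycleElt k c) →
      cycleTypes y = cycleTypes (cycleElt k c) ∧ normSign y = 1 := fun y hy => by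
    refine ⟨cycleTypes_eq_of_isConj hy, ?_⟩
    obtain ⟨u, hu⟩ := isConj_iff.1 hy
    rw [← normSign_conj u, hu, normSign_cycleElt]
  rw [hT]
  by_cases h : cycleTypes x = cycleTypes (cycleElt k c)
  · rw [if_pos h]
    rcases (simZ_of_cycleTypes_eq h).isConj with h1 | h1
    · have h2 := (hsig x h1).2
      have h3 : ¬ IsConj (zW Γ k.1 * x) (cycleElt k c) := fun h3 => by
        have := (hsig _ h3).2
        rw [normSign_zW_mul, h2] at this
        norm_num at this
      rw [if_pos h1, if_neg h3, h2, sub_zero]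
    · have h1' : IsConj (zW Γ k.1 * x) (cycleElt k c) := by
        simpa [zW_mul_zW_mul] using isConj_zW_mul h1
      have h2 := (hsig _ h1').2
      rw [normSign_zW_mul] at h2
      have h3 : ¬ IsConj x (cycleElt k c) := fun h3 => by
        have := (hsig _ h3).2
        rw [this] at h2
        norm_num at h2
      rw [if_neg h3, if_pos h1']
      linear_combination h2
  · rw [if_neg h, if_neg fun h1 => h (hsig x h1).1, if_neg fun h1 => h ?_, sub_zero]
    rw [← (hsig _ h1).1, cycleTypes_zW_mul]

end Sign

/-! ### Counting elements with one cycle -/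

section Count

variable {Γ : Type*} [Group Γ] {n m k : ℕ}

theorem mk_out (c : ConjClasses Γ) : ConjClasses.mk (Quotient.out c) = c := Quotient.out_eq c

theorem valAt_mk (f : ClassFn Γ) (g : Γ) : valAt f (ConjClasses.mk g) = f.1 g := by
  obtain ⟨u, hu⟩ := isConj_iff.1 (ConjClasses.mk_eq_mk_iff_isConj.1 (mk_out (ConjClasses.mk g)))
  exact (f.2 u _).symm.trans (congrArg f.1 hu)

/-- The product of labels starting at i is an entry of a power of x based at the predecessor a of i.
The shift by one point does not matter, since the type is constant on a cycle. -/
theorem mk_cycleProd (x : SpinWr Γ n) (i : Fin n) :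
    ConjClasses.mk (cycleProd x.left (permW x) i) = (ptype x i).2 := by
  set a := (permW x)⁻¹ i with ha
  have hi : permW x a = i := by rw [ha, ← Equiv.Perm.mul_apply, mul_inv_cancel]; rfl
  have key : ∀ l : ℕ, (((List.range l).map fun j => x.left ((permW x ^ j) i)).reverse).prod =
      (x ^ l).left ((permW x ^ l) a) := by
    intro l
    induction l with
    | zero => simp
    | succ l ih =>
      rw [List.range_succ, List.map_append, List.reverse_append, List.prod_append, ih,
        List.map_singleton, List.reverse_singleton, List.prod_singleton, pow_succ' x,
        pow_succ' (permW x), Equiv.Perm.mul_apply, mul_left_perm, ← Equiv.Perm.mul_apply (permW x),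
        ← pow_succ', pow_succ, Equiv.Perm.mul_apply, hi]
  have hlen : cycleLen x i = cycleLen x a := by
    have := congrArg Prod.fst (ptype_perm x a)
    rwa [hi] at this
  have h1 : cycleProd x.left (permW x) i = (x ^ cycleLen x i).left ((permW x ^ cycleLen x i) a) :=
    key _
  rw [h1, hlen, ← map_pow, permW_pow_cycleLen, ← hi, ptype_perm]
  rfl

theorem eta_eq (ξ : SelfDual Γ) (x : SpinWr Γ n) :
    eta ξ x = ((cycleTypes x).map fun p => valAt ξ.fn p.2).prod := by
  rw [cycleTypes, Multiset.map_map]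
  change ∏ i ∈ cycleReps (permW x), ξ.fn.1 (cycleProd x.left (permW x) i) = _
  refine Finset.prod_congr rfl fun i _ => ?_
  rw [Function.comp_apply, ← mk_cycleProd, valAt_mk]

/-- The element of `Γ^k` with the entry `g` at the first letter. -/
def firstElt (hk : 0 < k) (g : Γ) : SpinWr Γ k :=
  SemidirectProduct.inl (Pi.mulSingle ⟨0, hk⟩ g)

theorem permW_firstElt_mul (hk : 0 < k) (g : Γ) (x : SpinWr Γ k) :
    permW (firstElt hk g * x) = permW x := by
  rw [map_mul, permW_apply, firstElt, SemidirectProduct.right_inl, map_one, one_mul]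

theorem firstElt_mul_left (hk : 0 < k) (g : Γ) (x : SpinWr Γ k) (i : Fin k) :
    (firstElt hk g * x).left i = Pi.mulSingle (M := fun _ => Γ) ⟨0, hk⟩ g i * x.left i := by
  simp [firstElt]

/-- Along the long cycle, letter 0 is reached again only at the last step, so the altered label is
met once and as the leftmost factor. -/
theorem firstElt_mul_pow_left (hk : 0 < k) (g : Γ) (x : SpinWr Γ k)
    (hx : cycleLen x ⟨0, hk⟩ = k) :
    ((firstElt hk g * x) ^ k).left ⟨0, hk⟩ = g * (x ^ k).left ⟨0, hk⟩ := by
  set i0 : Fin k := ⟨0, hk⟩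
  have hp := permW_firstElt_mul hk g x
  have step : ∀ (y : SpinWr Γ k) (j : ℕ), (y ^ (j + 1)).left ((permW y ^ (j + 1)) i0) =
      y.left ((permW y ^ (j + 1)) i0) * (y ^ j).left ((permW y ^ j) i0) := fun y j => by
    rw [pow_succ' y, pow_succ' (permW y), Equiv.Perm.mul_apply, mul_left_perm]
  have key : ∀ j < k, ((firstElt hk g * x) ^ j).left ((permW x ^ j) i0) =
      (x ^ j).left ((permW x ^ j) i0) := by
    intro j
    induction j with
    | zero => simp
    | succ j ih =>
      intro hj
      have h1 := step (firstElt hk g * x) j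
      rw [hp, ih (by omega), firstElt_mul_left, Pi.mulSingle_eq_of_ne, one_mul] at h1
      · rw [h1, step]
      · intro h0
        have := pow_apply_inj x i0 (a := j + 1) (b := 0) (by omega) (by omega) (by simpa using h0)
        omega
  obtain ⟨j, rfl⟩ : ∃ j, k = j + 1 := ⟨k - 1, by omega⟩
  have hfix : (permW x ^ (j + 1)) i0 = i0 := by
    have := permW_pow_cycleLen x i0
    rwa [hx, map_pow] at this
  have h1 := step (firstElt hk g * x) j
  have h2 := step x j
  rw [hp, key j (by omega), firstElt_mul_left, hfix, Pi.mulSingle_eq_same] at h1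
  rw [hfix] at h2
  rw [h1, h2, mul_assoc]

theorem cycleTypes_eq_singleton_iff (hk : 0 < k) (x : SpinWr Γ k) (c : ConjClasses Γ) :
    cycleTypes x = {(k, c)} ↔
      cycleLen x ⟨0, hk⟩ = k ∧ ConjClasses.mk ((x ^ k).left ⟨0, hk⟩) = c := by
  constructor
  · intro h
    have h1 := ptype_eq_of_cycleTypes_eq_singleton h ⟨0, hk⟩
    have h2 : cycleLen x ⟨0, hk⟩ = k := congrArg Prod.fst h1
    refine ⟨h2, ?_⟩
    have h3 := congrArg Prod.snd h1
    simp only [ptype, h2] at h3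
    exact h3
  · rintro ⟨h1, h2⟩
    refine cycleTypes_eq_singleton rfl hk fun i => ?_
    obtain ⟨l, hl⟩ := (Finite.injective_iff_surjective.1 (cycleEmb x ⟨0, hk⟩ h1).injective) i
    rw [← hl]
    change ptype x ((permW x ^ l.1) ⟨0, hk⟩) = _
    rw [ptype_perm_pow, ptype, h1, h2]

variable [Fintype Γ]

/-- Orbit and stabilizer for the conjugation action, the stabilizer being the centralizer. -/
theorem card_class_mul_zeta (c : ConjClasses Γ) :
    (Finset.univ.filter fun g : Γ => ConjClasses.mk g = c).card * zeta c = Fintype.card Γ := by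
  have h := Nat.card_congr (MulAction.orbitProdStabilizerEquivGroup (ConjAct Γ) (Quotient.out c))
  rw [Nat.card_prod, ConjAct.orbit_eq_carrier_conjClasses,
    ← Subgroup.nat_card_centralizer_nat_card_stabilizer, mk_out] at h
  rw [zeta, ← Nat.card_eq_fintype_card (α := Γ)]
  refine Eq.trans ?_ h
  congr 1
  rw [Nat.card_eq_fintype_card, Fintype.card_subtype]
  congr 1
  ext g
  simp [ConjClasses.mem_carrier_iff_mk_eq]

theorem zeta_ne_zero (c : ConjClasses Γ) : (zeta c : ℂ) ≠ 0 := by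
  rw [zeta]; exact_mod_cast Nat.card_pos.ne'

/-- All fibres of a surjective homomorphism have the same size, so the proportion of elements
satisfying P is the same in both groups. -/
theorem card_filter_hom {G H : Type*} [Group G] [Fintype G] [Group H] [Fintype H] (φ : G →* H)
    (hφ : Function.Surjective φ) (P : H → Prop) [DecidablePred P] :
    (Finset.univ.filter fun x => P (φ x)).card * Fintype.card H =
      Fintype.card G * (Finset.univ.filter P).card := by
  have hfib : ∀ y, (Finset.univ.filter fun x => φ x = y).card =
      (Finset.univ.filter fun x => φ x = 1).card := fun y =>
    MonoidHom.card_fiber_eq_of_mem_range φ (hφ y) (hφ 1)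
  have h1 : ∀ Q : H → Prop, (Finset.univ.filter fun x => Q (φ x)).card =
      (Finset.univ.filter Q).card * (Finset.univ.filter fun x => φ x = 1).card := by
    intro Q
    rw [Finset.card_eq_sum_card_fiberwise (t := Finset.univ.filter Q) (f := φ)
      fun x hx => by simpa using hx, Finset.card_eq_sum_ones (Finset.univ.filter Q), Finset.sum_mul]
    refine Finset.sum_congr rfl fun y hy => ?_
    rw [one_mul, ← hfib y, Finset.filter_filter]
    congr 1
    ext x
    simp only [Finset.mem_filter, Finset.mem_univ, true_and] at hy ⊢
    exact ⟨fun h => h.2, fun h => ⟨h ▸ hy, h⟩⟩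
  have h2 := h1 fun _ => True
  simp only [Finset.filter_true, Finset.card_univ] at h2
  have h3 := h1 P
  have h4 : ∀ a b c d : ℕ, a = b * c → d = Fintype.card H * c →
      a * Fintype.card H = d * b := by
    rintro _ b c _ rfl rfl; ring
  exact h4 _ _ _ _ (by convert h3) h2

theorem isCycle_of_minimalPeriod (hk : 2 ≤ k) {σ : Equiv.Perm (Fin k)} {i : Fin k}
    (h : Function.minimalPeriod σ i = k) : σ.IsCycle ∧ σ.support = Finset.univ := by
  have hinj : Function.Injective fun j : Fin k => (σ ^ j.1) i := fun a b hab => by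
    simp only [Equiv.Perm.coe_pow] at hab
    exact Fin.ext (Function.iterate_injOn_Iio_minimalPeriod
      (show a.1 < _ by rw [h]; exact a.2) (show b.1 < _ by rw [h]; exact b.2) hab)
  have hsurj := Finite.injective_iff_surjective.1 hinj
  have hi : σ i ≠ i := fun hi => by
    rw [Function.minimalPeriod_eq_one_iff_isFixedPt.2 hi] at h
    omega
  have hmov : ∀ j, σ j ≠ j := fun j hj => by
    obtain ⟨l, rfl⟩ := hsurj j
    rw [← Equiv.Perm.mul_apply, ← pow_succ', pow_succ, Equiv.Perm.mul_apply] at hj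
    exact hi ((σ ^ l.1).injective hj)
  refine ⟨⟨i, hi, fun j _ => ?_⟩, by ext j; simp [hmov]⟩
  obtain ⟨l, hl⟩ := hsurj j
  exact ⟨l.1, by simpa using hl⟩

/-- The permutations in question are the (k - 1)! long cycles; the count is written without
division. -/
theorem card_full_cycles (hk : 0 < k) :
    (Finset.univ.filter fun σ : Equiv.Perm (Fin k) =>
      Function.minimalPeriod σ ⟨0, hk⟩ = k).card * k = k.factorial := by
  -- The cycle type of a permutation omits fixed points, so a single letter is treated apart.
  rcases Nat.lt_or_ge k 2 with h | h
  · obtain rfl : k = 1 := by omega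
    rw [Finset.filter_true_of_mem]
    · simp
    · intro σ _
      rw [Function.minimalPeriod_eq_one_iff_isFixedPt]
      exact Subsingleton.elim _ _
  · have hset : (Finset.univ.filter fun σ : Equiv.Perm (Fin k) =>
        Function.minimalPeriod σ ⟨0, hk⟩ = k) =
        Finset.univ.filter fun σ : Equiv.Perm (Fin k) => σ.cycleType = {k} := by
      refine Finset.filter_congr fun σ _ => ⟨fun h1 => ?_, fun h1 => ?_⟩
      · obtain ⟨hc, hs⟩ := isCycle_of_minimalPeriod h h1
        rw [hc.cycleType, hs, Finset.card_univ, Fintype.card_fin]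
      · have hc : σ.IsCycle := Equiv.Perm.card_cycleType_eq_one.1 (by rw [h1]; simp)
        have hs : σ.support.card = k := by
          have := hc.cycleType
          rw [h1] at this
          exact (Multiset.singleton_inj.1 this).symm
        have hmem : (⟨0, hk⟩ : Fin k) ∈ σ.support := by
          rw [(Finset.card_eq_iff_eq_univ _).1 (hs.trans (Fintype.card_fin k).symm)]
          exact Finset.mem_univ _
        rw [Equiv.Perm.mem_support] at hmem
        have ho : orderOf σ = k := by rw [hc.orderOf, hs]
        apply Nat.dvd_antisymm
        · refine Dvd.dvd.trans ?_ (dvd_of_eq ho)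
          apply Function.IsPeriodicPt.minimalPeriod_dvd
          rw [Function.IsPeriodicPt, Function.IsFixedPt, ← Equiv.Perm.coe_pow, pow_orderOf_eq_one]
          rfl
        · refine (dvd_of_eq ho.symm).trans ?_
          apply orderOf_dvd_of_pow_eq_one
          rw [hc.pow_eq_one_iff' hmem, Equiv.Perm.coe_pow]
          exact Function.isPeriodicPt_minimalPeriod _ _
    have := Equiv.Perm.card_of_cycleType_singleton (α := Fin k) h (by simp)
    rw [Fintype.card_fin, Nat.choose_self, mul_one] at this
    rw [hset, mul_comm, ← Nat.mul_factorial_pred hk.ne', ← this]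

theorem card_full (hk : 0 < k) :
    (Finset.univ.filter fun x : SpinWr Γ k => cycleLen x ⟨0, hk⟩ = k).card * k =
      Fintype.card (SpinWr Γ k) := by
  have h := card_filter_hom (permW (Γ := Γ) (n := k)) permW_surjective
    (fun σ => Function.minimalPeriod σ ⟨0, hk⟩ = k)
  rw [Fintype.card_perm, Fintype.card_fin, ← card_full_cycles hk, ← mul_assoc, mul_right_comm,
    mul_comm (Fintype.card _)] at h
  have hpos : 0 < (Finset.univ.filter fun σ : Equiv.Perm (Fin k) =>
      Function.minimalPeriod σ ⟨0, hk⟩ = k).card :=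
    Nat.pos_of_ne_zero fun h0 => by
      have := card_full_cycles hk
      rw [h0, zero_mul] at this
      exact (Nat.factorial_pos k).ne this
  rw [mul_comm] at h
  exact Nat.eq_of_mul_eq_mul_left hpos h

/-- Left multiplication of the first label by g permutes the lifts of long cycles and multiplies the
cycle product at the first letter by g. Summing over all g, the cycle products are equidistributed
in Γ, so the class c has the share 1/ζ_c of the elements counted by `card_full`. -/
theorem card_cycleTypes_singleton (hk : 0 < k) (c : ConjClasses Γ) :
    (Finset.univ.filter fun x : SpinWr Γ k => cycleTypes x = {(k, c)}).card * (k * zeta c) =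
      Fintype.card (SpinWr Γ k) := by
  set X := Finset.univ.filter fun x : SpinWr Γ k => cycleTypes x = {(k, c)}
  set Y := Finset.univ.filter fun x : SpinWr Γ k => cycleLen x ⟨0, hk⟩ = k with hY
  set K := Finset.univ.filter fun g : Γ => ConjClasses.mk g = c
  have h1 : X.card = ∑ x ∈ Y, if ConjClasses.mk ((x ^ k).left ⟨0, hk⟩) = c then 1 else 0 := by
    rw [← Finset.card_filter, hY, Finset.filter_filter]
    congr 1
    refine Finset.filter_congr fun x _ => ?_
    rw [cycleTypes_eq_singleton_iff hk]
  have h2 : ∀ g : Γ, X.card = ∑ x ∈ Y,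
      if ConjClasses.mk (g * (x ^ k).left ⟨0, hk⟩) = c then 1 else 0 := fun g => by
    rw [h1]
    have hlen : ∀ (g : Γ) (x : SpinWr Γ k), cycleLen (firstElt hk g * x) ⟨0, hk⟩ =
        cycleLen x ⟨0, hk⟩ := fun g x => by
      rw [cycleLen, permW_firstElt_mul]; rfl
    have hinv : firstElt hk g⁻¹ = (firstElt hk g)⁻¹ := by
      rw [firstElt, Pi.mulSingle_inv, map_inv]; rfl
    refine (Finset.sum_bij' (fun x _ => firstElt hk g * x) (fun x _ => firstElt hk g⁻¹ * x)
      ?_ ?_ ?_ ?_ ?_).symm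
    · intro x hx
      simpa [hY, hlen] using hx
    · intro x hx
      simpa [hY, hlen] using hx
    · intro x _; simp [hinv]
    · intro x _; simp [hinv]
    · intro x hx
      rw [firstElt_mul_pow_left hk g x (by simpa [hY] using hx)]
  have h3 : Fintype.card Γ * X.card = Y.card * K.card := by
    calc Fintype.card Γ * X.card = ∑ _g : Γ, X.card := by
          rw [Finset.sum_const, Finset.card_univ, smul_eq_mul]
      _ = ∑ g : Γ, ∑ x ∈ Y, if ConjClasses.mk (g * (x ^ k).left ⟨0, hk⟩) = c then 1 else 0 :=
          Finset.sum_congr rfl fun g _ => h2 g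
      _ = ∑ x ∈ Y, ∑ g : Γ, if ConjClasses.mk (g * (x ^ k).left ⟨0, hk⟩) = c then 1 else 0 :=
          Finset.sum_comm
      _ = ∑ _x ∈ Y, K.card := by
          refine Finset.sum_congr rfl fun x _ => ?_
          rw [Finset.card_filter]
          exact Fintype.sum_equiv (Equiv.mulRight ((x ^ k).left ⟨0, hk⟩)) _ _ fun g => rfl
      _ = _ := by rw [Finset.sum_const, smul_eq_mul]
  have h4 := card_full (Γ := Γ) hk
  have h5 := card_class_mul_zeta c
  have hG : 0 < Fintype.card Γ := Fintype.card_pos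
  apply Nat.eq_of_mul_eq_mul_left hG
  calc Fintype.card Γ * (X.card * (k * zeta c)) =
        (Fintype.card Γ * X.card) * (k * zeta c) := by ring
    _ = (Y.card * k) * (K.card * zeta c) := by rw [h3]; ring
    _ = Fintype.card Γ * Fintype.card (SpinWr Γ k) := by rw [h4, h5, mul_comm]

end Count

/-! ### The action of the raising and lowering operators on the basis -/

section Operators

variable {Γ : Type*} [Group Γ] [Fintype Γ] {n m k : ℕ}

theorem raise_apply (f : SuperFn Γ n) (g : SuperFn Γ m) (w : SpinWr Γ (n + m)) :
    (raise f m g).1 w = induce (hatProd Γ n m) (outer f.1 g.1) w := rfl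

theorem lower_apply (ξ : SelfDual Γ) (f : SuperFn Γ n) (g : SuperFn Γ (n + m))
    (y : SpinWr Γ m) :
    (lower ξ f m g).1 y = (Fintype.card (SpinWr Γ n) : ℂ)⁻¹ *
      ∑ x, eta ξ x * f.1 x * g.1 (embL n m x⁻¹ * embR n m y) := rfl

/-- The fibre over the product of a and y contains only (a, y) and (za, zy), and the two signs
cancel. The average in the definition is therefore over equal values. -/
theorem outer_eq (f : SuperFn Γ n) (g : SuperFn Γ m) (w : hatProd Γ n m) (a : SpinWr Γ n)
    (y : SpinWr Γ m) (h : w.1 = embL n m a * embR n m y) : outer f.1 g.1 w = f.1 a * g.1 y := by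
  have hval : ∀ p ∈ fibre n m w.1, f.1 p.1 * g.1 p.2 = f.1 a * g.1 y := by
    rintro ⟨b, v⟩ hp
    rw [mem_fibre, h] at hp
    dsimp only at hp ⊢
    have hb : b = a ∨ b = zW Γ n * a := by
      refine eq_or_eq_zW_mul (funext fun i => ?_) (Equiv.ext fun i => ?_)
      · rw [← (restrictsTo_castAdd b v i).1, hp, (restrictsTo_castAdd a y i).1]
      · apply Fin.castAdd_injective n m
        rw [← (restrictsTo_castAdd b v i).2, hp, (restrictsTo_castAdd a y i).2]
    have hv : v = y ∨ v = zW Γ m * y := by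
      refine eq_or_eq_zW_mul (funext fun i => ?_) (Equiv.ext fun i => ?_)
      · rw [← (restrictsTo_natAdd b v i).1, hp, (restrictsTo_natAdd a y i).1]
      · apply Fin.natAdd_injective m n
        rw [← (restrictsTo_natAdd b v i).2, hp, (restrictsTo_natAdd a y i).2]
    have hz : embL n m a * embR n m (zW Γ m * y) = zW Γ _ * (embL n m a * embR n m y) := by
      rw [map_mul, embR_zW, ← mul_assoc, ← zW_comm, mul_assoc]
    rcases hb with rfl | rfl <;> rcases hv with rfl | rfl
    · rfl
    · rw [hz] at hp
      exact absurd hp (zW_mul_ne _)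
    · rw [map_mul, embL_zW, mul_assoc] at hp
      exact absurd hp (zW_mul_ne _)
    · rw [f.2.2.1, g.2.2.1]; ring
  have hne : ((fibre n m w.1).card : ℂ) ≠ 0 := by
    have : (a, y) ∈ fibre n m w.1 := mem_fibre.2 h.symm
    exact_mod_cast (Finset.card_pos.2 ⟨_, this⟩).ne'
  rw [outer, Finset.sum_congr rfl hval, Finset.sum_const, nsmul_eq_mul, inv_mul_cancel_left₀ hne]

/-- `u` moves a cycle of type `p` to the first `k` letters. -/
def MovesCycle (w u : SpinWr Γ (k + m)) (p : ℕ × ConjClasses Γ) : Prop :=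
  ∃ i, ptype w i = p ∧ ∀ j : ℕ, (permW u ((permW w ^ j) i)).1 < k

/-- For any one such element u0, the others are exactly the elements h u0 with h in the spin
product. -/
theorem card_moving (w : SpinWr Γ (k + m)) (r : Fin (k + m)) (hr : cycleLen w r = k) :
    (Finset.univ.filter fun u : SpinWr Γ (k + m) =>
      ∀ j : ℕ, (permW u ((permW w ^ j) r)).1 < k).card = Nat.card (hatProd Γ k m) := by
  obtain ⟨u0, hu0⟩ := exists_moving_cycle hr
  rw [Nat.card_eq_fintype_card, Fintype.card_subtype]
  refine (Finset.card_bij (fun h _ => h * u0) ?_ ?_ ?_).symm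
  · intro h hh
    simp only [Finset.mem_filter, Finset.mem_univ, true_and] at hh ⊢
    intro j
    rw [mem_hatProd_iff] at hh
    rw [map_mul, Equiv.Perm.mul_apply]
    exact hh ⟨_, hu0 j⟩
  · intro a _ b _ h; exact mul_right_cancel h
  · intro u hu
    simp only [Finset.mem_filter, Finset.mem_univ, true_and] at hu
    refine ⟨u * u0⁻¹, ?_, by simp⟩
    simp only [Finset.mem_filter, Finset.mem_univ, true_and]
    rw [mem_hatProd_iff]
    intro l
    obtain ⟨j, hj⟩ := exists_pow_apply_eq_castAdd hr hu0 l
    rw [map_mul, map_inv, Equiv.Perm.mul_apply, Equiv.Perm.inv_eq_iff_eq.2 hj.symm]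
    exact hu j

/-- The first k letters have room for a single k-cycle, so the sets attached to distinct cycles are
disjoint, and each has the order of the spin product. -/
theorem card_movesCycle (w : SpinWr Γ (k + m)) (c : ConjClasses Γ) :
    (Finset.univ.filter fun u : SpinWr Γ (k + m) => MovesCycle w u (k, c)).card =
      (cycleTypes w).count (k, c) * Nat.card (hatProd Γ k m) := by
  have hset : (Finset.univ.filter fun u : SpinWr Γ (k + m) => MovesCycle w u (k, c)) =
      ((cycleReps (permW w)).filter fun i => ptype w i = (k, c)).biUnion fun r =>
        Finset.univ.filter fun u : SpinWr Γ (k + m) =>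
          ∀ j : ℕ, (permW u ((permW w ^ j) r)).1 < k := by
    ext u
    simp only [Finset.mem_filter, Finset.mem_univ, true_and, Finset.mem_biUnion]
    constructor
    · rintro ⟨i, hi, hu⟩
      obtain ⟨r, hr, l, rfl⟩ := exists_cycleRep (permW w) i
      refine ⟨r, ⟨hr, by rw [← hi, ptype_perm_pow]⟩, fun j => ?_⟩
      obtain ⟨l', hl'⟩ := pow_apply_back (permW w) r l
      have := hu (j + l')
      rwa [pow_add, Equiv.Perm.mul_apply, hl'] at this
    · rintro ⟨r, ⟨_, hr⟩, hu⟩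
      exact ⟨r, hr, hu⟩
  rw [hset, Finset.card_biUnion, count_cycleTypes, Finset.card_eq_sum_ones, Finset.sum_mul]
  · refine Finset.sum_congr rfl fun r hr => ?_
    rw [one_mul, card_moving w r (congrArg Prod.fst (Finset.mem_filter.1 hr).2)]
  · intro r hr r' hr' hne
    rw [Function.onFun, Finset.disjoint_left]
    intro u hu hu'
    simp only [Finset.coe_filter, Set.mem_ofPred_eq, Finset.mem_filter, Finset.mem_univ,
      true_and] at hr hr' hu hu'
    apply hne
    obtain ⟨j, hj⟩ := exists_pow_apply_eq_castAdd (congrArg Prod.fst hr'.2) hu'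
      ⟨permW u r, by simpa using hu 0⟩
    have h1 : (permW w ^ j) r' = r := (permW u).injective (Fin.ext (congrArg Fin.val hj))
    exact cycleReps_unique hr.1 hr'.1 (j := 0) (j' := j) (by simpa using h1.symm)

/-- In the induced sum an element u contributes only if it moves a cycle of type p to the first
letters. Multiplicativity and invariance of `normSign` make the contribution independent of u, so
after division by the order of the spin product the factor is the number of cycles of type p in w.
-/
theorem raise_basisFn (p : OddNat × ConjClasses Γ) (M : Multiset (OddNat × ConjClasses Γ))
    (w : SpinWr Γ (p.1.1 + m)) :
    (raise (basisFn p.1.1 {p}) m (basisFn m M)).1 w =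
      (cycleTypes w).count (p.1.1, p.2) * (basisFn (p.1.1 + m) (p ::ₘ M)).1 w := by
  have hsing : toTypes {p} = {(p.1.1, p.2)} := Multiset.map_singleton _ _
  have hodd : ∀ q ∈ ({(p.1.1, p.2)} : Multiset (ℕ × ConjClasses Γ)), Odd q.1 := fun q hq => by
    rw [Multiset.mem_singleton.1 hq]; exact p.1.2
  have hsum : ∀ u : SpinWr Γ (p.1.1 + m),
      (if h : u * w * u⁻¹ ∈ hatProd Γ p.1.1 m then
        outer (basisFn p.1.1 {p}).1 (basisFn m M).1 ⟨u * w * u⁻¹, h⟩ else 0) =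
      if MovesCycle w u (p.1.1, p.2) then (basisFn (p.1.1 + m) (p ::ₘ M)).1 w else 0 := by
    intro u
    by_cases hQ : MovesCycle w u (p.1.1, p.2)
    · rw [if_pos hQ]
      obtain ⟨i, hi, hu⟩ := hQ
      obtain ⟨a, y, e, ha⟩ := conj_eq_embL_mul_embR (congrArg Prod.fst hi) hu
      rw [hi] at ha
      have hmem : u * w * u⁻¹ ∈ hatProd Γ p.1.1 m := e ▸ embL_mul_embR_mem a y
      rw [dif_pos hmem, outer_eq _ _ _ a y e, basisFn_apply, basisFn_apply, basisFn_apply,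
        if_pos (ha.trans hsing.symm)]
      have hw : cycleTypes w = (p.1.1, p.2) ::ₘ cycleTypes y := by
        rw [← cycleTypes_conj u w, e, cycleTypes_embL_mul_embR, ha, Multiset.singleton_add]
      have hpM : toTypes (p ::ₘ M) = (p.1.1, p.2) ::ₘ toTypes M := Multiset.map_cons _ _ _
      rw [hw, hpM]
      by_cases hy : cycleTypes y = toTypes M
      · rw [if_pos hy, if_pos (by rw [hy]), ← normSign_conj u w, e,
          normSign_embL_mul_embR (by rw [ha]; exact hodd) (odd_of_cycleTypes_eq hy)]
      · rw [if_neg hy, if_neg fun h => hy ((Multiset.cons_inj_right _).1 h), mul_zero]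
    -- A nonzero contribution would require the first factor to be one long cycle of type p. Pulled
    -- back by u it is a cycle of w which u moves to the first letters, contrary to `hQ`.
    · rw [if_neg hQ]
      split_ifs with h
      · obtain ⟨a, y, e⟩ := exists_embL_mul_embR _ ((mem_hatProd_iff _).1 h)
        rw [outer_eq _ _ _ a y e, basisFn_apply, if_neg, zero_mul]
        intro ha
        rw [hsing] at ha
        have h0 : 0 < p.1.1 := p.1.2.pos
        let l : Fin p.1.1 := ⟨0, h0⟩
        obtain ⟨i, hi⟩ := (permW u).surjective (Fin.castAdd m l)
        refine hQ ⟨i, ?_, fun j => ?_⟩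
        · rw [← ptype_conj u w, hi, e, ptype_castAdd, ptype_eq_of_cycleTypes_eq_singleton ha]
        · have h1 := ((restrictsTo_castAdd a y).pow j l).2
          rw [← e, conj_pow, map_mul, map_mul, map_inv, ← hi, Equiv.Perm.mul_apply,
            Equiv.Perm.mul_apply, Equiv.Perm.inv_eq_iff_eq.2 rfl, map_pow] at h1
          rw [h1]
          simp
      · rfl
  have hH : (Nat.card (hatProd Γ p.1.1 m) : ℂ) ≠ 0 := by exact_mod_cast Nat.card_pos.ne'
  rw [raise_apply, induce, Finset.sum_congr rfl fun u _ => hsum u, ← Finset.sum_filter, Finset.sum_const,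
    card_movesCycle, nsmul_eq_mul]
  push_cast
  field_simp

/-- The pair with the inverse class. -/
def dualPair (p : OddNat × ConjClasses Γ) : OddNat × ConjClasses Γ := (p.1, invClass p.2)

/-- The pairing evaluates at x⁻¹, whose type is (k, c⁻¹) when x has type p = (k, c); this is the
pair removed from M. The signs of x and x⁻¹ cancel, each x carries the weight ξ(c), and the elements
of type p have density 1/(k ζ_c). -/
theorem lower_basisFn (ξ : SelfDual Γ) (p : OddNat × ConjClasses Γ)
    (M : Multiset (OddNat × ConjClasses Γ)) (y : SpinWr Γ m) :
    (lower ξ (basisFn p.1.1 {p}) m (basisFn (p.1.1 + m) M)).1 y =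
      valAt ξ.fn p.2 / (p.1.1 * zeta p.2) *
        if dualPair p ∈ M then (basisFn m (M.erase (dualPair p))).1 y else 0 := by
  have hsing : toTypes {p} = {(p.1.1, p.2)} := Multiset.map_singleton _ _
  have hodd : ∀ q ∈ ({(p.1.1, p.2)} : Multiset (ℕ × ConjClasses Γ)), Odd q.1 := fun q hq => by
    rw [Multiset.mem_singleton.1 hq]; exact p.1.2
  have hsum : ∀ x : SpinWr Γ p.1.1, eta ξ x * (basisFn p.1.1 {p}).1 x *
      (basisFn (p.1.1 + m) M).1 (embL p.1.1 m x⁻¹ * embR p.1.1 m y) =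
      if cycleTypes x = {(p.1.1, p.2)} then valAt ξ.fn p.2 *
        (if dualPair p ∈ M then (basisFn m (M.erase (dualPair p))).1 y else 0)
      else 0 := by
    intro x
    rw [basisFn_apply, hsing]
    by_cases hx : cycleTypes x = {(p.1.1, p.2)}
    swap
    · rw [if_neg hx, if_neg hx, mul_zero, zero_mul]
    rw [if_pos hx, if_pos hx, eta_eq, hx, Multiset.map_singleton, Multiset.prod_singleton,
      basisFn_apply, cycleTypes_embL_mul_embR, cycleTypes_inv, hx, Multiset.map_singleton,
      Multiset.singleton_add]
    have hxo : ∀ q ∈ cycleTypes x⁻¹, Odd q.1 := fun q hq => by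
      rw [cycleTypes_inv, hx, Multiset.map_singleton] at hq
      rw [Multiset.mem_singleton.1 hq]; exact p.1.2
    have hsq : normSign x * normSign x = 1 := normSign_sq (by rw [hx]; exact hodd)
    by_cases hM : dualPair p ∈ M
    · rw [if_pos hM, basisFn_apply]
      have hM' : toTypes M = (p.1.1, invClass p.2) ::ₘ toTypes (M.erase (dualPair p)) := by
        conv_lhs => rw [← Multiset.cons_erase hM]
        exact Multiset.map_cons _ _ _
      rw [hM']
      by_cases hy : cycleTypes y = toTypes (M.erase (dualPair p))
      · rw [if_pos hy, if_pos (by rw [hy]), normSign_embL_mul_embR hxo (odd_of_cycleTypes_eq hy),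
          normSign_inv]
        linear_combination (valAt ξ.fn p.2 * normSign y) * hsq
      · rw [if_neg hy, if_neg fun h => hy ((Multiset.cons_inj_right _).1 h)]
        ring
    · rw [if_neg hM, if_neg]
      · simp
      · intro h
        have : (p.1.1, invClass p.2) ∈ toTypes M := h ▸ Multiset.mem_cons_self _ _
        obtain ⟨q, hq, e⟩ := Multiset.mem_map.1 this
        simp only [Prod.mk.injEq] at e
        exact hM (by rwa [show dualPair p = q from
          Prod.ext (Subtype.ext e.1.symm) e.2.symm])
  rw [lower_apply, Finset.sum_congr rfl fun x _ => hsum x, ← Finset.sum_filter, Finset.sum_const,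
    nsmul_eq_mul, ← card_cycleTypes_singleton p.1.2.pos p.2]
  have h1 : (p.1.1 : ℂ) ≠ 0 := by exact_mod_cast p.1.2.pos.ne'
  have h2 := zeta_ne_zero p.2
  have h3 : ((Finset.univ.filter fun x : SpinWr Γ p.1.1 =>
      cycleTypes x = {(p.1.1, p.2)}).card : ℂ) ≠ 0 := by
    have h4 := card_cycleTypes_singleton (Γ := Γ) p.1.2.pos p.2
    have h5 : 0 < Fintype.card (SpinWr Γ p.1.1) := Fintype.card_pos
    have h6 : (Finset.univ.filter fun x : SpinWr Γ p.1.1 =>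
        cycleTypes x = {(p.1.1, p.2)}).card ≠ 0 := fun h0 => by rw [h0, zero_mul] at h4; omega
    exact_mod_cast h6
  push_cast
  field_simp

/-! ### Linearity of the raising and lowering maps in the fixed function -/

theorem raise_add (f f' : SuperFn Γ n) (g : SuperFn Γ m) :
    raise (f + f') m g = raise f m g + raise f' m g := by
  refine Subtype.ext (funext fun x => ?_)
  rw [Submodule.coe_add, Pi.add_apply, raise_apply, raise_apply, raise_apply]
  simp only [induce, outer, Submodule.coe_add, Pi.add_apply, ← mul_add, ← Finset.sum_add_distrib]
  congr 1
  refine Finset.sum_congr rfl fun u _ => ?_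
  split_ifs
  · rw [← mul_add, ← Finset.sum_add_distrib]
    simp only [add_mul]
  · simp

theorem raise_smul (b : ℂ) (f : SuperFn Γ n) (g : SuperFn Γ m) :
    raise (b • f) m g = b • raise f m g := by
  refine Subtype.ext (funext fun x => ?_)
  rw [Submodule.coe_smul, Pi.smul_apply, raise_apply, raise_apply]
  simp only [induce, outer, Submodule.coe_smul, Pi.smul_apply, smul_eq_mul]
  rw [mul_left_comm b]
  congr 1
  rw [Finset.mul_sum]
  refine Finset.sum_congr rfl fun u _ => ?_
  split_ifs
  · rw [mul_left_comm b]
    congr 1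
    rw [Finset.mul_sum]
    exact Finset.sum_congr rfl fun p _ => by ring
  · simp

theorem raise_sum {ι : Type*} (s : Finset ι) (a : ι → ℂ) (f : ι → SuperFn Γ n)
    (g : SuperFn Γ m) :
    raise (∑ i ∈ s, a i • f i) m g = ∑ i ∈ s, a i • raise (f i) m g := by
  induction s using Finset.induction_on with
  | empty => simpa using raise_smul 0 (0 : SuperFn Γ n) g
  | insert i s hi ih => rw [Finset.sum_insert hi, Finset.sum_insert hi, raise_add, raise_smul, ih]

theorem lower_add (ξ : SelfDual Γ) (f f' : SuperFn Γ n) (g : SuperFn Γ (n + m)) :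
    lower ξ (f + f') m g = lower ξ f m g + lower ξ f' m g := by
  refine Subtype.ext (funext fun x => ?_)
  rw [Submodule.coe_add, Pi.add_apply, lower_apply, lower_apply, lower_apply]
  simp only [Submodule.coe_add, Pi.add_apply, mul_add, add_mul, Finset.sum_add_distrib]

theorem lower_smul (ξ : SelfDual Γ) (b : ℂ) (f : SuperFn Γ n) (g : SuperFn Γ (n + m)) :
    lower ξ (b • f) m g = b • lower ξ f m g := by
  refine Subtype.ext (funext fun x => ?_)
  rw [Submodule.coe_smul, Pi.smul_apply, lower_apply, lower_apply]
  simp only [Submodule.coe_smul, Pi.smul_apply, smul_eq_mul]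
  rw [mul_left_comm b]
  congr 1
  rw [Finset.mul_sum]
  exact Finset.sum_congr rfl fun u _ => by ring

theorem lower_sum {ι : Type*} (ξ : SelfDual Γ) (s : Finset ι) (a : ι → ℂ) (f : ι → SuperFn Γ n)
    (g : SuperFn Γ (n + m)) :
    lower ξ (∑ i ∈ s, a i • f i) m g = ∑ i ∈ s, a i • lower ξ (f i) m g := by
  induction s using Finset.induction_on with
  | empty => simpa using lower_smul ξ 0 (0 : SuperFn Γ n) g
  | insert i s hi ih => rw [Finset.sum_insert hi, Finset.sum_insert hi, lower_add, lower_smul, ih]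

end Operators

/-! ## Partition-valued functions as multisets -/

section Multisets

variable {Γ : Type*} [Group Γ]

/-- The partition at the class `c`. -/
def partsAt (M : Multiset (OddNat × ConjClasses Γ)) (c : ConjClasses Γ) : Multiset OddNat :=
  (M.filter fun p => p.2 = c).map Prod.fst

theorem partsAt_cons_self (p : OddNat × ConjClasses Γ) (M : Multiset (OddNat × ConjClasses Γ)) :
    partsAt (p ::ₘ M) p.2 = p.1 ::ₘ partsAt M p.2 := by
  rw [partsAt, Multiset.filter_cons_of_pos (p := fun q : OddNat × ConjClasses Γ => q.2 = p.2) _ rfl, Multiset.map_cons,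
    partsAt]

theorem partsAt_cons_of_ne (p : OddNat × ConjClasses Γ) (M : Multiset (OddNat × ConjClasses Γ))
    {c : ConjClasses Γ} (h : p.2 ≠ c) : partsAt (p ::ₘ M) c = partsAt M c := by
  rw [partsAt, Multiset.filter_cons_of_neg (p := fun q : OddNat × ConjClasses Γ => q.2 = c) _ h, partsAt]

theorem count_partsAt [DecidableEq (OddNat × ConjClasses Γ)]
    (M : Multiset (OddNat × ConjClasses Γ)) (k : OddNat) (c : ConjClasses Γ) :
    (partsAt M c).count k = M.count (k, c) := by
  induction M using Multiset.induction_on with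
  | empty => simp [partsAt]
  | cons p M ih =>
    obtain ⟨j, d⟩ := p
    by_cases h : d = c
    · subst h
      rw [partsAt_cons_self, Multiset.count_cons, Multiset.count_cons, ih]
      simp only [Prod.mk.injEq, and_true]
    · rw [partsAt_cons_of_ne _ _ h, ih, Multiset.count_cons_of_ne]
      simp [Ne.symm h]

theorem partsAt_injective {M M' : Multiset (OddNat × ConjClasses Γ)}
    (h : ∀ c, partsAt M c = partsAt M' c) : M = M' := by
  ext ⟨k, c⟩
  rw [← count_partsAt, ← count_partsAt, h]

/-- The product of the parts gains the factor k, and the factorial of the multiplicity of k gains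
the new multiplicity. -/
theorem zPart_cons (k : OddNat) (s : Multiset OddNat) :
    OddPF.zPart (k ::ₘ s) = k.1 * (s.count k + 1) * OddPF.zPart s := by
  have h1 : ∏ j ∈ (k ::ₘ s).toFinset, ((k ::ₘ s).count j).factorial =
      (s.count k + 1) * ∏ j ∈ s.toFinset, (s.count j).factorial := by
    have h2 : ∏ j ∈ s.toFinset, (s.count j).factorial =
        ∏ j ∈ (k ::ₘ s).toFinset, (s.count j).factorial := by
      refine Finset.prod_subset (by simp) fun j _ hj => ?_
      rw [Multiset.count_eq_zero_of_notMem (by simpa using hj), Nat.factorial_zero]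
    have hk : k ∈ (k ::ₘ s).toFinset := by simp
    rw [h2, ← Finset.mul_prod_erase _ _ hk, ← Finset.mul_prod_erase _ _ hk,
      Multiset.count_cons_self, Nat.factorial_succ, mul_assoc]
    congr 2
    refine Finset.prod_congr rfl fun j hj => ?_
    rw [Multiset.count_cons_of_ne (Finset.ne_of_mem_erase hj)]
  rw [OddPF.zPart, OddPF.zPart, h1, Multiset.map_cons, Multiset.prod_cons]
  ring

/-- The monomial attached to a multiset of pairs. -/
def mon (M : Multiset (OddNat × ConjClasses Γ)) : SMinus Γ :=
  (M.map fun p => gen p.1 (classDelta p.2)).prod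

theorem mon_cons (p : OddNat × ConjClasses Γ) (M : Multiset (OddNat × ConjClasses Γ)) :
    mon (p ::ₘ M) = gen p.1 (classDelta p.2) * mon M := by
  rw [mon, Multiset.map_cons, Multiset.prod_cons, mon]

variable [Fintype Γ]

/-- `Z_ρ` in terms of the multiset of pairs. -/
def zM (M : Multiset (OddNat × ConjClasses Γ)) : ℕ :=
  ∏ c, OddPF.zPart (partsAt M c) * zeta c ^ Multiset.card (partsAt M c)

/-- Only the partition at the class of p changes. This recursion is what cancels the multiplicities
and densities produced by the raising and lowering operators. -/
theorem zM_cons [DecidableEq (OddNat × ConjClasses Γ)] (p : OddNat × ConjClasses Γ)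
    (M : Multiset (OddNat × ConjClasses Γ)) :
    zM (p ::ₘ M) = p.1.1 * zeta p.2 * (M.count p + 1) * zM M := by
  rw [zM, zM, ← Finset.mul_prod_erase _ _ (Finset.mem_univ p.2),
    ← Finset.mul_prod_erase _ _ (Finset.mem_univ p.2), partsAt_cons_self, zPart_cons,
    count_partsAt, Multiset.card_cons, pow_succ,
    Finset.prod_congr rfl fun c hc => by rw [partsAt_cons_of_ne p M (Finset.ne_of_mem_erase hc).symm]]
  ring

theorem zM_ne_zero (M : Multiset (OddNat × ConjClasses Γ)) : (zM M : ℂ) ≠ 0 := by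
  induction M using Multiset.induction_on with
  | empty => simp [zM, partsAt, OddPF.zPart]
  | cons p M ih =>
    rw [zM_cons]
    push_cast
    refine mul_ne_zero (mul_ne_zero (mul_ne_zero ?_ (zeta_ne_zero _)) ?_) ih
    · exact_mod_cast p.1.2.pos.ne'
    · exact_mod_cast Nat.succ_ne_zero (M.count p)

variable {n : ℕ}

/-- The multiset of pairs of a partition-valued function. -/
def OddPF.ms (ρ : OddPF Γ n) : Multiset (OddNat × ConjClasses Γ) := ρ.toList

theorem OddPF.ms_eq (ρ : OddPF Γ n) :
    ρ.ms = (Finset.univ : Finset (ConjClasses Γ)).val.bind fun c =>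
      (ρ.parts c).map fun k => (k, c) := by
  have h : ∀ c : ConjClasses Γ, ((ρ.parts c).map fun k => (k, c)) =
      (((ρ.parts c).sort (· ≥ ·)).map fun k => (k, c) : List (OddNat × ConjClasses Γ)) := fun c => by
    rw [← Multiset.map_coe, Multiset.sort_eq]
  simp only [h]
  rw [OddPF.ms, OddPF.toList, ← Finset.coe_toList, Multiset.coe_bind]

theorem OddPF.partsAt_ms (ρ : OddPF Γ n) (c : ConjClasses Γ) : partsAt ρ.ms c = ρ.parts c := by
  ext k
  rw [count_partsAt, OddPF.ms_eq, Multiset.count_bind]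
  change ∑ d, _ = _
  rw [Finset.sum_eq_single c]
  · exact Multiset.count_map_eq_count' (fun k => (k, c)) _ (fun a b h => (Prod.mk.inj h).1) k
  · intro d _ hd
    refine Multiset.count_eq_zero.2 fun h => ?_
    obtain ⟨j, _, hj⟩ := Multiset.mem_map.1 h
    exact hd (Prod.mk.inj hj).2
  · simp

theorem OddPF.ms_injective : Function.Injective (OddPF.ms (Γ := Γ) (n := n)) := fun ρ ρ' h => by
  obtain ⟨p, hp⟩ := ρ
  obtain ⟨p', hp'⟩ := ρ'
  rw [OddPF.mk.injEq]
  funext c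
  exact (OddPF.partsAt_ms ⟨p, hp⟩ c).symm.trans (by rw [h, OddPF.partsAt_ms])

theorem weight_eq_sum (M : Multiset (OddNat × ConjClasses Γ)) :
    weight M = ∑ c, ((partsAt M c).map Subtype.val).sum := by
  induction M using Multiset.induction_on with
  | empty => simp [weight, partsAt]
  | cons p M ih =>
    rw [weight_cons, ih, ← Finset.add_sum_erase _ _ (Finset.mem_univ p.2),
      ← Finset.add_sum_erase _ _ (Finset.mem_univ p.2), partsAt_cons_self, Multiset.map_cons,
      Multiset.sum_cons, add_assoc]
    congr 2
    refine Finset.sum_congr rfl fun c hc => ?_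
    rw [partsAt_cons_of_ne p M (Finset.ne_of_mem_erase hc).symm]

theorem OddPF.weight_ms (ρ : OddPF Γ n) : weight ρ.ms = n := by
  refine (weight_eq_sum _).trans (Eq.trans ?_ ρ.size_eq)
  exact Finset.sum_congr rfl fun c _ => by rw [OddPF.partsAt_ms]

theorem OddPF.exists_ms_eq {M : Multiset (OddNat × ConjClasses Γ)} (h : weight M = n) :
    ∃ ρ : OddPF Γ n, ρ.ms = M :=
  ⟨⟨partsAt M, by rw [← h, weight_eq_sum]⟩, partsAt_injective fun c => OddPF.partsAt_ms _ c⟩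

theorem OddPF.Z_eq (ρ : OddPF Γ n) : ρ.Z = zM ρ.ms := by
  simp only [OddPF.Z, zM, OddPF.partsAt_ms]

theorem OddPF.len_eq (ρ : OddPF Γ n) : ρ.len = Multiset.card ρ.ms := by
  rw [OddPF.ms_eq, Multiset.card_bind, OddPF.len]
  change _ = ∑ c, _
  simp

theorem classMonomial_eq (ρ : OddPF Γ n) : classMonomial ρ = mon ρ.ms := by
  rw [OddPF.ms_eq, mon, Multiset.map_bind, Multiset.prod_bind, classMonomial]
  change _ = ∏ c, _
  simp

theorem OddPF.cycleTypes_rep (ρ : OddPF Γ n) : cycleTypes ρ.rep = toTypes ρ.ms :=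
  (stdElt_spec _ _ ρ.weight_ms).1

theorem OddPF.normSign_rep (ρ : OddPF Γ n) : normSign ρ.rep = 1 :=
  (stdElt_spec _ _ ρ.weight_ms).2

theorem basisFn_rep (ρ : OddPF Γ n) (M : Multiset (OddNat × ConjClasses Γ)) :
    (basisFn n M).1 ρ.rep = if ρ.ms = M then 1 else 0 := by
  rw [basisFn_apply, ρ.cycleTypes_rep, ρ.normSign_rep]
  simp only [toTypes_injective.eq_iff]

theorem superFn_eq_normSign_mul (f : SuperFn Γ n) {x : SpinWr Γ n} (ρ : OddPF Γ n)
    (h : cycleTypes x = toTypes ρ.ms) : f.1 x = f.1 ρ.rep * normSign x := by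
  rw [← superFn_apply_mul_normSign f (h.trans ρ.cycleTypes_rep.symm), ρ.normSign_rep, mul_one]

/-- For given odd types both sides are multiples of `normSign` and agree at the standard
representative; on all other elements both vanish. -/
theorem superFn_eq_sum (f : SuperFn Γ n) : f = ∑ ρ : OddPF Γ n, f.1 ρ.rep • basisFn n ρ.ms := by
  refine Subtype.ext (funext fun x => ?_)
  rw [Submodule.coe_sum, Finset.sum_apply]
  simp only [Submodule.coe_smul, Pi.smul_apply, smul_eq_mul, basisFn_apply]
  by_cases h : ∃ M, cycleTypes x = toTypes M
  · obtain ⟨M, hM⟩ := h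
    obtain ⟨ρ, rfl⟩ := OddPF.exists_ms_eq (weight_eq_of_cycleTypes hM)
    rw [Finset.sum_eq_single ρ, if_pos hM, superFn_eq_normSign_mul f ρ hM]
    · intro ρ' _ hne
      rw [if_neg, mul_zero]
      rw [hM]
      exact fun h => hne (OddPF.ms_injective (toTypes_injective h)).symm
    · simp
  · rw [superFn_eq_zero_of_not_odd f x h, Finset.sum_eq_zero]
    intro ρ _
    rw [if_neg fun h' => h ⟨_, h'⟩, mul_zero]

/-! ### The characteristic map in the two bases -/

/-- The coefficient of the characteristic map at `M`. -/
def chCoeff (M : Multiset (OddNat × ConjClasses Γ)) : ℂ :=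
  (Real.sqrt 2 : ℂ) ^ Multiset.card M / (zM M : ℂ)

theorem sqrt_two_ne_zero : (Real.sqrt 2 : ℂ) ≠ 0 := by
  exact_mod_cast (Real.sqrt_pos.2 (by norm_num : (0 : ℝ) < 2)).ne'

theorem chCoeff_ne_zero (M : Multiset (OddNat × ConjClasses Γ)) : chCoeff M ≠ 0 :=
  div_ne_zero (pow_ne_zero _ sqrt_two_ne_zero) (zM_ne_zero M)

theorem chN_eq (f : SuperFn Γ n) :
    chN n f = ∑ ρ : OddPF Γ n, (chCoeff ρ.ms * f.1 ρ.rep) • mon ρ.ms := by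
  rw [chN_apply]
  refine Finset.sum_congr rfl fun ρ _ => ?_
  rw [ρ.len_eq, ρ.Z_eq, classMonomial_eq, chCoeff]

theorem chN_basisFn {M : Multiset (OddNat × ConjClasses Γ)} (h : weight M = n) :
    chN n (basisFn n M) = chCoeff M • mon M := by
  obtain ⟨ρ, rfl⟩ := OddPF.exists_ms_eq h
  rw [chN_eq, Finset.sum_eq_single ρ]
  · rw [basisFn_rep, if_pos rfl, mul_one]
  · intro ρ' _ hne
    rw [basisFn_rep, if_neg fun h => hne (OddPF.ms_injective h), mul_zero, zero_smul]
  · simp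

theorem ch_of (f : SuperFn Γ n) : ch Γ (RMinus.of n f) = chN n f := by
  simp [ch, RMinus.sumMap, RMinus.of]

/-- Linear maps on `R⁻_Γ` are determined by their values at the basis functions. -/
theorem linearMap_ext_basisFn {W : Type*} [AddCommGroup W] [Module ℂ W]
    {F G : RMinus Γ →ₗ[ℂ] W}
    (h : ∀ M, F (RMinus.of (weight M) (basisFn (weight M) M)) =
      G (RMinus.of (weight M) (basisFn (weight M) M))) : F = G := by
  have h1 : F ∘ₗ (RMinus.equiv Γ).symm.toLinearMap = G ∘ₗ (RMinus.equiv Γ).symm.toLinearMap := by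
    refine DirectSum.linearMap_ext ℂ fun n => LinearMap.ext fun f => ?_
    change F (RMinus.of n f) = G (RMinus.of n f)
    rw [superFn_eq_sum f]
    simp only [map_sum, map_smul]
    refine Finset.sum_congr rfl fun ρ _ => ?_
    have := h ρ.ms
    rw [ρ.weight_ms] at this
    rw [this]
  ext v
  exact DFunLike.congr_fun h1 (RMinus.equiv Γ v)

end Multisets

/-! ## The characteristic map intertwines the operators -/

section Intertwine

variable {Γ : Type*} [Group Γ] {n m : ℕ}

theorem count_toTypes [DecidableEq (ℕ × ConjClasses Γ)] [DecidableEq (OddNat × ConjClasses Γ)]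
    (M : Multiset (OddNat × ConjClasses Γ)) (p : OddNat × ConjClasses Γ) :
    (toTypes M).count (p.1.1, p.2) = M.count p :=
  Multiset.count_map_eq_count' (fun p : OddNat × ConjClasses Γ => (p.1.1, p.2)) _
    (fun p q h => by
      simp only [Prod.mk.injEq] at h
      exact Prod.ext (Subtype.ext h.1) h.2) p

theorem le_weight {p : OddNat × ConjClasses Γ} {M : Multiset (OddNat × ConjClasses Γ)}
    (h : p ∈ M) : p.1.1 ≤ weight M := by
  obtain ⟨M, rfl⟩ := Multiset.exists_cons_of_mem h
  simp

theorem component_of_self (f : SuperFn Γ n) : RMinus.component n (RMinus.of n f) = f :=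
  DirectSum.component.lof_self (M := fun k => SuperFn Γ k) ℂ n f

theorem component_of_ne (f : SuperFn Γ n) (h : n ≠ m) :
    RMinus.component m (RMinus.of n f) = 0 :=
  (DirectSum.component.of (M := fun k => SuperFn Γ k) ℂ m n f).trans (dif_neg h)

theorem rMinus_ext {u v : RMinus Γ} (h : ∀ n, RMinus.component n u = RMinus.component n v) :
    u = v := DirectSum.ext_component ℂ h

variable [Fintype Γ]

theorem zeta_invClass (c : ConjClasses Γ) : zeta (invClass c) = zeta c := by
  have h : (Finset.univ.filter fun g : Γ => ConjClasses.mk g = invClass c).card =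
      (Finset.univ.filter fun g : Γ => ConjClasses.mk g = c).card := by
    refine Finset.card_equiv (Equiv.inv Γ) fun g => ?_
    simp only [Finset.mem_filter, Finset.mem_univ, true_and, Equiv.inv_apply, ← invClass_mk]
    exact ⟨fun h => by rw [h, invClass_invClass], fun h => by rw [← h, invClass_invClass]⟩
  have h1 := card_class_mul_zeta (invClass c)
  rw [h, ← card_class_mul_zeta c] at h1
  have h2 : 0 < (Finset.univ.filter fun g : Γ => ConjClasses.mk g = c).card := by
    refine Finset.card_pos.2 ⟨Quotient.out c, ?_⟩
    simp [mk_out]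
  exact Nat.eq_of_mul_eq_mul_left h2 h1

/-- The sum runs over the x with x⁻¹ in c, and their number times ζ_c is |Γ|. The form thus sees γ
only at classes where ξ does not vanish, which describes its radical. -/
theorem wform_classDelta (ξ : SelfDual Γ) (γ : ClassFn Γ) (c : ConjClasses Γ) :
    wform ξ γ (classDelta c) = valAt ξ.fn (invClass c) * valAt γ (invClass c) := by
  have h : ∀ x : Γ, ξ.fn.1 x * γ.1 x * (classDelta c).1 x⁻¹ =
      if ConjClasses.mk x = invClass c then
        valAt ξ.fn (invClass c) * valAt γ (invClass c) * zeta c else 0 := fun x => by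
    have h1 : ConjClasses.mk x⁻¹ = c ↔ ConjClasses.mk x = invClass c := by
      rw [← invClass_mk]
      exact ⟨fun h => by rw [← h, invClass_invClass], fun h => by rw [h, invClass_invClass]⟩
    by_cases h2 : ConjClasses.mk x = invClass c
    · rw [if_pos h2, ← h2, valAt_mk, valAt_mk]
      congr 1
      exact if_pos (h1.2 h2)
    · rw [if_neg h2]
      exact mul_eq_zero_of_right _ (if_neg (mt h1.1 h2))
  rw [wform, LinearMap.mk₂_apply, Finset.sum_congr rfl fun x _ => h x, ← Finset.sum_filter,
    Finset.sum_const, nsmul_eq_mul, ← card_class_mul_zeta (invClass c), zeta_invClass]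
  have h2 : ((Finset.univ.filter fun g : Γ => ConjClasses.mk g = invClass c).card : ℂ) ≠ 0 := by
    have : 0 < (Finset.univ.filter fun g : Γ => ConjClasses.mk g = invClass c).card :=
      Finset.card_pos.2 ⟨Quotient.out (invClass c), by simp [mk_out]⟩
    exact_mod_cast this.ne'
  have := zeta_ne_zero c
  push_cast
  field_simp

/-- The multiplicity of p in w, a function of w in `raise_basisFn`, is constant on the support of
the resulting basis function: one more than in M. -/
theorem raise_basisFn_eq (p : OddNat × ConjClasses Γ) (M : Multiset (OddNat × ConjClasses Γ)) :
    raise (basisFn p.1.1 {p}) m (basisFn m M) =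
      ((M.count p : ℂ) + 1) • basisFn (p.1.1 + m) (p ::ₘ M) := by
  refine Subtype.ext (funext fun w => ?_)
  rw [raise_basisFn, Submodule.coe_smul, Pi.smul_apply, smul_eq_mul, basisFn_apply]
  split_ifs with h
  · rw [h, count_toTypes, Multiset.count_cons_self]
    push_cast
    rfl
  · rw [mul_zero, mul_zero]

theorem lower_basisFn_eq (ξ : SelfDual Γ) (p : OddNat × ConjClasses Γ)
    (M : Multiset (OddNat × ConjClasses Γ)) :
    lower ξ (basisFn p.1.1 {p}) m (basisFn (p.1.1 + m) M) =
      (valAt ξ.fn p.2 / (p.1.1 * zeta p.2)) •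
        if dualPair p ∈ M then basisFn m (M.erase (dualPair p)) else 0 := by
  refine Subtype.ext (funext fun w => ?_)
  rw [lower_basisFn, Submodule.coe_smul, Pi.smul_apply, smul_eq_mul]
  split_ifs <;> rfl

theorem chCoeff_cons (p : OddNat × ConjClasses Γ) (M : Multiset (OddNat × ConjClasses Γ)) :
    chCoeff (p ::ₘ M) = (Real.sqrt 2 : ℂ) / (p.1.1 * zeta p.2 * (M.count p + 1)) * chCoeff M := by
  rw [chCoeff, chCoeff, zM_cons, Multiset.card_cons, pow_succ]
  push_cast
  rw [div_mul_div_comm, mul_comm (_ ^ _)]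

theorem raiseOp_of (f : SuperFn Γ n) (g : SuperFn Γ m) :
    raiseOp f (RMinus.of m g) = RMinus.of (n + m) (raise f m g) := by
  simp [raiseOp, RMinus.sumMap, RMinus.of]

/-- With m the multiplicity of (k, c) in M, the factor (k/√2) γ(c) from `sigma`, the factor m + 1
from induction and the change √2/(k ζ_c (m + 1)) of the coefficient of `ch` multiply to γ(c)/ζ_c.
This is the coefficient of ζ_c 1_c in γ. -/
theorem ch_raiseOp_sigma (k : OddNat) (γ : ClassFn Γ) (v : RMinus Γ) :
    ch Γ (raiseOp (sigma k γ) v) = gen k γ * ch Γ v := by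
  suffices h : ch Γ ∘ₗ raiseOp (sigma k γ) = LinearMap.mulLeft ℂ (gen k γ) ∘ₗ ch Γ from
    DFunLike.congr_fun h v
  refine linearMap_ext_basisFn fun M => ?_
  rw [LinearMap.comp_apply, LinearMap.comp_apply, LinearMap.mulLeft_apply, raiseOp_of, ch_of, ch_of,
    chN_basisFn rfl, sigma_eq, raise_sum, map_sum]
  nth_rewrite 2 [← sum_valAt_smul_classDelta γ]
  rw [map_sum, Finset.sum_mul]
  refine Finset.sum_congr rfl fun c _ => ?_
  rw [raise_basisFn_eq (k, c) M, map_smul, map_smul, chN_basisFn (weight_cons (k, c) M), mon_cons,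
    chCoeff_cons, map_smul, smul_smul, smul_smul, smul_mul_smul_comm]
  congr 1
  have h1 : (k.1 : ℂ) ≠ 0 := by exact_mod_cast k.2.pos.ne'
  have h2 := zeta_ne_zero c
  have h3 : ((M.count (k, c) : ℂ) + 1) ≠ 0 := by exact_mod_cast Nat.succ_ne_zero (M.count (k, c))
  have h4 := sqrt_two_ne_zero
  field_simp

theorem component_lowerOp (ξ : SelfDual Γ) (f : SuperFn Γ n) (v : RMinus Γ) :
    RMinus.component m (lowerOp ξ f v) = lower ξ f m (RMinus.component (n + m) v) := rfl

theorem lowerOp_of_add (ξ : SelfDual Γ) (f : SuperFn Γ n) (g : SuperFn Γ (n + m)) :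
    lowerOp ξ f (RMinus.of (n + m) g) = RMinus.of m (lower ξ f m g) := by
  refine rMinus_ext fun j => ?_
  rw [component_lowerOp]
  by_cases h : m = j
  · subst h
    rw [component_of_self, component_of_self]
  · rw [component_of_ne _ h, component_of_ne _ (by omega), map_zero]

theorem lowerOp_of_lt (ξ : SelfDual Γ) (f : SuperFn Γ n) (g : SuperFn Γ m) (h : m < n) :
    lowerOp ξ f (RMinus.of m g) = 0 := by
  refine rMinus_ext fun j => ?_
  rw [component_lowerOp, component_of_ne _ (by omega), map_zero, map_zero]

/-- Leibniz' rule, equal factors being collected into the multiplicity. In the induction the new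
factor p matters only for the term (k, c) = p, where it supplies one further copy of `mon M`. -/
theorem symDer_mon (ξ : SelfDual Γ) (k : OddNat) (γ : ClassFn Γ)
    (M : Multiset (OddNat × ConjClasses Γ)) :
    symDer (annFunctional ξ k γ) (mon M) =
      ∑ c, ((M.count (k, c) : ℂ) * ((k.1 : ℂ) / 2 * wform ξ γ (classDelta c))) •
        mon (M.erase (k, c)) := by
  induction M using Multiset.induction_on with
  | empty => simp [mon]
  | cons p M ih =>
    have h : ∀ c, (((p ::ₘ M).count (k, c) : ℂ) * ((k.1 : ℂ) / 2 * wform ξ γ (classDelta c))) •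
        mon ((p ::ₘ M).erase (k, c)) =
        (if c = p.2 then (if k = p.1 then ((k.1 : ℂ) / 2 * wform ξ γ (classDelta c)) • mon M
          else 0) else 0) +
        gen p.1 (classDelta p.2) * (((M.count (k, c) : ℂ) *
          ((k.1 : ℂ) / 2 * wform ξ γ (classDelta c))) • mon (M.erase (k, c))) := fun c => by
      by_cases hp : (k, c) = p
      · subst hp
        rw [if_pos rfl, if_pos rfl, Multiset.count_cons_self, Multiset.erase_cons_head]
        by_cases hm : (k, c) ∈ M
        · obtain ⟨M, rfl⟩ := Multiset.exists_cons_of_mem hm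
          rw [Multiset.erase_cons_head, mul_smul_comm, ← mon_cons, ← add_smul]
          push_cast
          congr 1
          ring
        · rw [Multiset.count_eq_zero_of_notMem hm]
          simp
      · rw [Multiset.count_cons_of_ne hp, Multiset.erase_cons_tail _ (Ne.symm hp), mon_cons,
          mul_smul_comm]
        rw [← ite_and, if_neg, zero_add]
        rintro ⟨rfl, rfl⟩
        exact hp rfl
    rw [Finset.sum_congr rfl fun c _ => h c, Finset.sum_add_distrib, ← Finset.mul_sum, ← ih,
      Finset.sum_ite_eq' Finset.univ p.2, if_pos (Finset.mem_univ _), mon_cons, Derivation.leibniz,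
      symDer_ann_gen, smul_eq_mul, smul_eq_mul, add_comm]
    congr 1
    split_ifs
    · rw [Algebra.smul_def, mul_comm]
    · simp

/-- Removing (k, c⁻¹) gives the factor (k/√2) γ(c) ξ(c)/(k ζ_c). If this pair has multiplicity m in
M, its removal divides the coefficient of `ch` by √2/(k ζ_c m). Together this is m (k/2) ξ(c) γ(c),
the coefficient of the derivation at c⁻¹. -/
theorem ch_lowerOp_sigma (ξ : SelfDual Γ) (k : OddNat) (γ : ClassFn Γ) (v : RMinus Γ) :
    ch Γ (lowerOp ξ (sigma k γ) v) = symDer (annFunctional ξ k γ) (ch Γ v) := by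
  suffices h : ch Γ ∘ₗ lowerOp ξ (sigma k γ) =
      (symDer (annFunctional ξ k γ)).toLinearMap ∘ₗ ch Γ from DFunLike.congr_fun h v
  refine linearMap_ext_basisFn fun M => ?_
  rw [LinearMap.comp_apply, LinearMap.comp_apply, ch_of, chN_basisFn rfl]
  change _ = symDer (annFunctional ξ k γ) _
  rw [Derivation.map_smul, symDer_mon]
  by_cases hk : weight M < k.1
  · rw [lowerOp_of_lt _ _ _ hk, map_zero, Finset.sum_eq_zero, smul_zero]
    intro c _
    rw [Multiset.count_eq_zero_of_notMem fun h => not_le.2 hk (le_weight h)]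
    simp
  · obtain ⟨m, hm⟩ := Nat.exists_eq_add_of_le (not_lt.1 hk)
    rw [hm, lowerOp_of_add, ch_of, sigma_eq, lower_sum, map_sum, Finset.smul_sum]
    -- The left sum is indexed by the class c in the expansion of `sigma`, the right one by the
    -- class removed from M, which is c⁻¹.
    refine Finset.sum_equiv (Equiv.ofBijective invClass
      (Function.Involutive.bijective invClass_invClass)) (by simp) fun c _ => ?_
    rw [Equiv.ofBijective_apply, map_smul, lower_basisFn_eq ξ (k, c) M, map_smul, wform_classDelta,
      invClass_invClass]
    change _ • _ • chN m (if (k, invClass c) ∈ M then basisFn m (M.erase (k, invClass c)) else 0) = _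
    split_ifs with h
    · obtain ⟨M, rfl⟩ := Multiset.exists_cons_of_mem h
      have hw : weight M = m := by rw [weight_cons] at hm; exact Nat.add_left_cancel hm
      rw [Multiset.erase_cons_head, chN_basisFn hw, chCoeff_cons, Multiset.count_cons_self,
        zeta_invClass, smul_smul, smul_smul, smul_smul]
      congr 1
      have h1 : (k.1 : ℂ) ≠ 0 := by exact_mod_cast k.2.pos.ne'
      have h2 := zeta_ne_zero c
      have h3 : ((M.count (k, invClass c) : ℂ) + 1) ≠ 0 := by exact_mod_cast Nat.succ_ne_zero (M.count (k, invClass c))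
      have h4 := sqrt_two_ne_zero
      have h5 : (Real.sqrt 2 : ℂ) ^ 2 = 2 := by
        rw [← Complex.ofReal_pow, Real.sq_sqrt (by norm_num)]
        norm_num
      push_cast
      field_simp
      rw [h5]
      ring
    · rw [Multiset.count_eq_zero_of_notMem h]
      simp

end Intertwine

/-! ## The monomial basis of the Fock space -/

section MonomialBasis

variable {Γ : Type*} [Group Γ] {n m : ℕ}

theorem valAt_invClass (ξ : SelfDual Γ) (c : ConjClasses Γ) :
    valAt ξ.fn (invClass c) = valAt ξ.fn c := by
  rw [← mk_out c, invClass_mk, valAt_mk, valAt_mk, ξ.fn_inv]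

theorem eta_eq_of_cycleTypes (ξ : SelfDual Γ) {x : SpinWr Γ n}
    {M : Multiset (OddNat × ConjClasses Γ)} (h : cycleTypes x = toTypes M) :
    eta ξ x = (M.map fun p => valAt ξ.fn p.2).prod := by
  rw [eta_eq, h, toTypes, Multiset.map_map]
  rfl

theorem cycleTypes_inv_eq_iff (x : SpinWr Γ n) (M : Multiset (OddNat × ConjClasses Γ)) :
    cycleTypes x⁻¹ = toTypes (M.map dualPair) ↔ cycleTypes x = toTypes M := by
  have h : toTypes (M.map dualPair) = (toTypes M).map fun p => (p.1, invClass p.2) := by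
    rw [toTypes, toTypes, Multiset.map_map, Multiset.map_map]
    rfl
  rw [cycleTypes_inv, h]
  refine (Multiset.map_injective fun p q h => ?_).eq_iff
  simp only [Prod.mk.injEq] at h
  exact Prod.ext h.1 (by rw [← invClass_invClass p.2, h.2, invClass_invClass])

variable [Fintype Γ]

/-- Class functions by their values divided by `ζ_c`. -/
def classFnEquiv : ClassFn Γ ≃ₗ[ℂ] (ConjClasses Γ → ℂ) :=
  LinearEquiv.ofLinearMap
    (LinearMap.pi fun c => (zeta c : ℂ)⁻¹ •
      (LinearMap.proj (Quotient.out c) ∘ₗ (ClassFn Γ).subtype))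
    (∑ c, (LinearMap.proj c : (ConjClasses Γ → ℂ) →ₗ[ℂ] ℂ).smulRight (classDelta c))
    (by
      refine LinearMap.ext fun v => funext fun d => ?_
      have h : ∀ c, (classDelta c).1 (Quotient.out d) = if c = d then (zeta c : ℂ) else 0 :=
        fun c => by
          by_cases hc : c = d
          · rw [if_pos hc]
            exact if_pos ((mk_out d).trans hc.symm)
          · rw [if_neg hc]
            exact if_neg fun h => hc (h.symm.trans (mk_out d))
      simp only [LinearMap.comp_apply, LinearMap.pi_apply, LinearMap.sum_apply,
        LinearMap.smulRight_apply, LinearMap.proj_apply, LinearMap.smul_apply,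
        Submodule.subtype_apply, Submodule.coe_sum, Submodule.coe_smul, Finset.sum_apply,
        Pi.smul_apply, h, smul_eq_mul, LinearMap.id_apply, mul_ite, mul_zero,
        Finset.sum_ite_eq', Finset.mem_univ, if_true]
      have := zeta_ne_zero d
      field_simp)
    (by
      refine LinearMap.ext fun γ => ?_
      simp only [LinearMap.comp_apply, LinearMap.sum_apply, LinearMap.smulRight_apply,
        LinearMap.proj_apply, LinearMap.pi_apply, LinearMap.smul_apply, Submodule.subtype_apply,
        LinearMap.id_apply, smul_eq_mul]
      exact sum_valAt_smul_classDelta γ)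

variable (Γ) in
/-- The basis `ζ_c 1_c` of the space of class functions. -/
def classBasis : Module.Basis (ConjClasses Γ) ℂ (ClassFn Γ) := .ofEquivFun classFnEquiv

theorem classBasis_apply (c : ConjClasses Γ) : classBasis Γ c = classDelta c := by
  rw [classBasis, Module.Basis.coe_ofEquivFun]
  simp [classFnEquiv, LinearMap.sum_apply, Pi.single_apply]

variable (Γ) in
/-- The basis of the space of generators of `S⁻_Γ`. -/
def genBasis : Module.Basis (OddNat × ConjClasses Γ) ℂ (OddNat →₀ ClassFn Γ) :=
  (Finsupp.basis fun _ : OddNat => classBasis Γ).reindex (Equiv.sigmaEquivProd _ _)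

theorem genBasis_apply (p : OddNat × ConjClasses Γ) :
    genBasis Γ p = Finsupp.single p.1 (classDelta p.2) := by
  simp [genBasis, classBasis_apply]

variable (Γ) in
/-- The monomial basis of `S⁻_Γ`. -/
def monBasis : Module.Basis (Multiset (OddNat × ConjClasses Γ)) ℂ (SMinus Γ) :=
  (genBasis Γ).symmetricAlgebra.reindex Multiset.toFinsupp.symm.toEquiv

theorem monBasis_apply (M : Multiset (OddNat × ConjClasses Γ)) : monBasis Γ M = mon M := by
  have h : monBasis Γ M = (SymmetricAlgebra.equivMvPolynomial (genBasis Γ)).symm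
      (MvPolynomial.monomial (Multiset.toFinsupp M) 1) := by
    rw [monBasis, Module.Basis.reindex_apply, Module.Basis.symmetricAlgebra, Module.Basis.map_apply,
      MvPolynomial.coe_basisMonomials]
    rfl
  rw [h]
  clear h
  induction M using Multiset.induction_on with
  | empty => simp [mon]
  | cons p M ih =>
    have h1 : MvPolynomial.monomial (Multiset.toFinsupp (p ::ₘ M)) (1 : ℂ) =
        MvPolynomial.X p * MvPolynomial.monomial (Multiset.toFinsupp M) 1 := by
      rw [← Multiset.singleton_add, Multiset.toFinsupp_add, Multiset.toFinsupp_singleton,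
        MvPolynomial.X, MvPolynomial.monomial_mul, one_mul]
    rw [h1, map_mul, ih, mon_cons, SymmetricAlgebra.equivMvPolynomial_symm_X, genBasis_apply]
    rfl

/-- The coefficient of a monomial. -/
def coeffS (M : Multiset (OddNat × ConjClasses Γ)) : SMinus Γ →ₗ[ℂ] ℂ := (monBasis Γ).coord M

theorem coeffS_mon (M M' : Multiset (OddNat × ConjClasses Γ)) :
    coeffS M (mon M') = if M' = M then 1 else 0 := by
  rw [← monBasis_apply, coeffS, Module.Basis.coord_apply, Module.Basis.repr_self,
    Finsupp.single_apply]

theorem linearMap_ext_mon {W : Type*} [AddCommGroup W] [Module ℂ W] {F G : SMinus Γ →ₗ[ℂ] W}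
    (h : ∀ M, F (mon M) = G (mon M)) : F = G :=
  (monBasis Γ).ext fun M => by rw [monBasis_apply, h]

theorem eq_top_of_mon_mem {N : Submodule ℂ (SMinus Γ)} (h : ∀ M, mon M ∈ N) : N = ⊤ := by
  rw [eq_top_iff, ← (monBasis Γ).span_eq, Submodule.span_le]
  rintro _ ⟨M, rfl⟩
  rw [monBasis_apply]
  exact h M

theorem mem_of_mon_mem {N : Submodule ℂ (SMinus Γ)} (s : SMinus Γ)
    (h : ∀ M, coeffS M s ≠ 0 → mon M ∈ N) : s ∈ N := by
  rw [← (monBasis Γ).linearCombination_repr s, Finsupp.linearCombination_apply]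
  refine Submodule.sum_mem _ fun M hM => N.smul_mem _ ?_
  rw [monBasis_apply]
  have h1 := Finsupp.mem_support_iff.1 hM
  exact h M h1

theorem finite_coeffS_ne_zero (s : SMinus Γ) : {M | coeffS M s ≠ 0}.Finite :=
  ((monBasis Γ).repr s).hasFiniteSupport

/-! ### Bijectivity of the characteristic map -/

/-- In the two bases `ch` is diagonal, so each coefficient of `ch v` reads off a single value of v.
-/
theorem coeffS_ch (ρ : OddPF Γ n) (v : RMinus Γ) :
    coeffS ρ.ms (ch Γ v) = chCoeff ρ.ms * (RMinus.component n v).1 ρ.rep := by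
  suffices h : coeffS ρ.ms ∘ₗ ch Γ = chCoeff ρ.ms •
      (LinearMap.proj ρ.rep ∘ₗ (SuperFn Γ n).subtype ∘ₗ RMinus.component n) from
    DFunLike.congr_fun h v
  refine linearMap_ext_basisFn fun M => ?_
  rw [LinearMap.comp_apply, ch_of, chN_basisFn rfl, map_smul, coeffS_mon, LinearMap.smul_apply]
  change chCoeff M * _ = chCoeff ρ.ms *
    (RMinus.component n (RMinus.of (weight M) (basisFn (weight M) M))).1 ρ.rep
  by_cases h : weight M = n
  · rw [h, component_of_self, basisFn_rep]
    by_cases hM : M = ρ.ms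
    · rw [if_pos hM, if_pos hM.symm, hM]
    · rw [if_neg hM, if_neg (Ne.symm hM), mul_zero, mul_zero]
  · rw [component_of_ne _ h, if_neg, mul_zero]
    · exact (mul_zero _).symm
    · rintro rfl
      exact h ρ.weight_ms

theorem ch_bijective : Function.Bijective (ch Γ) := by
  constructor
  · rw [← LinearMap.ker_eq_bot, LinearMap.ker_eq_bot']
    intro v hv
    refine rMinus_ext fun n => ?_
    rw [map_zero, superFn_eq_sum (RMinus.component n v)]
    refine Finset.sum_eq_zero fun ρ _ => ?_
    have h := coeffS_ch ρ v
    rw [hv, map_zero] at h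
    rw [(mul_eq_zero.1 h.symm).resolve_left (chCoeff_ne_zero _), zero_smul]
  · rw [← LinearMap.range_eq_top]
    refine eq_top_of_mon_mem fun M => ⟨(chCoeff M)⁻¹ • RMinus.of (weight M) (basisFn _ M), ?_⟩
    rw [map_smul, ch_of, chN_basisFn rfl, smul_smul, inv_mul_cancel₀ (chCoeff_ne_zero M), one_smul]

/-! ### The radicals -/

/-- No pair in `M` has a class at which `ξ` vanishes. -/
def IsGood (ξ : SelfDual Γ) (M : Multiset (OddNat × ConjClasses Γ)) : Prop :=
  ∀ p ∈ M, valAt ξ.fn p.2 ≠ 0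

theorem wform_classDelta_eq_zero (ξ : SelfDual Γ) {c : ConjClasses Γ} (h : valAt ξ.fn c = 0) :
    wform ξ (classDelta c) = 0 := by
  refine LinearMap.ext fun γ => ?_
  rw [wform_symm, wform_classDelta, valAt_invClass, h, zero_mul, LinearMap.zero_apply]

theorem mul_mem_SZero {ξ : SelfDual Γ} (s : SMinus Γ) {t : SMinus Γ} (h : t ∈ SZero ξ) :
    s * t ∈ SZero ξ := Ideal.mul_mem_left _ _ h

theorem gen_mem_SZero {ξ : SelfDual Γ} (n : OddNat) {γ : ClassFn Γ} (h : wform ξ γ = 0) :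
    gen n γ ∈ SZero ξ := Ideal.subset_span ⟨n, γ, h, rfl⟩

/-- Elements of the ideal are sums of multiples of the generators, so an additive property need only
be checked on one multiple at a time. -/
theorem SZero_induction {ξ : SelfDual Γ} {P : SMinus Γ → Prop} (h0 : P 0)
    (hadd : ∀ s t, P s → P t → P (s + t))
    (hgen : ∀ n γ s, wform ξ γ = 0 → P (s * gen n γ)) {s : SMinus Γ} (hs : s ∈ SZero ξ) : P s := by
  -- P is not assumed to be stable under multiplication, so the induction is run for all multiples
  -- of s at once.
  have h : ∀ a : SMinus Γ, P (a * s) := by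
    refine Submodule.span_induction (p := fun s _ => ∀ a : SMinus Γ, P (a * s)) ?_ ?_ ?_ ?_ hs
    · rintro _ ⟨n, γ, hγ, rfl⟩ a
      exact hgen n γ a hγ
    · intro a
      rwa [mul_zero]
    · intro x y _ _ hx hy a
      rw [mul_add]
      exact hadd _ _ (hx a) (hy a)
    · intro b x _ hx a
      rw [smul_eq_mul, ← mul_assoc]
      exact hx _
  simpa using h 1

/-- An element γ of the radical has no component at a class with ξ(c) ≠ 0. Every monomial that
occurs in the product therefore contains a pair with ξ(c) = 0, and none of them is M. -/
theorem coeffS_gen_mul_eq_zero {ξ : SelfDual Γ} {M : Multiset (OddNat × ConjClasses Γ)}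
    (hM : IsGood ξ M) (n : OddNat) {γ : ClassFn Γ} (hγ : wform ξ γ = 0) (s : SMinus Γ) :
    coeffS M (s * gen n γ) = 0 := by
  suffices h : coeffS M ∘ₗ LinearMap.mulRight ℂ (gen n γ) = 0 from DFunLike.congr_fun h s
  refine linearMap_ext_mon fun M' => ?_
  rw [LinearMap.comp_apply, LinearMap.mulRight_apply, LinearMap.zero_apply,
    ← sum_valAt_smul_classDelta γ, map_sum, Finset.mul_sum, map_sum]
  refine Finset.sum_eq_zero fun c _ => ?_
  rw [map_smul, mul_smul_comm, map_smul, mul_comm (mon M'), ← mon_cons (n, c), coeffS_mon]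
  split_ifs with h
  · have h1 := wform_classDelta ξ γ (invClass c)
    rw [invClass_invClass, hγ, LinearMap.zero_apply] at h1
    have h2 := hM (n, c) (h ▸ Multiset.mem_cons_self _ _)
    rw [(mul_eq_zero.1 h1.symm).resolve_left h2]
    simp
  · rw [smul_zero]

/-- The ideal is spanned by the monomials containing a pair with ξ(c) = 0: such a monomial is a
multiple of a generator, because ζ_c 1_c then lies in the radical. -/
theorem mem_SZero_iff {ξ : SelfDual Γ} {s : SMinus Γ} :
    s ∈ SZero ξ ↔ ∀ M, IsGood ξ M → coeffS M s = 0 := by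
  constructor
  · intro hs M hM
    refine SZero_induction (P := fun s => coeffS M s = 0) (map_zero _) (fun s t hs ht => ?_)
      (fun n γ s hγ => coeffS_gen_mul_eq_zero hM n hγ s) hs
    rw [map_add, hs, ht, add_zero]
  · intro h
    refine mem_of_mon_mem s fun M hM => ?_
    have h1 : ¬ IsGood ξ M := fun h2 => hM (h M h2)
    simp only [IsGood, not_forall, not_not] at h1
    obtain ⟨p, hp, hξ⟩ := h1
    obtain ⟨M, rfl⟩ := Multiset.exists_cons_of_mem hp
    rw [mon_cons, mul_comm]
    exact mul_mem_SZero _ (gen_mem_SZero _ (wform_classDelta_eq_zero ξ hξ))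

theorem formR_of (ξ : SelfDual Γ) (v : RMinus Γ) (g : SuperFn Γ n) :
    formR ξ v (RMinus.of n g) = wformN ξ n (RMinus.component n v) g := by
  suffices h : (formR ξ).flip (RMinus.of n g) = (wformN ξ n).flip g ∘ₗ RMinus.component n from
    DFunLike.congr_fun h v
  refine linearMap_ext_basisFn fun M => ?_
  have h1 : ∀ f : SuperFn Γ (weight M), (formR ξ).flip (RMinus.of n g) (RMinus.of (weight M) f) =
      wformN ξ (weight M) f (RMinus.component (weight M) (RMinus.of n g)) := fun f => by
    simp [formR, RMinus.sumMap, RMinus.of]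
  rw [h1, LinearMap.comp_apply, LinearMap.flip_apply]
  by_cases h : weight M = n
  · subst h
    rw [component_of_self, component_of_self]
  · rw [component_of_ne _ h, component_of_ne _ (Ne.symm h), map_zero, map_zero,
      LinearMap.zero_apply]

/-- Passing to inverse classes compensates for the argument x⁻¹, so only elements with the cycle
types of ρ contribute. They contribute equally, since the sign of f cancels that of the basis
function, and the pairing isolates the value f(ρ). -/
theorem wformN_basisFn_dual (ξ : SelfDual Γ) (f : SuperFn Γ n) (ρ : OddPF Γ n) :
    wformN ξ n f (basisFn n (ρ.ms.map dualPair)) =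
      (Fintype.card (SpinWr Γ n) : ℂ)⁻¹ *
        (Finset.univ.filter fun x : SpinWr Γ n => cycleTypes x = toTypes ρ.ms).card *
        (ρ.ms.map fun p => valAt ξ.fn p.2).prod * f.1 ρ.rep := by
  have h : ∀ x : SpinWr Γ n, eta ξ x * f.1 x * (basisFn n (ρ.ms.map dualPair)).1 x⁻¹ =
      if cycleTypes x = toTypes ρ.ms then
        (ρ.ms.map fun p => valAt ξ.fn p.2).prod * f.1 ρ.rep else 0 := fun x => by
    rw [basisFn_apply]
    simp only [cycleTypes_inv_eq_iff]
    split_ifs with hx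
    · rw [eta_eq_of_cycleTypes ξ hx, superFn_eq_normSign_mul f ρ hx, normSign_inv]
      linear_combination (ρ.ms.map fun p => valAt ξ.fn p.2).prod * f.1 ρ.rep *
        normSign_sq (odd_of_cycleTypes_eq hx)
    · rw [mul_zero]
  rw [wformN, LinearMap.mk₂_apply, Finset.sum_congr rfl fun x _ => h x, ← Finset.sum_filter,
    Finset.sum_const, nsmul_eq_mul]
  ring

/-- Pairing v with the dual basis function gives the value at ρ times the product of the ξ(c), which
is nonzero for good ρ. Conversely η vanishes on the types that are not good and v on those with an
even cycle, so if v is zero on the good types every summand of the form is zero. -/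
theorem mem_RZero_iff {ξ : SelfDual Γ} {v : RMinus Γ} :
    v ∈ RZero ξ ↔ ∀ (n : ℕ) (ρ : OddPF Γ n), IsGood ξ ρ.ms →
      (RMinus.component n v).1 ρ.rep = 0 := by
  rw [RZero, LinearMap.mem_ker]
  constructor
  · intro h n ρ hρ
    have h1 := formR_of ξ v (basisFn n (ρ.ms.map dualPair))
    rw [h, LinearMap.zero_apply, wformN_basisFn_dual] at h1
    refine (mul_eq_zero.1 h1.symm).resolve_left (mul_ne_zero (mul_ne_zero ?_ ?_) ?_)
    · exact inv_ne_zero (by exact_mod_cast Fintype.card_ne_zero)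
    · have : 0 < (Finset.univ.filter fun x : SpinWr Γ n => cycleTypes x = toTypes ρ.ms).card :=
        Finset.card_pos.2 ⟨ρ.rep, by simp [ρ.cycleTypes_rep]⟩
      exact_mod_cast this.ne'
    · refine Multiset.prod_ne_zero fun h2 => ?_
      obtain ⟨p, hp, h3⟩ := Multiset.mem_map.1 h2
      exact hρ p hp h3
  · intro h
    refine linearMap_ext_basisFn fun M => ?_
    rw [formR_of, LinearMap.zero_apply, wformN, LinearMap.mk₂_apply, Finset.sum_eq_zero, mul_zero]
    intro x _
    by_cases hx : ∃ M, cycleTypes x = toTypes M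
    · obtain ⟨M', hM⟩ := hx
      obtain ⟨ρ, rfl⟩ := OddPF.exists_ms_eq (weight_eq_of_cycleTypes hM)
      by_cases hρ : IsGood ξ ρ.ms
      · rw [superFn_eq_normSign_mul _ ρ hM, h _ ρ hρ, zero_mul, mul_zero, zero_mul]
      · simp only [IsGood, not_forall, not_not] at hρ
        obtain ⟨p, hp, h0⟩ := hρ
        rw [eta_eq_of_cycleTypes ξ hM, Multiset.prod_eq_zero (Multiset.mem_map.2 ⟨p, hp, h0⟩),
          zero_mul, zero_mul]
    · rw [superFn_eq_zero_of_not_odd _ x hx, mul_zero, zero_mul]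

theorem ch_mem_SZero_iff {ξ : SelfDual Γ} {v : RMinus Γ} : ch Γ v ∈ SZero ξ ↔ v ∈ RZero ξ := by
  rw [mem_SZero_iff, mem_RZero_iff]
  constructor
  · intro h n ρ hρ
    have h1 := h _ hρ
    rw [coeffS_ch] at h1
    exact (mul_eq_zero.1 h1).resolve_left (chCoeff_ne_zero _)
  · intro h M hM
    obtain ⟨ρ, hρ⟩ := OddPF.exists_ms_eq (Γ := Γ) (M := M) rfl
    rw [← hρ] at hM ⊢
    rw [coeffS_ch, h _ ρ hM, mul_zero]

end MonomialBasis

/-! ## The Fock representation -/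

section FockRepresentation

variable {Γ : Type*} [Group Γ]

theorem mon_zero : mon (0 : Multiset (OddNat × ConjClasses Γ)) = 1 := rfl

variable [Fintype Γ] {ξ : SelfDual Γ}

theorem fock_apply (x : Heis ξ) (s : SMinus Γ) :
    fock ξ x s = fockA ξ (Heis.fstₗ x) s + Heis.sndₗ x • s := rfl

theorem fock_a (m : OddInt) (γ : ClassFn Γ) :
    fock ξ (Heis.a m γ) = fockA ξ (Finsupp.single m γ) := by
  refine LinearMap.ext fun s => ?_
  rw [fock_apply]
  change _ + (0 : ℂ) • s = _
  rw [zero_smul, add_zero]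
  rfl

theorem fock_C : fock ξ Heis.C = 1 := by
  refine LinearMap.ext fun s => ?_
  rw [fock_apply]
  change fockA ξ 0 s + (1 : ℂ) • s = s
  rw [map_zero, LinearMap.zero_apply, zero_add, one_smul]

/-- Creation operators multiply, so they preserve the ideal. An annihilation operator is a
derivation which kills a_{-n}(γ') for γ' in the radical, so it maps multiples of this generator to
such multiples. -/
theorem isSubrep_SZero (ξ : SelfDual Γ) : IsSubrep (fock ξ) (SZero ξ) := by
  intro x s hs
  rw [fock_apply]
  refine Submodule.add_mem _ ?_ (Submodule.smul_mem _ _ hs)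
  induction Heis.fstₗ x using Finsupp.induction_linear with
  | zero => rw [map_zero]; exact Submodule.zero_mem _
  | add u v hu hv => rw [map_add]; exact Submodule.add_mem _ hu hv
  | single m γ =>
    by_cases hm : 0 < m.1
    · rw [fockA_pos ξ m hm]
      refine SZero_induction (P := fun s => symDer (annFunctional ξ m.abs γ) s ∈ SZero ξ)
        (by rw [map_zero]; exact Submodule.zero_mem _)
        (fun s t hs ht => by rw [map_add]; exact Submodule.add_mem _ hs ht)
        (fun n γ' s hγ => ?_) hs
      rw [Derivation.leibniz, symDer_ann_gen, wform_symm, hγ, LinearMap.zero_apply, mul_zero,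
        ite_self, map_zero, smul_zero, zero_add, smul_eq_mul, mul_comm]
      exact mul_mem_SZero _ (gen_mem_SZero n hγ)
    · have h0 : m.1 ≠ 0 := fun h => by have := m.2; simp [h] at this
      rw [fockA_neg ξ m (by omega)]
      exact mul_mem_SZero _ hs

/-- A positive odd number as an odd integer. -/
def OddNat.toOddInt (k : OddNat) : OddInt := ⟨k.1, by exact_mod_cast k.2⟩

/-- The annihilation operator lowering the exponent of the variable `p`. -/
theorem coeffS_symDer (ξ : SelfDual Γ) (p : OddNat × ConjClasses Γ)
    (M : Multiset (OddNat × ConjClasses Γ)) (s : SMinus Γ) :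
    coeffS M (symDer (annFunctional ξ p.1 (classDelta (invClass p.2))) s) =
      ((M.count p : ℂ) + 1) * ((p.1.1 : ℂ) / 2 * (valAt ξ.fn p.2 * zeta p.2)) *
        coeffS (p ::ₘ M) s := by
  suffices h : coeffS M ∘ₗ (symDer (annFunctional ξ p.1 (classDelta (invClass p.2)))).toLinearMap =
      (((M.count p : ℂ) + 1) * ((p.1.1 : ℂ) / 2 * (valAt ξ.fn p.2 * zeta p.2))) •
        coeffS (p ::ₘ M) from DFunLike.congr_fun h s
  obtain ⟨k, d⟩ := p
  have hδ : ∀ c, wform ξ (classDelta (invClass d)) (classDelta c) =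
      if c = d then valAt ξ.fn d * zeta d else 0 := fun c => by
    rw [wform_classDelta, valAt_invClass]
    by_cases h : c = d
    · subst h
      rw [if_pos rfl]
      congr 1
      exact (if_pos (mk_out _)).trans (by rw [zeta_invClass])
    · rw [if_neg h]
      refine mul_eq_zero_of_right _ (if_neg fun h' => h ?_)
      have h1 := (mk_out _).symm.trans h'
      rw [← invClass_invClass c, h1, invClass_invClass]
  refine linearMap_ext_mon fun M' => ?_
  rw [LinearMap.comp_apply, LinearMap.smul_apply, smul_eq_mul, coeffS_mon]
  change coeffS M (symDer _ (mon M')) = _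
  simp only [symDer_mon, hδ]
  rw [Finset.sum_eq_single d, if_pos rfl, map_smul, coeffS_mon, smul_eq_mul]
  · by_cases hm : (k, d) ∈ M'
    · obtain ⟨M', rfl⟩ := Multiset.exists_cons_of_mem hm
      rw [Multiset.erase_cons_head, Multiset.count_cons_self]
      by_cases h : M' = M
      · subst h
        simp
      · rw [if_neg h, if_neg fun h' => h ((Multiset.cons_inj_right _).1 h'), mul_zero, mul_zero]
    · rw [Multiset.count_eq_zero_of_notMem hm, if_neg fun (h : M' = (k, d) ::ₘ M) =>
        hm (h ▸ Multiset.mem_cons_self _ _)]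
      simp
  · intro c _ hc
    rw [if_neg hc, mul_zero, mul_zero, zero_smul]
  · simp

/-- One annihilation operator is applied for each pair of M, at the inverse class. By
`coeffS_symDer` each shifts the coefficients by its pair, with a factor that is nonzero because M is
good. The constant r depends on M' through the multiplicities. -/
theorem exists_mem_coeffS_shift {N : Submodule ℂ (SMinus Γ)} (hN : IsSubrep (fock ξ) N)
    {M : Multiset (OddNat × ConjClasses Γ)} (hM : IsGood ξ M) {s : SMinus Γ} (hs : s ∈ N) :
    ∃ t ∈ N, ∀ M', ∃ r : ℂ, r ≠ 0 ∧ coeffS M' t = r * coeffS (M + M') s := by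
  induction M using Multiset.induction_on with
  | empty => exact ⟨s, hs, fun M' => ⟨1, one_ne_zero, by rw [zero_add, one_mul]⟩⟩
  | cons p M ih =>
    obtain ⟨t, ht, h⟩ := ih fun q hq => hM q (Multiset.mem_cons_of_mem hq)
    have hpos : 0 < (OddNat.toOddInt p.1).1 := by
      change (0 : ℤ) < p.1.1
      exact_mod_cast p.1.2.pos
    have h1 := hN (Heis.a (OddNat.toOddInt p.1) (classDelta (invClass p.2))) t ht
    rw [fock_a, fockA_pos ξ _ hpos] at h1
    have habs : (OddNat.toOddInt p.1).abs = p.1 := Subtype.ext (Int.natAbs_natCast _)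
    rw [habs] at h1
    refine ⟨_, h1, fun M' => ?_⟩
    obtain ⟨r, hr, h2⟩ := h (p ::ₘ M')
    refine ⟨((M'.count p : ℂ) + 1) * ((p.1.1 : ℂ) / 2 * (valAt ξ.fn p.2 * zeta p.2)) * r, ?_, ?_⟩
    · have h3 : (p.1.1 : ℂ) ≠ 0 := by exact_mod_cast p.1.2.pos.ne'
      have h4 : ((M'.count p : ℂ) + 1) ≠ 0 := by exact_mod_cast Nat.succ_ne_zero (M'.count p)
      exact mul_ne_zero (mul_ne_zero h4 (mul_ne_zero (div_ne_zero h3 two_ne_zero)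
        (mul_ne_zero (hM p (Multiset.mem_cons_self _ _)) (zeta_ne_zero _)))) hr
    · rw [coeffS_symDer, h2, Multiset.add_cons, Multiset.cons_add, mul_assoc _ r]

/-- The creation operators build every monomial from 1, one factor at a time. -/
theorem eq_top_of_one_mem {N : Submodule ℂ (SMinus Γ)} (hN : IsSubrep (fock ξ) N)
    (h : (1 : SMinus Γ) ∈ N) : N = ⊤ := by
  refine eq_top_of_mon_mem fun M => ?_
  induction M using Multiset.induction_on with
  | empty => exact h
  | cons p M ih =>
    have hneg : (-OddNat.toOddInt p.1).1 < 0 := by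
      change -(p.1.1 : ℤ) < 0
      have := p.1.2.pos
      omega
    have h1 := hN (Heis.a (-OddNat.toOddInt p.1) (classDelta p.2)) _ ih
    have habs : (-OddNat.toOddInt p.1).abs = p.1 :=
      Subtype.ext ((Int.natAbs_neg _).trans (Int.natAbs_natCast _))
    rw [fock_a, fockA_neg ξ _ hneg, habs] at h1
    rwa [mon_cons]

theorem one_notMem_SZero (ξ : SelfDual Γ) : (1 : SMinus Γ) ∉ SZero ξ := fun h => by
  have h1 := mem_SZero_iff.1 h 0 fun p hp => absurd hp (Multiset.notMem_zero p)
  rw [← mon_zero, coeffS_mon, if_pos rfl] at h1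
  exact one_ne_zero h1

/-- Modulo S⁰_Γ only good monomials matter. An element of N outside S⁰_Γ can be lowered to a nonzero
constant modulo S⁰_Γ; as S⁰_Γ is contained in N, this puts 1 into N. -/
theorem eq_SZero_or_eq_top {N : Submodule ℂ (SMinus Γ)} (hN : IsSubrep (fock ξ) N)
    (h0 : SZero ξ ≤ N) : N = SZero ξ ∨ N = ⊤ := by
  by_cases hle : N ≤ SZero ξ
  · exact Or.inl (le_antisymm hle h0)
  · refine Or.inr (eq_top_of_one_mem hN ?_)
    obtain ⟨s, hs, hs0⟩ := Set.not_subset.1 hle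
    have hfin : {M | IsGood ξ M ∧ coeffS M s ≠ 0}.Finite :=
      (finite_coeffS_ne_zero s).subset fun M h => h.2
    have hne : hfin.toFinset.Nonempty := by
      by_contra h
      refine hs0 (mem_SZero_iff.2 fun M hM => ?_)
      by_contra hc
      exact h ⟨M, hfin.mem_toFinset.2 ⟨hM, hc⟩⟩
    -- A good M with the most parts is chosen: any other good monomial surviving the shift by M
    -- would come from a good M + M' with more parts and a nonzero coefficient.
    obtain ⟨M, hM, hmax⟩ := Finset.exists_max_image hfin.toFinset Multiset.card hne
    obtain ⟨hgood, hc⟩ := hfin.mem_toFinset.1 hM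
    obtain ⟨t, ht, h⟩ := exists_mem_coeffS_shift hN hgood hs
    obtain ⟨r, hr, hr0⟩ := h 0
    rw [add_zero] at hr0
    -- The subtracted constant is the coefficient of t at the empty monomial, the only good one
    -- left; the difference has no good monomial.
    have h1 : t - (r * coeffS M s) • (1 : SMinus Γ) ∈ SZero ξ := by
      refine mem_SZero_iff.2 fun M' hM' => ?_
      rw [map_sub, map_smul, ← mon_zero, coeffS_mon]
      split_ifs with hz
      · rw [← hz, hr0, smul_eq_mul, mul_one, sub_self]
      · obtain ⟨r', _, h2⟩ := h M'
        rw [h2, smul_zero, sub_zero]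
        by_contra hne
        have h3 := hmax (M + M') (hfin.mem_toFinset.2
          ⟨fun p hp => (Multiset.mem_add.1 hp).elim (hgood p) (hM' p), right_ne_zero_of_mul hne⟩)
        rw [Multiset.card_add] at h3
        exact hz (Multiset.card_eq_zero.1 (by omega)).symm
    have h2 := N.sub_mem ht (h0 h1)
    rw [sub_sub_cancel] at h2
    exact (N.smul_mem_iff (mul_ne_zero hr hc)).1 h2

end FockRepresentation

/-! ### Transport of representations, and irreducibility of quotients -/

section Transfer

variable {L : Type*} [LieRing L] [LieAlgebra ℂ L]
variable {V : Type*} [AddCommGroup V] [Module ℂ V] {W : Type*} [AddCommGroup W] [Module ℂ W]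

/-- A representation transported along a linear equivalence. -/
def transport (e : V ≃ₗ[ℂ] W) (τ : L →ₗ⁅ℂ⁆ Module.End ℂ W) : L →ₗ⁅ℂ⁆ Module.End ℂ V where
  toFun x := e.symm.toLinearMap ∘ₗ τ x ∘ₗ e.toLinearMap
  map_add' x y := by ext v; simp
  map_smul' r x := by ext v; simp
  map_lie' {x y} := by ext v; simp [Ring.lie_def]

variable {ρ : L →ₗ⁅ℂ⁆ Module.End ℂ V} {τ : L →ₗ⁅ℂ⁆ Module.End ℂ W} {f : V →ₗ[ℂ] W}
  {N : Submodule ℂ V} {N' : Submodule ℂ W}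

/-- The direction of `hmem` from N' back to N is what gives surjectivity here; in the quotient it
gives injectivity. -/
theorem IsRepIso.subRep (h : IsRepIso ρ τ f) (hN : IsSubrep ρ N) (hN' : IsSubrep τ N')
    (hmem : ∀ v, f v ∈ N' ↔ v ∈ N) (hf : ∀ v ∈ N, f v ∈ N') :
    IsRepIso (subRep ρ N hN) (subRep τ N' hN') (f.restrict hf) := by
  refine ⟨⟨fun u v huv => ?_, fun w => ?_⟩, fun x v => Subtype.ext (h.2 x v.1)⟩
  · exact Subtype.ext (h.1.1 (congrArg Subtype.val huv))
  · obtain ⟨v, hv⟩ := h.1.2 w.1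
    exact ⟨⟨v, (hmem v).1 (hv ▸ w.2)⟩, Subtype.ext hv⟩

theorem IsRepIso.quotRep (h : IsRepIso ρ τ f) (hN : IsSubrep ρ N) (hN' : IsSubrep τ N')
    (hmem : ∀ v, f v ∈ N' ↔ v ∈ N) (hf : ∀ v ∈ N, f v ∈ N') :
    IsRepIso (quotRep ρ N hN) (quotRep τ N' hN') (N.mapQ N' f hf) := by
  refine ⟨⟨?_, fun w => ?_⟩, fun x v => ?_⟩
  · rw [← LinearMap.ker_eq_bot, LinearMap.ker_eq_bot']
    intro v hv
    obtain ⟨v, rfl⟩ := N.mkQ_surjective v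
    rw [Submodule.mkQ_apply, Submodule.mapQ_apply, Submodule.Quotient.mk_eq_zero] at hv
    exact (Submodule.Quotient.mk_eq_zero N).2 ((hmem v).1 hv)
  · obtain ⟨w, rfl⟩ := N'.mkQ_surjective w
    obtain ⟨v, rfl⟩ := h.1.2 w
    exact ⟨N.mkQ v, rfl⟩
  · obtain ⟨v, rfl⟩ := N.mkQ_surjective v
    exact congrArg N'.mkQ (h.2 x v)

/-- Images of subrepresentations are subrepresentations, and injectivity recovers a subspace as the
preimage of its image. -/
theorem IsRepIso.isIrreducibleRep (h : IsRepIso ρ τ f) (hτ : IsIrreducibleRep τ) :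
    IsIrreducibleRep ρ := by
  obtain ⟨_, hτ⟩ := hτ
  refine ⟨h.1.2.nontrivial, fun N hN => ?_⟩
  have h1 : IsSubrep τ (N.map f) := by
    rintro x _ ⟨v, hv, rfl⟩
    exact ⟨ρ x v, hN x v hv, h.2 x v⟩
  refine (hτ _ h1).imp (fun h2 => ?_) (fun h2 => ?_)
  · rw [← Submodule.comap_map_eq_of_injective h.1.1 N, h2, Submodule.comap_bot,
      LinearMap.ker_eq_bot.2 h.1.1]
  · rw [← Submodule.comap_map_eq_of_injective h.1.1 N, h2, Submodule.comap_top]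

/-- Subrepresentations of the quotient correspond to the subrepresentations that contain N, by
taking preimages. -/
theorem isIrreducibleRep_quotRep (hN : IsSubrep ρ N) (hne : N ≠ ⊤)
    (h : ∀ N₁ : Submodule ℂ V, IsSubrep ρ N₁ → N ≤ N₁ → N₁ = N ∨ N₁ = ⊤) :
    IsIrreducibleRep (quotRep ρ N hN) := by
  refine ⟨Submodule.Quotient.nontrivial_iff.2 hne, fun N₁ hN₁ => ?_⟩
  have h1 : IsSubrep ρ (N₁.comap N.mkQ) := fun x v hv => hN₁ x _ hv
  have h2 : N ≤ N₁.comap N.mkQ := fun v hv => by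
    rw [Submodule.mem_comap, Submodule.mkQ_apply, (Submodule.Quotient.mk_eq_zero N).2 hv]
    exact N₁.zero_mem
  have h3 := Submodule.map_comap_eq_of_surjective N.mkQ_surjective N₁
  refine (h _ h1 h2).imp (fun h4 => ?_) (fun h4 => ?_)
  · rw [← h3, h4, Submodule.mkQ_map_self]
  · rw [← h3, h4, Submodule.map_top, Submodule.range_mkQ]

end Transfer

/-! ### The representation on R⁻_Γ -/

section Main

variable {Γ : Type*} [Group Γ] [Fintype Γ]

variable (Γ) in
/-- The characteristic map as a linear equivalence. -/
def chEquiv : RMinus Γ ≃ₗ[ℂ] SMinus Γ := LinearEquiv.ofBijective (ch Γ) ch_bijective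

theorem ch_aTilde (ξ : SelfDual Γ) (n : OddInt) (γ : ClassFn Γ) (v : RMinus Γ) :
    ch Γ (aTilde ξ n γ v) = fock ξ (Heis.a n γ) (ch Γ v) := by
  rw [aTilde, fock_a]
  split_ifs with hn
  · rw [ch_lowerOp_sigma, fockA_pos ξ n hn]
  · have h0 : n.1 ≠ 0 := fun h => by have := n.2; simp [h] at this
    rw [ch_raiseOp_sigma, fockA_neg ξ n (by omega)]

/-- The representation on `R⁻_Γ`. -/
def repR (ξ : SelfDual Γ) : Heis ξ →ₗ⁅ℂ⁆ Module.End ℂ (RMinus Γ) := transport (chEquiv Γ) (fock ξ)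

theorem ch_repR (ξ : SelfDual Γ) (x : Heis ξ) (v : RMinus Γ) :
    ch Γ (repR ξ x v) = fock ξ x (ch Γ v) :=
  (chEquiv Γ).apply_symm_apply _

/-- The transported action is a representation by construction. It agrees with the operators of
`aTilde` because both become the Fock operators after applying the injective map `ch`, so no
commutator on R⁻_Γ has to be computed. -/
theorem repR_a (ξ : SelfDual Γ) (n : OddInt) (γ : ClassFn Γ) :
    repR ξ (Heis.a n γ) = aTilde ξ n γ :=
  LinearMap.ext fun v => ch_bijective.1 (by rw [ch_repR, ch_aTilde])

theorem repR_C (ξ : SelfDual Γ) : repR ξ Heis.C = 1 :=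
  LinearMap.ext fun v => ch_bijective.1 (by rw [ch_repR, fock_C]; rfl)

theorem isRepIso_ch (ξ : SelfDual Γ) : IsRepIso (repR ξ) (fock ξ) (ch Γ) :=
  ⟨ch_bijective, ch_repR ξ⟩

theorem isSubrep_RZero (ξ : SelfDual Γ) : IsSubrep (repR ξ) (RZero ξ) := fun x v hv => by
  rw [← ch_mem_SZero_iff, ch_repR]
  exact isSubrep_SZero ξ x _ (ch_mem_SZero_iff.2 hv)

theorem isIrreducibleRep_fock_quotient (ξ : SelfDual Γ) :
    IsIrreducibleRep (quotRep (fock ξ) (SZero ξ) (isSubrep_SZero ξ)) :=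
  isIrreducibleRep_quotRep _ (fun h => one_notMem_SZero ξ (h ▸ Submodule.mem_top))
    fun _ hN h0 => eq_SZero_or_eq_top hN h0

end Main

end SpinWreath

end

theorem mainTheorem6 {Γ : Type*} [Group Γ] [Fintype Γ] (ξ : SpinWreath.SelfDual Γ) :
    ∃ ρ : SpinWreath.Heis ξ →ₗ⁅ℂ⁆ Module.End ℂ (SpinWreath.RMinus Γ),
      (∀ (n : SpinWreath.OddInt) (γ : SpinWreath.ClassFn Γ),
        ρ (SpinWreath.Heis.a n γ) = SpinWreath.aTilde ξ n γ) ∧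
      ρ SpinWreath.Heis.C = 1 ∧
      ∃ (hR : SpinWreath.IsSubrep ρ (SpinWreath.RZero ξ))
        (hS : SpinWreath.IsSubrep (SpinWreath.fock ξ) (SpinWreath.SZero ξ)),
        SpinWreath.IsIrreducibleRep (SpinWreath.quotRep ρ (SpinWreath.RZero ξ) hR) ∧
        SpinWreath.IsRepIso ρ (SpinWreath.fock ξ) (SpinWreath.ch Γ) ∧
        ∃ hch : ∀ v ∈ SpinWreath.RZero ξ, SpinWreath.ch Γ v ∈ SpinWreath.SZero ξ,
          SpinWreath.IsRepIso (SpinWreath.subRep ρ (SpinWreath.RZero ξ) hR)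
            (SpinWreath.subRep (SpinWreath.fock ξ) (SpinWreath.SZero ξ) hS)
            ((SpinWreath.ch Γ).restrict hch) ∧
          SpinWreath.IsRepIso (SpinWreath.quotRep ρ (SpinWreath.RZero ξ) hR)
            (SpinWreath.quotRep (SpinWreath.fock ξ) (SpinWreath.SZero ξ) hS)
            (Submodule.mapQ (SpinWreath.RZero ξ) (SpinWreath.SZero ξ) (SpinWreath.ch Γ) hch) :=
  have hch : ∀ v, SpinWreath.ch Γ v ∈ SpinWreath.SZero ξ ↔ v ∈ SpinWreath.RZero ξ := fun _ =>
    SpinWreath.ch_mem_SZero_iff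
  have hiso := (SpinWreath.isRepIso_ch ξ).quotRep (SpinWreath.isSubrep_RZero ξ)
    (SpinWreath.isSubrep_SZero ξ) hch fun v => (hch v).2
  ⟨SpinWreath.repR ξ, SpinWreath.repR_a ξ, SpinWreath.repR_C ξ, SpinWreath.isSubrep_RZero ξ,
    SpinWreath.isSubrep_SZero ξ,
    hiso.isIrreducibleRep (SpinWreath.isIrreducibleRep_fock_quotient ξ),
    SpinWreath.isRepIso_ch ξ, fun v => (hch v).2,
    (SpinWreath.isRepIso_ch ξ).subRep _ _ hch _, hiso⟩
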